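/- **Setting.** Let $\tau$ be a connected metric fatgraph with all valences $m_v\ge 3$ and edge lengths $L$; its boundary pieces $p$ are the punctures, with perimeters $a_p$. Let $F^c$ be the Riemann surface glued from neighbourhoods $U_v$ (coordinate $w$) of the vertices and disks $V_p=\{|y|<1\}$ around the punctures as follows. Number the half-edges at each vertex in counterclockwise order, put $c=e^{2\pi i(j-1)/m_v}$ for the $j$-th one, and $w=c\,z^{2/m_v}$ for $z$ in the stripe $0<\mathrm{Re}\,z<L$ of the corresponding edge. For an oriented edge from $v$ to $v'$ the overlap $U_v\cap U_{v'}$ is the stripe, and $$w'=f^0_{v',v}(w)=c'\,(L-z)^{2/m_{v'}},\qquad z=(w/c)^{m_v/2}.$$ On $U_v\cap V_p$ (a corner at $v$, beginning with the $k$-th edge of the boundary piece $p$, which leaves $v$ with $p$ on its left) $y=f^0_{p,v}(w)=\exp\big(\tfrac{2\pi i}{a_p}(L_1+\dots+L_{k-1}+z)\big)$. Overlaps are indexed by oriented edges and by corners, so that loops and multiple edges are allowed. Let $g^0_{v',v}\in U(1)$ be a graph connection with trivial monodromy around every boundary piece and let $\sum_p M_p\,p$ be a divisor supported at the punctures. Let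 $S$ be a complex Grassmann algebra with finitely many generators. Let $SF$ be a $(1|1)$-supermanifold over $S$ glued from superdomains over the $U_v$ (coordinates $(w,\xi)$) and the $V_p$, with transition functions $$w'=f_{v',v}(w+\xi\,\alpha_{v',v}(w)),\qquad \xi'=g_{v',v}(w)\,(\xi+\beta_{v',v}(w))\tag{1}$$ on $U_v\cap U_{v'}$ and transition functions of the same form on $U_v\cap V_p$, satisfying the cocycle conditions (inverse transitions for reversed edges, and compatibility on the triple overlaps $U_v\cap U_{v'}\cap V_p$). Here $f,g$ are even and $\alpha,\beta$ odd holomorphic $S$-valued functions; modulo the generators of $S$, $f$ becomes $f^0$, $g_{v',v}$ becomes $g^0_{v',v}$, and $g_{p,v}$ becomes $\mathrm{const}\cdot y^{M_p}$ with constants of modulus one. (In particular $\alpha,\beta$ may be deformations of odd Čech cocycles determined by odd parameters at the vertices.) For an edge from $v$ to $v'$ write $f,g,\alpha,\beta$ for the functions in (1), $g^{-1}$ for $w\mapsto g_{v',v}(w)^{-1}$ (also denoted $g_{v,v'}(w)$), and a prime on a function for $\partial_w$. An $N=2$ super Riemann surface is glued from superdomains of dimension $(1|2)$ by superconformal transitions,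 that is, transitions which satisfy $D_\pm=(D_\pm\theta'_\pm)D'_\pm$ with $D_\pm\theta'_\pm$ invertible, where $D_\pm=\partial_{\theta_\pm}+\tfrac12\theta_\mp\partial_z$. It corresponds to $SF$ if in all charts its quotient by the leaves of $D_-$, i.e. by the projection $(z,\theta_+,\theta_-)\mapsto(z+\tfrac12\theta_+\theta_-,\ \theta_+)$, is $SF$. **Theorem.** For every oriented edge from $v$ to $v'$ put, on $U_v\cap U_{v'}$, $$\epsilon_+=g\beta,\qquad \epsilon_-=f'\alpha\,g^{-1},\qquad q_+=g,$$ $$q_-=f'g^{-1}(1+\alpha\beta')+(g^{-1})'f'\beta\alpha,\qquad q=f+\tfrac12 f'\alpha\beta.\tag{2}$$ 1. These are holomorphic; $q,q_\pm$ are even, $\epsilon_\pm$ are odd, $q_\pm$ are invertible, and $q_+q_-=q'+\tfrac12(\epsilon_+\epsilon_-'+\epsilon_-\epsilon_+')$. 2. (1) can be written as $w'=\mathsf S+\xi V\varphi$, $\xi'=\psi+\xi V$ with holomorphic $\mathsf S,V$ (even) and $\varphi,\psi$ (odd), $V$ invertible, for which (2) are the Dolgikh–Rosly–Schwarz functions $\epsilon_+=\psi$,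 $q_+=V$, $\epsilon_-=\varphi$, $q_-=(\mathsf S'-\psi'\varphi)V^{-1}$, $q=\mathsf S+\tfrac12\varphi\psi$. 3. There is an $N=2$ super Riemann surface over the punctured surface, with charts over the same $U_v$ and $V_p$ and with transitions satisfying the same cocycle conditions, which corresponds to $SF$ and whose transition function along each oriented edge from $v$ to $v'$ is $$z'=q+\tfrac12\theta_-\epsilon_+q_-+\tfrac12\theta_+\epsilon_-q_++\tfrac14\theta_+\theta_-(\epsilon_+\epsilon_-)',$$ $$\theta'_+=\epsilon_++\theta_+q_++\tfrac12\theta_+\theta_-\epsilon_+',\qquad \theta'_-=\epsilon_-+\theta_-q_-+\tfrac12\theta_-\theta_+\epsilon_-'$$ (all functions evaluated at $z$). It is unique: every $N=2$ super Riemann surface over the same covering which corresponds to $SF$ has the same transition functions on all overlaps $U_v\cap U_{v'}$ and $U_v\cap V_p$. -/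

import Mathlib

noncomputable section

/-! ## Grassmann algebras -/

/-- The complex Grassmann algebra on `n` odd generators. -/
abbrev Gr (n : ℕ) : Type := ExteriorAlgebra ℂ (Fin n → ℂ)

namespace Gr

/-- Coordinates of an element of `Gr n` in the basis of monomials in the generators. -/
def coeffs (n : ℕ) : Gr n ≃ₗ[ℂ] (Finset (Fin n) → ℂ) :=
  ((Pi.basisFun ℂ (Fin n)).ExteriorAlgebra).equivFun

/-- `Gr n` is finite dimensional; it is normed by the largest coefficient, which serves only to
speak of holomorphic `Gr n`-valued functions and of their derivatives. -/
instance instNormedAddCommGroup (n : ℕ) : NormedAddCommGroup (Gr n) :=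
  NormedAddCommGroup.induced (Gr n) (Finset (Fin n) → ℂ) (coeffs n) (coeffs n).injective

instance instNormedSpace (n : ℕ) : NormedSpace ℂ (Gr n) :=
  NormedSpace.induced ℂ (Gr n) (Finset (Fin n) → ℂ) (coeffs n)

/-- The grading involution (`-1` on every generator). -/
def invol {n : ℕ} : Gr n →ₐ[ℂ] Gr n := CliffordAlgebra.involute

def IsEven {n : ℕ} (x : Gr n) : Prop := invol x = x

def IsOdd {n : ℕ} (x : Gr n) : Prop := invol x = -x

/-- The value modulo nilpotents (all generators set to `0`). -/
def body {n : ℕ} : Gr n →ₐ[ℂ] ℂ := ExteriorAlgebra.algebraMapInv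

/-- The `i`-th generator. -/
def gen {n : ℕ} (i : Fin n) : Gr n := ExteriorAlgebra.ι ℂ (Pi.single i 1)

/-- The odd part of an element. -/
def oddPart {n : ℕ} (x : Gr n) : Gr n := (1 / 2 : ℂ) • (x - invol x)

theorem invol_invol {n : ℕ} (x : Gr n) : invol (invol x) = x :=
  CliffordAlgebra.involute_involute x

theorem isOdd_oddPart {n : ℕ} (x : Gr n) : IsOdd (oddPart x) := by
  simp only [IsOdd, oddPart, map_smul, map_sub, invol_invol]
  rw [← smul_neg, neg_sub]

theorem isOdd_gen {n : ℕ} (i : Fin n) : IsOdd (gen i) :=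
  CliffordAlgebra.involute_ι _

theorem ι_mul_eq {n : ℕ} (m : Fin n → ℂ) (x : Gr n) :
    ExteriorAlgebra.ι ℂ m * x = invol x * ExteriorAlgebra.ι ℂ m := by
  induction x using ExteriorAlgebra.induction with
  | algebraMap r => rw [AlgHom.commutes, Algebra.commutes]
  | ι v =>
    have h1 : invol (ExteriorAlgebra.ι ℂ v) = -ExteriorAlgebra.ι ℂ v :=
      CliffordAlgebra.involute_ι _
    rw [h1, neg_mul]
    exact eq_neg_of_add_eq_zero_left (ExteriorAlgebra.ι_add_mul_swap _ _)
  | mul a b ha hb => rw [← mul_assoc, ha, mul_assoc, hb, ← mul_assoc, map_mul]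
  | add a b ha hb => rw [mul_add, ha, hb, map_add, add_mul]

theorem IsOdd.mul_eq {n : ℕ} {x : Gr n} (hx : IsOdd x) (y : Gr n) : x * y = invol y * x := by
  induction y using ExteriorAlgebra.induction with
  | algebraMap r => rw [AlgHom.commutes, Algebra.commutes]
  | ι v =>
    have h1 : invol (ExteriorAlgebra.ι ℂ v) = -ExteriorAlgebra.ι ℂ v :=
      CliffordAlgebra.involute_ι _
    rw [h1, neg_mul, ι_mul_eq, hx, neg_mul, neg_neg]
  | mul a b ha hb => rw [← mul_assoc, ha, mul_assoc, hb, ← mul_assoc, map_mul]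
  | add a b ha hb => rw [mul_add, ha, hb, map_add, add_mul]

theorem IsOdd.mul_self {n : ℕ} {x : Gr n} (hx : IsOdd x) : x * x = 0 := by
  have h := hx.mul_eq x
  rw [hx, neg_mul] at h
  have h2 : (2 : ℂ) • (x * x) = 0 := by
    rw [two_smul]
    exact add_eq_zero_iff_eq_neg.mpr h
  exact (smul_eq_zero.mp h2).resolve_left two_ne_zero

end Gr

/-! ## Superfunctions and maps of superdomains

The ground Grassmann algebra is `S = Gr N`.  A superfunction of one even coordinate and `k` odd
coordinates over `S` is a holomorphic function with values in `S ⊗ Λ[θ_0, …, θ_{k-1}] = Gr (N + k)`;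
the first `N` generators are those of `S` and the last `k` are the odd coordinates. -/

/-- The inclusion of `S` in `S[θ_0, …, θ_{k-1}]`. -/
def incl (N k : ℕ) : Gr N →ₐ[ℂ] Gr (N + k) :=
  ExteriorAlgebra.map (Function.ExtendByZero.linearMap ℂ (Fin.castAdd k))

/-- The odd coordinate `θ_i`. -/
def theta (N : ℕ) {k : ℕ} (i : Fin k) : Gr (N + k) := Gr.gen (Fin.natAdd N i)

/-- The left derivative `∂ / ∂θ_i`. -/
def dTheta (N : ℕ) {k : ℕ} (i : Fin k) : Gr (N + k) →ₗ[ℂ] Gr (N + k) :=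
  CliffordAlgebra.contractLeft (LinearMap.proj (Fin.natAdd N i))

theorem subst_aux {N k l : ℕ} (Θ : Fin l → Gr (N + k)) (m : Fin (N + l) → ℂ) :
    Fintype.linearCombination ℂ (Fin.append (fun a : Fin N => Gr.gen (Fin.castAdd k a))
        (fun i => Gr.oddPart (Θ i))) m *
      Fintype.linearCombination ℂ (Fin.append (fun a : Fin N => Gr.gen (Fin.castAdd k a))
        (fun i => Gr.oddPart (Θ i))) m = 0 := by
  apply Gr.IsOdd.mul_self
  rw [Gr.IsOdd, Fintype.linearCombination_apply, map_sum, ← Finset.sum_neg_distrib]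
  refine Finset.sum_congr rfl fun j _ => ?_
  rw [map_smul, ← smul_neg]
  congr 1
  induction j using Fin.addCases with
  | left a => rw [Fin.append_left]; exact Gr.isOdd_gen _
  | right i => rw [Fin.append_right]; exact Gr.isOdd_oddPart _

/-- The `S`-linear substitution `θ'_i ↦ Θ_i`, for odd `Θ_i` (the odd part is taken only to make
the definition total). -/
def subst {N k l : ℕ} (Θ : Fin l → Gr (N + k)) : Gr (N + l) →ₐ[ℂ] Gr (N + k) :=
  ExteriorAlgebra.lift ℂ ⟨Fintype.linearCombination ℂ
    (Fin.append (fun a : Fin N => Gr.gen (Fin.castAdd k a)) (fun i => Gr.oddPart (Θ i))),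
    subst_aux Θ⟩

/-- The value `F(Z)` of a holomorphic function `F` at an even element `Z`, by Taylor's formula at
the body of `Z`.  The nilpotent element `Z - body Z` of `Gr n` has `(n+1)`-st power zero, so that
the sum is the whole Taylor series. -/
def evalAt {n : ℕ} (F : ℂ → Gr n) (Z : Gr n) : Gr n :=
  ∑ j ∈ Finset.range (n + 1), ((j.factorial : ℂ)⁻¹) •
    (iteratedDeriv j F (Gr.body Z) * (Z - algebraMap ℂ (Gr n) (Gr.body Z)) ^ j)

/-- The coordinate expression `z' = even`, `θ'_i = odd i` of a map from a superdomain of dimension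
`(1|k)` to one of dimension `(1|l)`, over `S = Gr N`. -/
structure SuperMap (N k l : ℕ) where
  even : ℂ → Gr (N + k)
  odd : Fin l → ℂ → Gr (N + k)

namespace SuperMap

/-- The pull-back `F(z', θ')` of a superfunction `F`. -/
def pullback {N k l : ℕ} (Φ : SuperMap N k l) (F : ℂ → Gr (N + l)) (z : ℂ) : Gr (N + k) :=
  evalAt (fun ζ => subst (fun i => Φ.odd i z) (F ζ)) (Φ.even z)

/-- The composition `Ψ ∘ Φ`. -/
def comp {N k l m : ℕ} (Ψ : SuperMap N l m) (Φ : SuperMap N k l) : SuperMap N k m where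
  even := Φ.pullback Ψ.even
  odd := fun i => Φ.pullback (Ψ.odd i)

/-- The identity map. -/
def id (N k : ℕ) : SuperMap N k k where
  even := fun z => algebraMap ℂ _ z
  odd := fun i _ => theta N i

/-- Equality over `U`. -/
def EqOn {N k l : ℕ} (Φ Ψ : SuperMap N k l) (U : Set ℂ) : Prop :=
  Set.EqOn Φ.even Ψ.even U ∧ ∀ i, Set.EqOn (Φ.odd i) (Ψ.odd i) U

/-- `Φ` is a holomorphic map of superdomains over `U`, of the right parities and with underlying
map `f₀`. -/
structure IsHolomorphicOn {N k l : ℕ} (Φ : SuperMap N k l) (U : Set ℂ) (f₀ : ℂ → ℂ) : Prop where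
  differentiable_even : DifferentiableOn ℂ Φ.even U
  differentiable_odd : ∀ i, DifferentiableOn ℂ (Φ.odd i) U
  isEven : ∀ z ∈ U, Gr.IsEven (Φ.even z)
  isOdd : ∀ i, ∀ z ∈ U, Gr.IsOdd (Φ.odd i z)
  body_even : ∀ z ∈ U, Gr.body (Φ.even z) = f₀ z

end SuperMap

/-! ## `N = 2` superconformal maps

In dimension `(1|2)` the odd coordinates are `θ₊ = θ_0` and `θ₋ = θ_1`. -/

def thetaP (N : ℕ) : Gr (N + 2) := theta N (0 : Fin 2)

def thetaM (N : ℕ) : Gr (N + 2) := theta N (1 : Fin 2)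

/-- `D₊ = ∂_{θ₊} + (1/2) θ₋ ∂_z`. -/
def DP {N : ℕ} (F : ℂ → Gr (N + 2)) (z : ℂ) : Gr (N + 2) :=
  dTheta N (0 : Fin 2) (F z) + (1 / 2 : ℂ) • (thetaM N * deriv F z)

/-- `D₋ = ∂_{θ₋} + (1/2) θ₊ ∂_z`. -/
def DM {N : ℕ} (F : ℂ → Gr (N + 2)) (z : ℂ) : Gr (N + 2) :=
  dTheta N (1 : Fin 2) (F z) + (1 / 2 : ℂ) • (thetaP N * deriv F z)

/-- `Φ = (z', θ'₊, θ'₋)` preserves the two line bundles spanned by `D₊` and by `D₋`, that is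
`D₊ = (D₊ θ'₊) D'₊` and `D₋ = (D₋ θ'₋) D'₋` with invertible factors.  These identities of vector
fields are tested on the coordinate functions `z', θ'₊, θ'₋`, on which
`D'₊ z' = θ'₋ / 2`, `D'₊ θ'₊ = 1`, `D'₊ θ'₋ = 0`, and symmetrically for `D'₋`. -/
structure IsSuperconformalOn {N : ℕ} (Φ : SuperMap N 2 2) (U : Set ℂ) : Prop where
  unit_plus : ∀ z ∈ U, IsUnit (DP (Φ.odd 0) z)
  unit_minus : ∀ z ∈ U, IsUnit (DM (Φ.odd 1) z)
  plus_odd : ∀ z ∈ U, DP (Φ.odd 1) z = 0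
  minus_odd : ∀ z ∈ U, DM (Φ.odd 0) z = 0
  plus_even : ∀ z ∈ U, DP Φ.even z = DP (Φ.odd 0) z * ((1 / 2 : ℂ) • Φ.odd 1 z)
  minus_even : ∀ z ∈ U, DM Φ.even z = DM (Φ.odd 1) z * ((1 / 2 : ℂ) • Φ.odd 0 z)

/-- The `S`-valued functions `q, q₊, q₋, ε₊, ε₋` of one variable which occur in an `N = 2`
superconformal transformation. -/
structure N2Functions (N : ℕ) where
  q : ℂ → Gr N
  qP : ℂ → Gr N
  qM : ℂ → Gr N
  epsP : ℂ → Gr N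
  epsM : ℂ → Gr N

namespace N2Functions

/-- The transformation
`z' = q + ½ θ₋ ε₊ q₋ + ½ θ₊ ε₋ q₊ + ¼ θ₊ θ₋ (ε₊ ε₋)'`,
`θ'₊ = ε₊ + θ₊ q₊ + ½ θ₊ θ₋ ε₊'`, `θ'₋ = ε₋ + θ₋ q₋ + ½ θ₋ θ₊ ε₋'`. -/
def toSuperMap {N : ℕ} (T : N2Functions N) : SuperMap N 2 2 where
  even := fun z =>
    incl N 2 (T.q z)
      + (1 / 2 : ℂ) • (thetaM N * incl N 2 (T.epsP z * T.qM z))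
      + (1 / 2 : ℂ) • (thetaP N * incl N 2 (T.epsM z * T.qP z))
      + (1 / 4 : ℂ) • (thetaP N * thetaM N * incl N 2 (deriv (fun x => T.epsP x * T.epsM x) z))
  odd := ![
    fun z => incl N 2 (T.epsP z) + thetaP N * incl N 2 (T.qP z)
      + (1 / 2 : ℂ) • (thetaP N * thetaM N * incl N 2 (deriv T.epsP z)),
    fun z => incl N 2 (T.epsM z) + thetaM N * incl N 2 (T.qM z)
      + (1 / 2 : ℂ) • (thetaM N * thetaP N * incl N 2 (deriv T.epsM z))]

/-- Holomorphy, parities, invertibility of `q₊`, `q₋`, and the constraint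
`q₊ q₋ = q' + ½ (ε₊ ε₋' + ε₋ ε₊')`. -/
structure IsAdmissibleOn {N : ℕ} (T : N2Functions N) (U : Set ℂ) : Prop where
  differentiable_q : DifferentiableOn ℂ T.q U
  differentiable_qP : DifferentiableOn ℂ T.qP U
  differentiable_qM : DifferentiableOn ℂ T.qM U
  differentiable_epsP : DifferentiableOn ℂ T.epsP U
  differentiable_epsM : DifferentiableOn ℂ T.epsM U
  even_q : ∀ z ∈ U, Gr.IsEven (T.q z)
  even_qP : ∀ z ∈ U, Gr.IsEven (T.qP z)
  even_qM : ∀ z ∈ U, Gr.IsEven (T.qM z)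
  odd_epsP : ∀ z ∈ U, Gr.IsOdd (T.epsP z)
  odd_epsM : ∀ z ∈ U, Gr.IsOdd (T.epsM z)
  unit_qP : ∀ z ∈ U, IsUnit (T.qP z)
  unit_qM : ∀ z ∈ U, IsUnit (T.qM z)
  constraint : ∀ z ∈ U, T.qP z * T.qM z =
    deriv T.q z + (1 / 2 : ℂ) • (T.epsP z * deriv T.epsM z + T.epsM z * deriv T.epsP z)

/-- Equality of all five functions over `U`. -/
def EqOn {N : ℕ} (T T' : N2Functions N) (U : Set ℂ) : Prop :=
  Set.EqOn T.q T'.q U ∧ Set.EqOn T.qP T'.qP U ∧ Set.EqOn T.qM T'.qM U ∧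
    Set.EqOn T.epsP T'.epsP U ∧ Set.EqOn T.epsM T'.epsM U

end N2Functions

/-! ## Maps of dimension `(1|1)` and the correspondence with `N = 2` -/

/-- The `S`-valued functions in the normal form `z' = S + θ V φ`, `θ' = ψ + θ V` of a `(1|1)`
coordinate transformation. -/
structure Functions11 (N : ℕ) where
  S : ℂ → Gr N
  V : ℂ → Gr N
  phi : ℂ → Gr N
  psi : ℂ → Gr N

namespace Functions11

def toSuperMap {N : ℕ} (T : Functions11 N) : SuperMap N 1 1 where
  even := fun z => incl N 1 (T.S z) + theta N (0 : Fin 1) * incl N 1 (T.V z * T.phi z)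
  odd := fun _ z => incl N 1 (T.psi z) + theta N (0 : Fin 1) * incl N 1 (T.V z)

structure IsAdmissibleOn {N : ℕ} (T : Functions11 N) (U : Set ℂ) : Prop where
  differentiable_S : DifferentiableOn ℂ T.S U
  differentiable_V : DifferentiableOn ℂ T.V U
  differentiable_phi : DifferentiableOn ℂ T.phi U
  differentiable_psi : DifferentiableOn ℂ T.psi U
  even_S : ∀ z ∈ U, Gr.IsEven (T.S z)
  even_V : ∀ z ∈ U, Gr.IsEven (T.V z)
  odd_phi : ∀ z ∈ U, Gr.IsOdd (T.phi z)
  odd_psi : ∀ z ∈ U, Gr.IsOdd (T.psi z)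
  unit_V : ∀ z ∈ U, IsUnit (T.V z)

/-- The Dolgikh--Rosly--Schwarz formulas: `ε₊ = ψ`, `q₊ = V`, `ε₋ = φ`,
`q₋ = (S' - ψ' φ) V⁻¹`, `q = S + ½ φ ψ`. -/
def drs {N : ℕ} (T : Functions11 N) : N2Functions N where
  q := fun z => T.S z + (1 / 2 : ℂ) • (T.phi z * T.psi z)
  qP := T.V
  qM := fun z => (deriv T.S z - deriv T.psi z * T.phi z) * Ring.inverse (T.V z)
  epsP := T.psi
  epsM := T.phi

end Functions11

/-- The quotient by the leaves of `D₋`, from dimension `(1|2)` to `(1|1)`: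
`(z, θ₊, θ₋) ↦ (z + ½ θ₊ θ₋, θ₊)`; both functions are annihilated by `D₋`. -/
def chiral (N : ℕ) : SuperMap N 2 1 where
  even := fun z => algebraMap ℂ _ z + (1 / 2 : ℂ) • (thetaP N * thetaM N)
  odd := fun _ _ => thetaP N

/-- The functions `f, g, α, β` of a transition `ξ' = g(w) (ξ + β(w))`, `w' = f(w + ξ α(w))`. -/
structure GluingFunctions (N : ℕ) where
  f : ℂ → Gr N
  g : ℂ → Gr N
  α : ℂ → Gr N
  β : ℂ → Gr N

namespace GluingFunctions

/-- `w' = f(w + ξ α(w))`, `ξ' = g(w) (ξ + β(w))`. -/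
def toSuperMap {N : ℕ} (G : GluingFunctions N) : SuperMap N 1 1 where
  even := fun w => evalAt (fun x => incl N 1 (G.f x))
    (algebraMap ℂ _ w + theta N (0 : Fin 1) * incl N 1 (G.α w))
  odd := fun _ w => incl N 1 (G.g w) * (theta N (0 : Fin 1) + incl N 1 (G.β w))

/-- `f, g` are even, `α, β` are odd, all are holomorphic on `U`, and modulo the odd parameters `f`
and `g` become the given functions `f₀` and `g₀`. -/
structure IsAdmissibleOn {N : ℕ} (G : GluingFunctions N) (U : Set ℂ) (f₀ g₀ : ℂ → ℂ) : Prop where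
  differentiable_f : DifferentiableOn ℂ G.f U
  differentiable_g : DifferentiableOn ℂ G.g U
  differentiable_α : DifferentiableOn ℂ G.α U
  differentiable_β : DifferentiableOn ℂ G.β U
  even_f : ∀ w ∈ U, Gr.IsEven (G.f w)
  even_g : ∀ w ∈ U, Gr.IsEven (G.g w)
  odd_α : ∀ w ∈ U, Gr.IsOdd (G.α w)
  odd_β : ∀ w ∈ U, Gr.IsOdd (G.β w)
  body_f : ∀ w ∈ U, Gr.body (G.f w) = f₀ w
  body_g : ∀ w ∈ U, Gr.body (G.g w) = g₀ w

/-- The functions `ε₊ = g β`, `ε₋ = f' α g⁻¹`, `q₊ = g`,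
`q₋ = f' g⁻¹ (1 + α β') + (g⁻¹)' f' β α`, `q = f + ½ f' α β`. -/
def n2gluing {N : ℕ} (G : GluingFunctions N) : N2Functions N where
  q := fun w => G.f w + (1 / 2 : ℂ) • (deriv G.f w * G.α w * G.β w)
  qP := G.g
  qM := fun w =>
    deriv G.f w * Ring.inverse (G.g w) * (1 + G.α w * deriv G.β w)
      + deriv (fun x => Ring.inverse (G.g x)) w * deriv G.f w * G.β w * G.α w
  epsP := fun w => G.g w * G.β w
  epsM := fun w => deriv G.f w * G.α w * Ring.inverse (G.g w)

end GluingFunctions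

/-! ## Metric fatgraphs and the associated punctured Riemann surface -/

/-- A connected metric fatgraph with set `D` of oriented edges; an oriented edge is identified with
the half-edge at its origin, so that the edges are the pairs `{d, rev d}`, the vertices are the
orbits of `next`, the boundary pieces (punctures) are the orbits of `next⁻¹ ∘ rev`. -/
structure MetricFatgraph (D : Type) [Fintype D] where
  /-- the next oriented edge, counterclockwise, with the same origin -/
  next : Equiv.Perm D
  /-- the same edge with the opposite orientation -/
  rev : Equiv.Perm D
  rev_rev : ∀ d, rev (rev d) = d
  rev_ne : ∀ d, rev d ≠ d
  /-- all valences are at least three -/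
  three_le : ∀ d, 3 ≤ Function.minimalPeriod next d
  connected : ∀ d d', ∃ p ∈ Subgroup.closure ({next, rev} : Set (Equiv.Perm D)), p d = d'
  /-- the length of an edge -/
  len : D → ℝ
  len_pos : ∀ d, 0 < len d
  len_rev : ∀ d, len (rev d) = len d
  /-- the root of unity `c = exp (2πi (j-1) / m)` of the `j`-th half-edge at an `m`-valent vertex,
  after a choice of the first one -/
  root : D → ℂ
  root_pow : ∀ d, root d ^ Function.minimalPeriod next d = 1
  root_next : ∀ d, root (next d) =
    Complex.exp (2 * Real.pi * Complex.I / (Function.minimalPeriod next d : ℂ)) * root d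
  /-- the partial sum `L_1 + ⋯ + L_{k-1}` at the `k`-th edge of a boundary piece, after a choice of
  the first one -/
  offset : D → ℝ
  offset_next : ∀ d,
    offset ((next⁻¹ * rev) d) = offset d + len d ∨
    offset ((next⁻¹ * rev) d) = 0 ∧ offset d + len d =
      ∑ i ∈ Finset.range (Function.minimalPeriod (next⁻¹ * rev : Equiv.Perm D) d),
        len (((next⁻¹ * rev) ^ i) d)

namespace MetricFatgraph

variable {D : Type} [Fintype D] (Γ : MetricFatgraph D)

/-- The next oriented edge along the boundary piece to the left of `d`. -/
def face : Equiv.Perm D := Γ.next⁻¹ * Γ.rev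

/-- The valence of the origin of `d`. -/
def val (d : D) : ℕ := Function.minimalPeriod Γ.next d

/-- The number of edges of the boundary piece to the left of `d`. -/
def faceLength (d : D) : ℕ := Function.minimalPeriod Γ.face d

/-- The perimeter `a` of the boundary piece to the left of `d`. -/
def perimeter (d : D) : ℝ := ∑ i ∈ Finset.range (Γ.faceLength d), Γ.len ((Γ.face ^ i) d)

/-- The coordinate `w = c z^(2/m)` at the origin of `d`, in terms of the coordinate `z` of the
stripe of `d`. -/
def coord (d : D) (z : ℂ) : ℂ := Γ.root d * z ^ (2 / (Γ.val d : ℂ))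

/-- The inverse `z = (w/c)^(m/2)` of `coord`. -/
def stripCoord (d : D) (w : ℂ) : ℂ := (w / Γ.root d) ^ ((Γ.val d : ℂ) / 2)

/-- The overlap `U_v ∩ U_v'` along the edge `d` from `v` to `v'`, in the coordinate `w` of `U_v`:
the image of the stripe `0 < Re z < L`. -/
def edgeOverlap (d : D) : Set ℂ :=
  Γ.coord d '' {z | 0 < z.re ∧ z.re < Γ.len d}

/-- The transition `w' = c' (L - z)^(2/m')` along `d`. -/
def edgeMap (d : D) (w : ℂ) : ℂ := Γ.coord (Γ.rev d) ((Γ.len d : ℂ) - Γ.stripCoord d w)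

/-- The overlap of `U_v` with the disk `V_p` around the puncture `p` to the left of `d`, in the
corner at `v` between `d` and `next d`, in the coordinate `w` of `U_v`: the upper half of the stripe
of `d` and the lower half of the stripe of `next d`, glued along their common boundary ray. -/
def cornerOverlap (d : D) : Set ℂ :=
  Γ.coord d '' {z | 0 < z.im ∧ -Γ.len (Γ.next d) < z.re ∧ z.re < Γ.len d}

/-- The transition `y = exp (2πi (L_1 + ⋯ + L_{k-1} + z) / a)` to the disk `V_p : |y| < 1`. -/
def cornerMap (d : D) (w : ℂ) : ℂ :=
  Complex.exp (2 * Real.pi * Complex.I / (Γ.perimeter d : ℂ) *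
    ((Γ.offset d : ℂ) + Γ.stripCoord d w))

/-- The triple overlap `U_v ∩ U_v' ∩ V_p` along the left side of the edge `d` from `v` to `v'`, in
the coordinate `w` of `U_v`. -/
def tripleOverlap (d : D) : Set ℂ :=
  Γ.coord d '' {z | 0 < z.im ∧ 0 < z.re ∧ z.re < Γ.len d}

end MetricFatgraph

/-- A `U(1)`-graph connection with trivial monodromy around the boundary pieces; `u d` is the
transition `g_{v',v}` of the flat line bundle along the edge `d` from `v` to `v'`. -/
structure FlatConnection {D : Type} [Fintype D] (Γ : MetricFatgraph D) where
  u : D → Circle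
  u_rev : ∀ d, u (Γ.rev d) = (u d)⁻¹
  monodromy : ∀ d, ∏ i ∈ Finset.range (Γ.faceLength d), u ((Γ.face ^ i) d) = 1

/-- A `(1|1)`-supermanifold over `S = Gr N` glued from superdomains over the vertex neighbourhoods
`U_v` and the disks `V_p`, whose transitions have the form `w' = f(w + ξ α(w))`,
`ξ' = g(w) (ξ + β(w))` and which, modulo the odd parameters, is the split supermanifold of the line
bundle given by the flat connection `u` and by the divisor `∑ M_p p` (so that
`g_{p,v} = const · y ^ M_p`) on the Riemann surface of `Γ`. -/
structure FatgraphSupermanifold {D : Type} [Fintype D] (Γ : MetricFatgraph D)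
    (A : FlatConnection Γ) (M : D → ℤ) (N : ℕ) where
  /-- the transition from `U_v` to `U_v'` along the edge `d` from `v` to `v'` -/
  edge : D → GluingFunctions N
  /-- the transition from `U_v` to `V_p` in the corner between `d` and `next d` -/
  corner : D → GluingFunctions N
  /-- the constants of the transitions from the flat line bundle to `V_p` -/
  frame : D → Circle
  edge_admissible : ∀ d, (edge d).IsAdmissibleOn (Γ.edgeOverlap d) (Γ.edgeMap d)
    (fun _ => (A.u d : ℂ))
  corner_admissible : ∀ d, (corner d).IsAdmissibleOn (Γ.cornerOverlap d) (Γ.cornerMap d)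
    (fun w => (frame d : ℂ) * Γ.cornerMap d w ^ M d)
  edge_rev : ∀ d, ((edge (Γ.rev d)).toSuperMap.comp (edge d).toSuperMap).EqOn
    (SuperMap.id N 1) (Γ.edgeOverlap d)
  cocycle : ∀ d, ((corner (Γ.face d)).toSuperMap.comp (edge d).toSuperMap).EqOn
    (corner d).toSuperMap (Γ.tripleOverlap d)

/-- An `N = 2` super Riemann surface over `S = Gr N`, with underlying punctured surface that of `Γ`,
glued from superdomains of dimension `(1|2)` over the `U_v` and the `V_p` by superconformal
transitions. -/
structure N2SuperRiemannSurface {D : Type} [Fintype D] (Γ : MetricFatgraph D) (N : ℕ) where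
  /-- the transition from `U_v` to `U_v'` along the edge `d` from `v` to `v'` -/
  edge : D → SuperMap N 2 2
  /-- the transition from `U_v` to `V_p` in the corner between `d` and `next d` -/
  corner : D → SuperMap N 2 2
  edge_holomorphic : ∀ d, (edge d).IsHolomorphicOn (Γ.edgeOverlap d) (Γ.edgeMap d)
  corner_holomorphic : ∀ d, (corner d).IsHolomorphicOn (Γ.cornerOverlap d) (Γ.cornerMap d)
  edge_superconformal : ∀ d, IsSuperconformalOn (edge d) (Γ.edgeOverlap d)
  corner_superconformal : ∀ d, IsSuperconformalOn (corner d) (Γ.cornerOverlap d)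
  edge_rev : ∀ d, ((edge (Γ.rev d)).comp (edge d)).EqOn (SuperMap.id N 2) (Γ.edgeOverlap d)
  cocycle : ∀ d, ((corner (Γ.face d)).comp (edge d)).EqOn (corner d) (Γ.tripleOverlap d)

/-- `Y` corresponds to the `(1|1)`-supermanifold `X`: in all charts, the quotient of `Y` by the
leaves of `D₋` is `X`. -/
def Corresponds {D : Type} [Fintype D] {Γ : MetricFatgraph D} {A : FlatConnection Γ} {M : D → ℤ}
    {N : ℕ} (Y : N2SuperRiemannSurface Γ N) (X : FatgraphSupermanifold Γ A M N) : Prop :=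
  (∀ d, ((chiral N).comp (Y.edge d)).EqOn ((X.edge d).toSuperMap.comp (chiral N))
    (Γ.edgeOverlap d)) ∧
  (∀ d, ((chiral N).comp (Y.corner d)).EqOn ((X.corner d).toSuperMap.comp (chiral N))
    (Γ.cornerOverlap d))

end

/-! The point is that an `N = 2` superconformal map is determined by its quotient by the leaves of
`D₋`. The quotient displays `θ'₊` and `Z = z' + ½ θ'₊ θ'₋`. Applying `D₊` gives `D₊ Z = (D₊ θ'₊)
θ'₋`, and since `D₊ θ'₊` is invertible this yields `θ'₋`, after which `z'` follows
(`superD_chiral_comp`, `eq_of_chiral_comp_eq`). Uniqueness of the surface is immediate.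

The same rigidity gives the cocycle conditions without computing any composition of `N = 2`
formulas. Lifts compose to a map preserving the line of `D₊` whose quotient is the composition of
the quotients, so an identity between `(1|1)` transitions forces the identity between their lifts
(`comp_eqOn_of_chiral`). This needs functoriality of pull-back and the chain rule `D_i = (D_i θ'_i)
D'_i`. Both follow from one principle: the defect is a twisted derivation on germs, and such a map
vanishes once it kills constants and the coordinate (`eq_zero_of_leibniz`).

Existence is local. Since `ξ α` squares to zero, (1) has the normal form with `S = f`, `V = g`, `φ =
f' α g⁻¹`, `ψ = g β`. The Dolgikh–Rosly–Schwarz formulas satisfy the constraint by Leibniz' rule,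
the constraint makes the explicit transformation superconformal (`superconformal_product`), and
direct expansion shows that its quotient is the given map (`chiral_comp_drs`).

Invertibility is decided modulo nilpotents. There it reduces to `g⁰ ≠ 0` and to nonvanishing of the
derivatives of the gluing maps of the fatgraph surface, which is read off in the stripe coordinate.
-/

noncomputable section

/-! ### Parity, nilpotents and units in a Grassmann algebra. -/

namespace Gr

variable {n : ℕ}

theorem invol_ι (v : Fin n → ℂ) : invol (ExteriorAlgebra.ι ℂ v) = -ExteriorAlgebra.ι ℂ v :=
  CliffordAlgebra.involute_ι _

theorem body_ι (v : Fin n → ℂ) : body (ExteriorAlgebra.ι ℂ v) = 0 := by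
  simp [body, ExteriorAlgebra.algebraMapInv]

theorem body_invol (x : Gr n) : body (invol x) = body x := by
  have h : (body (n := n)).comp invol = body := by
    apply ExteriorAlgebra.hom_ext
    ext v
    simp [invol_ι, body_ι]
  exact DFunLike.congr_fun h x

theorem IsEven.mul {x y : Gr n} (hx : IsEven x) (hy : IsEven y) : IsEven (x * y) := by
  rw [IsEven, map_mul, hx, hy]

theorem IsOdd.mul {x y : Gr n} (hx : IsOdd x) (hy : IsOdd y) : IsEven (x * y) := by
  rw [IsEven, map_mul, hx, hy, neg_mul_neg]

theorem IsEven.mul_odd {x y : Gr n} (hx : IsEven x) (hy : IsOdd y) : IsOdd (x * y) := by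
  rw [IsOdd, map_mul, hx, hy, mul_neg]

theorem IsOdd.mul_even {x y : Gr n} (hx : IsOdd x) (hy : IsEven y) : IsOdd (x * y) := by
  rw [IsOdd, map_mul, hx, hy, neg_mul]

theorem IsEven.add {x y : Gr n} (hx : IsEven x) (hy : IsEven y) : IsEven (x + y) := by
  rw [IsEven, map_add, hx, hy]

theorem IsOdd.add {x y : Gr n} (hx : IsOdd x) (hy : IsOdd y) : IsOdd (x + y) := by
  rw [IsOdd, map_add, hx, hy, neg_add]

theorem IsEven.sub {x y : Gr n} (hx : IsEven x) (hy : IsEven y) : IsEven (x - y) := by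
  rw [IsEven, map_sub, hx, hy]

theorem IsEven.smul (c : ℂ) {x : Gr n} (hx : IsEven x) : IsEven (c • x) := by
  rw [IsEven, map_smul, hx]

theorem IsOdd.smul (c : ℂ) {x : Gr n} (hx : IsOdd x) : IsOdd (c • x) := by
  rw [IsOdd, map_smul, hx, smul_neg]

theorem isEven_algebraMap (c : ℂ) : IsEven (algebraMap ℂ (Gr n) c) := invol.commutes c

theorem IsOdd.anticomm {x y : Gr n} (hx : IsOdd x) (hy : IsOdd y) : x * y = -(y * x) := by
  rw [hx.mul_eq, hy, neg_mul]

/-- A generator passes `x` at the cost of the grading involution, which fixes an even `x`; so even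
elements are central. -/
theorem IsEven.comm {x : Gr n} (hx : IsEven x) (y : Gr n) : x * y = y * x := by
  induction y using ExteriorAlgebra.induction with
  | algebraMap r => rw [Algebra.commutes]
  | ι v => rw [ι_mul_eq, hx]
  | mul a b ha hb => rw [← mul_assoc, ha, mul_assoc, hb, ← mul_assoc]
  | add a b ha hb => rw [mul_add, ha, hb, add_mul]

theorem IsOdd.oddPart_eq {x : Gr n} (hx : IsOdd x) : oddPart x = x := by
  rw [oddPart, hx, sub_neg_eq_add, ← two_smul ℂ x, smul_smul]
  norm_num

theorem IsOdd.body_eq {x : Gr n} (hx : IsOdd x) : body x = 0 := by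
  have h := body_invol x
  rw [hx, map_neg] at h
  linear_combination (-1 / 2 : ℂ) * h

theorem body_algebraMap (c : ℂ) : body (algebraMap ℂ (Gr n) c) = c := by
  simp [AlgHom.commutes]

/-- The augmentation ideal is generated by the generators. -/
theorem sub_body_mem (x : Gr n) :
    x - algebraMap ℂ (Gr n) (body x) ∈
      LinearMap.range (ExteriorAlgebra.ι ℂ (M := Fin n → ℂ)) * (⊤ : Submodule ℂ (Gr n)) := by
  induction x using ExteriorAlgebra.induction with
  | algebraMap r => rw [body_algebraMap, sub_self]; exact zero_mem _
  | ι v =>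
    rw [body_ι, map_zero, sub_zero, ← mul_one (ExteriorAlgebra.ι ℂ v)]
    exact Submodule.mul_mem_mul ⟨v, rfl⟩ trivial
  | mul a b ha hb =>
    have h : a * b - algebraMap ℂ (Gr n) (body (a * b)) =
        (a - algebraMap ℂ (Gr n) (body a)) * b +
          (body a) • (b - algebraMap ℂ (Gr n) (body b)) := by
      rw [map_mul, map_mul, Algebra.smul_def]
      noncomm_ring
    rw [h]
    refine add_mem ?_ (Submodule.smul_mem _ _ hb)
    have h2 := Submodule.mul_mem_mul ha (Submodule.mem_top (x := b) (R := ℂ))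
    rw [mul_assoc] at h2
    have h3 := mul_le_mul_right (le_top (a := (⊤ : Submodule ℂ (Gr n)) * ⊤))
      (LinearMap.range (ExteriorAlgebra.ι ℂ (M := Fin n → ℂ)))
    exact h3 h2
  | add a b ha hb =>
    rw [map_add, map_add, add_sub_add_comm]
    exact add_mem ha hb

/-- Generators can be moved to the left up to the involution. This lets powers of the augmentation
ideal be collected as powers of the space of generators. -/
theorem top_mul_range_le :
    (⊤ : Submodule ℂ (Gr n)) * LinearMap.range (ExteriorAlgebra.ι ℂ (M := Fin n → ℂ)) ≤
      LinearMap.range (ExteriorAlgebra.ι ℂ (M := Fin n → ℂ)) * (⊤ : Submodule ℂ (Gr n)) := by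
  rw [Submodule.mul_le]
  rintro x - _ ⟨v, rfl⟩
  rw [← invol_invol x, ← ι_mul_eq]
  exact Submodule.mul_mem_mul ⟨v, rfl⟩ trivial

/-- With `V` the span of the generators, `x` lies in `V · Gr n`, hence `x ^ k` in `V ^ k · Gr n`;
and `V ^ (n + 1)` is the exterior power of degree `n + 1` of an `n`-dimensional space. -/
theorem pow_eq_zero_of_body_eq_zero {x : Gr n} (hx : body x = 0) : x ^ (n + 1) = 0 := by
  have h1 : x ∈ LinearMap.range (ExteriorAlgebra.ι ℂ (M := Fin n → ℂ)) *
      (⊤ : Submodule ℂ (Gr n)) := by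
    simpa [hx] using sub_body_mem x
  have h2 : ∀ k : ℕ, x ^ k ∈ LinearMap.range (ExteriorAlgebra.ι ℂ (M := Fin n → ℂ)) ^ k *
      (⊤ : Submodule ℂ (Gr n)) := by
    intro k
    induction k with
    | zero => simp
    | succ k ih =>
      have h3 := Submodule.mul_mem_mul ih h1
      rw [← pow_succ, mul_assoc, ← mul_assoc ⊤] at h3
      have h4 : (⊤ : Submodule ℂ (Gr n)) *
          LinearMap.range (ExteriorAlgebra.ι ℂ (M := Fin n → ℂ)) * ⊤ ≤
          LinearMap.range (ExteriorAlgebra.ι ℂ (M := Fin n → ℂ)) * ⊤ :=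
        (mul_le_mul_left top_mul_range_le _).trans
          (by rw [mul_assoc]; exact mul_le_mul_right le_top _)
      have h5 := mul_le_mul_right h4 (LinearMap.range
        (ExteriorAlgebra.ι ℂ (M := Fin n → ℂ)) ^ k) h3
      rwa [← mul_assoc, ← pow_succ] at h5
  have h6 : LinearMap.range (ExteriorAlgebra.ι ℂ (M := Fin n → ℂ)) ^ (n + 1) = ⊥ := by
    have h7 := exteriorPower.finrank_eq (R := ℂ) (M := Fin n → ℂ) (n + 1)
    rw [Module.finrank_fin_fun, Nat.choose_succ_self] at h7
    exact Submodule.finrank_eq_zero.mp h7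
  have h8 := h2 (n + 1)
  rw [h6, Submodule.bot_mul] at h8
  exact h8

/-- A nonzero scalar plus a nilpotent element commuting with it is invertible. -/
theorem isUnit_of_body_ne_zero {x : Gr n} (hx : body x ≠ 0) : IsUnit x := by
  have h1 : IsNilpotent (x - algebraMap ℂ (Gr n) (body x)) :=
    ⟨n + 1, pow_eq_zero_of_body_eq_zero (by simp)⟩
  have h2 : IsUnit (algebraMap ℂ (Gr n) (body x)) := (IsUnit.mk0 _ hx).map _
  have h3 := h1.isUnit_add_left_of_commute h2 (Algebra.commutes _ _).symm
  rwa [add_sub_cancel] at h3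

theorem isUnit_iff {x : Gr n} : IsUnit x ↔ body x ≠ 0 :=
  ⟨fun h => (h.map body).ne_zero, isUnit_of_body_ne_zero⟩

theorem IsEven.inverse {x : Gr n} (hx : IsEven x) (h : IsUnit x) : IsEven (Ring.inverse x) := by
  have h1 : x * invol (Ring.inverse x) = 1 := by
    nth_rewrite 1 [← hx]
    rw [← map_mul, Ring.mul_inverse_cancel _ h, map_one]
  calc invol (Ring.inverse x) = Ring.inverse x * (x * invol (Ring.inverse x)) := by
        rw [← mul_assoc, Ring.inverse_mul_cancel _ h, one_mul]
    _ = Ring.inverse x := by rw [h1, mul_one]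

theorem invol_gen (i : Fin n) : invol (gen i) = -gen i := isOdd_gen i

end Gr

/-! ### Substitution and left derivatives in `S[θ]`. -/

variable {N k l : ℕ}

theorem ι_eq_sum_gen {n : ℕ} (v : Fin n → ℂ) :
    ExteriorAlgebra.ι ℂ v = ∑ i, v i • Gr.gen i := by
  conv_lhs => rw [pi_eq_sum_univ' v]
  rw [map_sum]
  refine Finset.sum_congr rfl fun i _ => ?_
  rw [map_smul, Gr.gen]

theorem Gr.induction_gen {n : ℕ} {C : Gr n → Prop} (algebraMap : ∀ r, C (algebraMap ℂ (Gr n) r))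
    (gen : ∀ i, C (Gr.gen i)) (mul : ∀ a b, C a → C b → C (a * b))
    (add : ∀ a b, C a → C b → C (a + b)) (x : Gr n) : C x := by
  induction x using ExteriorAlgebra.induction with
  | algebraMap r => exact algebraMap r
  | ι v =>
    rw [ι_eq_sum_gen]
    refine Finset.sum_induction _ C add (by simpa using algebraMap 0) fun i _ => ?_
    rw [Algebra.smul_def]
    exact mul _ _ (algebraMap _) (gen i)
  | mul a b ha hb => exact mul a b ha hb
  | add a b ha hb => exact add a b ha hb

theorem Gr.algHom_ext {n : ℕ} {A : Type*} [Ring A] [Algebra ℂ A] {f g : Gr n →ₐ[ℂ] A}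
    (h : ∀ i, f (Gr.gen i) = g (Gr.gen i)) : f = g := by
  refine AlgHom.ext fun x => ?_
  induction x using Gr.induction_gen with
  | algebraMap r => simp
  | gen i => exact h i
  | mul a b ha hb => rw [map_mul, map_mul, ha, hb]
  | add a b ha hb => rw [map_add, map_add, ha, hb]

theorem incl_gen (a : Fin N) : incl N k (Gr.gen a) = Gr.gen (Fin.castAdd k a) := by
  rw [incl, Gr.gen, ExteriorAlgebra.map_apply_ι, Gr.gen]
  congr 1
  funext j
  rw [Function.ExtendByZero.linearMap_apply]
  by_cases h : ∃ i, Fin.castAdd k i = j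
  · obtain ⟨i, rfl⟩ := h
    rw [(Fin.castAdd_injective N k).extend_apply]
    simp [Pi.single_apply]
  · rw [Function.extend_apply' _ _ _ h, Pi.single_apply, if_neg]
    · rfl
    · exact fun h' => h ⟨a, h'.symm⟩

theorem invol_incl (x : Gr N) : Gr.invol (incl N k x) = incl N k (Gr.invol x) := by
  have h : (Gr.invol (n := N + k)).comp (incl N k) = (incl N k).comp Gr.invol :=
    Gr.algHom_ext fun i => by simp [incl_gen, Gr.invol_gen]
  exact DFunLike.congr_fun h x

theorem Gr.body_gen {n : ℕ} (i : Fin n) : body (gen i) = 0 := body_ι _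

theorem body_incl (x : Gr N) : Gr.body (incl N k x) = Gr.body x := by
  have h : (Gr.body (n := N + k)).comp (incl N k) = Gr.body :=
    Gr.algHom_ext fun i => by simp [incl_gen, Gr.body_gen]
  exact DFunLike.congr_fun h x

theorem Gr.IsEven.incl {x : Gr N} (h : IsEven x) : IsEven (incl N k x) := by
  rw [IsEven, invol_incl, h]

theorem Gr.IsOdd.incl {x : Gr N} (h : IsOdd x) : IsOdd (incl N k x) := by
  rw [IsOdd, invol_incl, h, map_neg]

theorem isOdd_theta (i : Fin k) : Gr.IsOdd (theta N i) := Gr.isOdd_gen _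

theorem subst_gen_castAdd (Θ : Fin l → Gr (N + k)) (a : Fin N) :
    subst Θ (Gr.gen (Fin.castAdd l a)) = Gr.gen (Fin.castAdd k a) := by
  rw [subst, Gr.gen, ExteriorAlgebra.lift_ι_apply, Fintype.linearCombination_apply_single,
    Fin.append_left, one_smul]

theorem subst_theta' (Θ : Fin l → Gr (N + k)) (i : Fin l) :
    subst Θ (theta N i) = Gr.oddPart (Θ i) := by
  rw [subst, theta, Gr.gen, ExteriorAlgebra.lift_ι_apply, Fintype.linearCombination_apply_single,
    Fin.append_right, one_smul]

theorem subst_theta {Θ : Fin l → Gr (N + k)} {i : Fin l} (h : Gr.IsOdd (Θ i)) :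
    subst Θ (theta N i) = Θ i := by
  rw [subst_theta', h.oddPart_eq]

theorem subst_incl (Θ : Fin l → Gr (N + k)) (x : Gr N) : subst Θ (incl N l x) = incl N k x := by
  have h : (subst Θ).comp (incl N l) = incl N k :=
    Gr.algHom_ext fun i => by simp [incl_gen, subst_gen_castAdd]
  exact DFunLike.congr_fun h x

/-- Induction over `S[θ]`: elements of `S` and the odd coordinates generate. -/
theorem Gr.induction_theta {C : Gr (N + k) → Prop} (algebraMap : ∀ r, C (algebraMap ℂ _ r))
    (incl_gen : ∀ a : Fin N, C (incl N k (Gr.gen a))) (theta : ∀ i : Fin k, C (theta N i))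
    (mul : ∀ a b, C a → C b → C (a * b)) (add : ∀ a b, C a → C b → C (a + b))
    (x : Gr (N + k)) : C x := by
  refine Gr.induction_gen algebraMap (fun i => ?_) mul add x
  induction i using Fin.addCases with
  | left a => rw [← _root_.incl_gen]; exact incl_gen a
  | right i => exact theta i

theorem algHom_ext_theta {A : Type*} [Ring A] [Algebra ℂ A] {f g : Gr (N + k) →ₐ[ℂ] A}
    (h : ∀ a : Fin N, f (incl N k (Gr.gen a)) = g (incl N k (Gr.gen a)))
    (h' : ∀ i : Fin k, f (theta N i) = g (theta N i)) : f = g := by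
  refine Gr.algHom_ext fun i => ?_
  induction i using Fin.addCases with
  | left a => rw [← incl_gen]; exact h a
  | right i => exact h' i

theorem invol_subst (Θ : Fin l → Gr (N + k)) (x : Gr (N + l)) :
    Gr.invol (subst Θ x) = subst Θ (Gr.invol x) := by
  have h : Gr.invol.comp (subst Θ) = (subst Θ).comp Gr.invol := by
    refine algHom_ext_theta (fun i => ?_) fun i => ?_
    · simp [subst_incl, invol_incl]
    · simp only [AlgHom.comp_apply]
      rw [isOdd_theta i, map_neg, subst_theta', Gr.isOdd_oddPart]
  exact DFunLike.congr_fun h x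

theorem body_subst (Θ : Fin l → Gr (N + k)) (x : Gr (N + l)) :
    Gr.body (subst Θ x) = Gr.body x := by
  have h : Gr.body.comp (subst Θ) = Gr.body := by
    refine algHom_ext_theta (fun i => ?_) fun i => ?_
    · simp [subst_incl, body_incl]
    · simp only [AlgHom.comp_apply]
      rw [subst_theta', (Gr.isOdd_oddPart _).body_eq, (isOdd_theta i).body_eq]
  exact DFunLike.congr_fun h x

/-- Contraction with a covector is an antiderivation: the rule for a vector on the left propagates
to products because the involution is multiplicative. -/
theorem dTheta_mul (i : Fin k) (x y : Gr (N + k)) :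
    dTheta N i (x * y) = dTheta N i x * y + Gr.invol x * dTheta N i y := by
  induction x using ExteriorAlgebra.induction generalizing y with
  | algebraMap r =>
    rw [AlgHom.commutes, ← Algebra.smul_def, map_smul, ← Algebra.smul_def]
    have : dTheta N i (algebraMap ℂ _ r) = 0 := CliffordAlgebra.contractLeft_algebraMap _ _ _
    rw [this, zero_mul, zero_add]
  | ι v =>
    rw [Gr.invol_ι]
    have h1 := CliffordAlgebra.contractLeft_ι_mul (Q := (0 : QuadraticForm ℂ (Fin (N + k) → ℂ)))
      (d := LinearMap.proj (Fin.natAdd N i)) v y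
    have h2 := CliffordAlgebra.contractLeft_ι (Q := (0 : QuadraticForm ℂ (Fin (N + k) → ℂ)))
      (LinearMap.proj (Fin.natAdd N i)) v
    refine h1.trans ?_
    rw [neg_mul, ← sub_eq_add_neg]
    refine congrArg₂ _ ?_ rfl
    rw [Algebra.smul_def]
    exact congrArg (· * y) h2.symm
  | mul a b ha hb =>
    rw [mul_assoc, ha, hb, ha, map_mul]
    noncomm_ring
  | add a b ha hb => rw [add_mul, map_add, ha, hb, map_add, map_add]; noncomm_ring

theorem dTheta_algebraMap (i : Fin k) (r : ℂ) : dTheta N i (algebraMap ℂ _ r) = 0 :=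
  CliffordAlgebra.contractLeft_algebraMap _ _ _

theorem dTheta_gen (i : Fin k) (j : Fin (N + k)) :
    dTheta N i (Gr.gen j) = if j = Fin.natAdd N i then 1 else 0 := by
  refine (CliffordAlgebra.contractLeft_ι _ _ _).trans ?_
  rw [LinearMap.proj_apply, Pi.single_apply]
  split_ifs with h h' h'
  · rw [map_one]
  · exact absurd h.symm h'
  · exact absurd h'.symm h
  · rw [map_zero]

theorem dTheta_theta (i j : Fin k) : dTheta N i (theta N j) = if j = i then 1 else 0 := by
  rw [theta, dTheta_gen]
  simp [Fin.natAdd_inj]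

theorem dTheta_incl (i : Fin k) (x : Gr N) : dTheta N i (incl N k x) = 0 := by
  induction x using Gr.induction_gen with
  | algebraMap r => rw [AlgHom.commutes, dTheta_algebraMap]
  | gen a =>
    rw [incl_gen, dTheta_gen, if_neg]
    intro h
    have := congrArg Fin.val h
    simp at this
    omega
  | mul a b ha hb => rw [map_mul, dTheta_mul, ha, hb, zero_mul, mul_zero, add_zero]
  | add a b ha hb => rw [map_add, map_add, ha, hb, add_zero]

theorem invol_dTheta (i : Fin k) (x : Gr (N + k)) :
    Gr.invol (dTheta N i x) = -dTheta N i (Gr.invol x) := by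
  induction x using ExteriorAlgebra.induction with
  | algebraMap r => rw [AlgHom.commutes, dTheta_algebraMap, map_zero, neg_zero]
  | ι v =>
    rw [Gr.invol_ι, map_neg, neg_neg]
    have h : dTheta N i (ExteriorAlgebra.ι ℂ v) = algebraMap ℂ _ (v (Fin.natAdd N i)) :=
      CliffordAlgebra.contractLeft_ι _ _ _
    rw [h, AlgHom.commutes]
  | mul a b ha hb =>
    rw [dTheta_mul, map_add, map_mul, map_mul, map_mul, ha, hb, dTheta_mul, Gr.invol_invol]
    noncomm_ring
  | add a b ha hb => rw [map_add, map_add, ha, hb, map_add, map_add]; abel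

/-! ### Holomorphic functions with Grassmann values. -/

open Topology Filter

namespace Gr

variable {n m : ℕ}

instance instFinite (n : ℕ) : Module.Finite ℂ (Gr n) :=
  Module.Finite.equiv (coeffs n).symm

instance instCompleteSpace (n : ℕ) : CompleteSpace (Gr n) := FiniteDimensional.complete ℂ (Gr n)

/-- Multiplication of `Gr n` as a continuous bilinear map. -/
def mulL (n : ℕ) : Gr n →L[ℂ] Gr n →L[ℂ] Gr n :=
  (LinearMap.mul ℂ (Gr n)).toContinuousBilinearMap

theorem mulL_apply (x y : Gr n) : mulL n x y = x * y := rfl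

end Gr

section Analytic

variable {n m : ℕ} {F G : ℂ → Gr n} {z : ℂ} {U : Set ℂ}

theorem AnalyticAt.gr_mul (hF : AnalyticAt ℂ F z) (hG : AnalyticAt ℂ G z) :
    AnalyticAt ℂ (fun x => F x * G x) z :=
  ((Gr.mulL n).analyticAt_bilinear (F z, G z)).comp (f := fun x => (F x, G x)) (AnalyticAt.prod hF hG)

theorem AnalyticAt.gr_pow (hF : AnalyticAt ℂ F z) (j : ℕ) :
    AnalyticAt ℂ (fun x => F x ^ j) z := by
  induction j with
  | zero => simpa using analyticAt_const
  | succ j ih => simpa only [pow_succ] using ih.gr_mul hF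

theorem AnalyticAt.gr_map {V W : Type*} [NormedAddCommGroup V] [NormedSpace ℂ V]
    [FiniteDimensional ℂ V] [NormedAddCommGroup W] [NormedSpace ℂ W]
    (L : V →ₗ[ℂ] W) {F : ℂ → V} (hF : AnalyticAt ℂ F z) : AnalyticAt ℂ (fun x => L (F x)) z :=
  (L.toContinuousLinearMap.analyticAt _).comp hF

theorem deriv_gr_map {V W : Type*} [NormedAddCommGroup V] [NormedSpace ℂ V]
    [FiniteDimensional ℂ V] [NormedAddCommGroup W] [NormedSpace ℂ W]
    (L : V →ₗ[ℂ] W) {F : ℂ → V} (hF : DifferentiableAt ℂ F z) :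
    deriv (fun x => L (F x)) z = L (deriv F z) :=
  ((L.toContinuousLinearMap.hasFDerivAt).comp_hasDerivAt z hF.hasDerivAt).deriv

theorem deriv_gr_mul (hF : DifferentiableAt ℂ F z) (hG : DifferentiableAt ℂ G z) :
    deriv (fun x => F x * G x) z = deriv F z * G z + F z * deriv G z := by
  have h := (Gr.mulL n).hasDerivAt_of_bilinear (fun _ => hF.hasDerivAt) fun _ => hG.hasDerivAt
  rw [add_comm]
  exact h.deriv

theorem analyticAt_gr_algebraMap : AnalyticAt ℂ (fun x : ℂ => algebraMap ℂ (Gr n) x) z :=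
  AnalyticAt.gr_map (Algebra.linearMap ℂ (Gr n)) (analyticAt_id (𝕜 := ℂ) (z := z))

theorem deriv_gr_algebraMap : deriv (fun x : ℂ => algebraMap ℂ (Gr n) x) z = 1 := by
  have h := deriv_gr_map (Algebra.linearMap ℂ (Gr n)) (differentiableAt_id (𝕜 := ℂ) (x := z))
  simpa using h

theorem AnalyticAt.iteratedDeriv_gr (hF : AnalyticAt ℂ F z) (j : ℕ) :
    AnalyticAt ℂ (iteratedDeriv j F) z := by
  rw [iteratedDeriv_eq_iterate]
  exact hF.iterated_deriv j

theorem iteratedDeriv_gr_map (L : Gr n →ₗ[ℂ] Gr m) (hF : AnalyticAt ℂ F z) (j : ℕ) :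
    iteratedDeriv j (fun x => L (F x)) z = L (iteratedDeriv j F z) := by
  induction j generalizing z with
  | zero => simp
  | succ j ih =>
    have h : iteratedDeriv j (fun x => L (F x)) =ᶠ[𝓝 z] fun x => L (iteratedDeriv j F x) := by
      filter_upwards [hF.eventually_analyticAt] with x hx using ih hx
    rw [iteratedDeriv_succ, h.deriv_eq, deriv_gr_map L (hF.iteratedDeriv_gr j).differentiableAt,
      iteratedDeriv_succ]

/-- Leibniz' rule. -/
theorem iteratedDeriv_gr_mul (hF : AnalyticAt ℂ F z) (hG : AnalyticAt ℂ G z) (j : ℕ) :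
    iteratedDeriv j (fun x => F x * G x) z =
      ∑ p ∈ Finset.HasAntidiagonal.antidiagonal j,
        j.choose p.1 • (iteratedDeriv p.1 F z * iteratedDeriv p.2 G z) := by
  induction j generalizing z with
  | zero => simp
  | succ j ih =>
    have h : iteratedDeriv j (fun x => F x * G x) =ᶠ[𝓝 z] fun x =>
        ∑ p ∈ Finset.HasAntidiagonal.antidiagonal j,
          j.choose p.1 • (iteratedDeriv p.1 F x * iteratedDeriv p.2 G x) := by
      filter_upwards [hF.eventually_analyticAt, hG.eventually_analyticAt] with x hx hy
        using ih hx hy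
    rw [iteratedDeriv_succ, h.deriv_eq, Finset.sum_antidiagonal_choose_succ_nsmul
      (fun a b => iteratedDeriv a F z * iteratedDeriv b G z), ← Finset.sum_add_distrib,
      deriv_fun_sum]
    · refine Finset.sum_congr rfl fun p hp => ?_
      rw [deriv_fun_const_smul _ ((hF.iteratedDeriv_gr _).gr_mul
        (hG.iteratedDeriv_gr _)).differentiableAt, deriv_gr_mul (hF.iteratedDeriv_gr _).differentiableAt
        (hG.iteratedDeriv_gr _).differentiableAt, ← iteratedDeriv_succ, ← iteratedDeriv_succ,
        ← Nat.choose_symm_of_eq_add (Finset.HasAntidiagonal.mem_antidiagonal.mp hp).symm, smul_add, add_comm]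
    · intro p _
      exact ((hF.iteratedDeriv_gr _).gr_mul (hG.iteratedDeriv_gr _)).differentiableAt.const_smul _

end Analytic

/-! ### Taylor evaluation at an even element respects sums and products. -/

section EvalAt

variable {n : ℕ} {F G : ℂ → Gr n} {Z : Gr n}

theorem evalAt_congr (h : F =ᶠ[𝓝 (Gr.body Z)] G) : evalAt F Z = evalAt G Z := by
  refine Finset.sum_congr rfl fun j _ => ?_
  rw [h.iteratedDeriv_eq]

theorem body_sub_body (Z : Gr n) : Gr.body (Z - algebraMap ℂ (Gr n) (Gr.body Z)) = 0 := by
  rw [map_sub, Gr.body_algebraMap, sub_self]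

theorem sub_body_pow (Z : Gr n) : (Z - algebraMap ℂ (Gr n) (Gr.body Z)) ^ (n + 1) = 0 :=
  Gr.pow_eq_zero_of_body_eq_zero (body_sub_body Z)

theorem evalAt_add (hF : AnalyticAt ℂ F (Gr.body Z)) (hG : AnalyticAt ℂ G (Gr.body Z)) :
    evalAt (fun x => F x + G x) Z = evalAt F Z + evalAt G Z := by
  rw [evalAt, evalAt, evalAt, ← Finset.sum_add_distrib]
  refine Finset.sum_congr rfl fun j _ => ?_
  rw [iteratedDeriv_fun_add hF.contDiffAt hG.contDiffAt, add_mul, smul_add]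

/-- Polynomials in a central nilpotent multiply by the Cauchy product, and the terms that truncation
discards carry a vanishing power of `h`. -/
theorem sum_range_mul_sum_range_of_pow_eq_zero {A : Type*} [Ring A] {h : A}
    (hc : ∀ y, h * y = y * h) {m : ℕ} (hm : h ^ m = 0) (a b : ℕ → A) :
    (∑ i ∈ Finset.range m, a i * h ^ i) * ∑ i ∈ Finset.range m, b i * h ^ i =
      ∑ j ∈ Finset.range m, (∑ p ∈ Finset.HasAntidiagonal.antidiagonal j, a p.1 * b p.2) * h ^ j := by
  have e : ∀ i k, a i * h ^ i * (b k * h ^ k) = a i * b k * h ^ (i + k) := by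
    intro i k
    have : Commute (h ^ i) (b k) := Commute.pow_left (hc _) _
    rw [mul_assoc, ← mul_assoc (h ^ i), this.eq, pow_add]
    noncomm_ring
  have key := Finset.sum_range_diag_flip m fun i k => a i * b k * h ^ (i + k)
  rw [Finset.sum_mul_sum]
  simp only [e]
  transitivity ∑ i ∈ Finset.range m, ∑ k ∈ Finset.range (m - i), a i * b k * h ^ (i + k)
  · refine Finset.sum_congr rfl fun i _ => (Finset.sum_subset ?_ fun k _ hk => ?_).symm
    · exact Finset.range_mono (Nat.sub_le _ _)
    · rw [Finset.mem_range, not_lt] at hk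
      rw [pow_eq_zero_of_le (by omega : m ≤ i + k) hm, mul_zero]
  · rw [← key]
    refine Finset.sum_congr rfl fun j _ => ?_
    rw [Finset.Nat.sum_antidiagonal_eq_sum_range_succ fun i k => a i * b k, Finset.sum_mul]
    refine Finset.sum_congr rfl fun k hk => ?_
    rw [Finset.mem_range] at hk
    rw [show k + (j - k) = j by omega]

/-- Evenness of `Z` makes its nilpotent part central, so the Taylor sums multiply by the Cauchy
product; its coefficients are those of Leibniz' rule divided by factorials. -/
theorem evalAt_mul (hZ : Gr.IsEven Z) (hF : AnalyticAt ℂ F (Gr.body Z))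
    (hG : AnalyticAt ℂ G (Gr.body Z)) :
    evalAt (fun x => F x * G x) Z = evalAt F Z * evalAt G Z := by
  have hc : ∀ y, (Z - algebraMap ℂ (Gr n) (Gr.body Z)) * y =
      y * (Z - algebraMap ℂ (Gr n) (Gr.body Z)) :=
    (hZ.sub (Gr.isEven_algebraMap _)).comm
  simp only [evalAt, ← smul_mul_assoc]
  rw [sum_range_mul_sum_range_of_pow_eq_zero hc (sub_body_pow Z)]
  refine Finset.sum_congr rfl fun j _ => congrArg (· * _) ?_
  rw [iteratedDeriv_gr_mul hF hG, Finset.smul_sum]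
  refine Finset.sum_congr rfl fun p hp => ?_
  rw [smul_mul_smul_comm, ← Nat.cast_smul_eq_nsmul ℂ, smul_smul]
  congr 1
  rw [Finset.HasAntidiagonal.mem_antidiagonal] at hp
  subst hp
  have h : ((p.1 + p.2).choose p.1 : ℂ) * p.1.factorial * p.2.factorial =
      (p.1 + p.2).factorial := by
    rw [Nat.choose_symm_add]
    exact_mod_cast Nat.add_choose_mul_factorial_mul_factorial p.1 p.2
  have h0 : ((p.1 + p.2).factorial : ℂ) ≠ 0 := Nat.cast_ne_zero.mpr (Nat.factorial_ne_zero _)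
  have h1 : (p.1.factorial : ℂ) ≠ 0 := Nat.cast_ne_zero.mpr (Nat.factorial_ne_zero _)
  have h2 : (p.2.factorial : ℂ) ≠ 0 := Nat.cast_ne_zero.mpr (Nat.factorial_ne_zero _)
  field_simp
  linear_combination h

theorem evalAt_const (c : Gr n) (Z : Gr n) : evalAt (fun _ => c) Z = c := by
  rw [evalAt, Finset.sum_range_succ']
  simp [iteratedDeriv_const]

/-- All terms of order at least two contain `h * h`. The sum runs up to order `n`, so `n ≠ 0`
guarantees that it has a linear term. -/
theorem evalAt_linear_of_sq {h : Gr n} (w : ℂ) (hh : h * h = 0) (hb : Gr.body h = 0) (hn : n ≠ 0) :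
    evalAt F (algebraMap ℂ _ w + h) = F w + deriv F w * h := by
  obtain ⟨m, rfl⟩ := Nat.exists_eq_succ_of_ne_zero hn
  have e : Gr.body (algebraMap ℂ _ w + h) = w := by rw [map_add, Gr.body_algebraMap, hb, add_zero]
  have : ∀ j, h ^ (j + 1 + 1) = 0 := fun j => by
    rw [pow_succ, pow_succ, mul_assoc, hh, mul_zero]
  rw [evalAt, Finset.sum_range_succ', Finset.sum_range_succ', e, add_sub_cancel_left]
  simp only [this, mul_zero, smul_zero, Finset.sum_const_zero]
  simp [iteratedDeriv_one, add_comm]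

theorem evalAt_id (Z : Gr n) : evalAt (fun x => algebraMap ℂ _ x) Z = Z := by
  have h : ∀ j, iteratedDeriv (j + 1 + 1) (fun x => algebraMap ℂ (Gr n) x) = 0 := by
    intro j
    have h1 : deriv (fun x => algebraMap ℂ (Gr n) x) = fun _ => 1 := funext fun z =>
      deriv_gr_algebraMap
    rw [iteratedDeriv_succ', h1, iteratedDeriv_succ']
    simp only [deriv_const']
    exact funext fun x => iteratedDeriv_fun_const_zero (𝕜 := ℂ) (x := x)
  -- For `n = 0` the Taylor sum has no linear term, but then `Z` equals its body.
  rcases Nat.eq_zero_or_pos n with rfl | hn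
  · have h1 := sub_body_pow Z
    rw [zero_add, pow_one, sub_eq_zero] at h1
    rw [evalAt]
    simpa using h1.symm
  · obtain ⟨m, rfl⟩ := Nat.exists_eq_succ_of_ne_zero hn.ne'
    rw [evalAt, Finset.sum_range_succ', Finset.sum_range_succ']
    simp only [h, Pi.zero_apply, zero_mul, smul_zero, Finset.sum_const_zero, iteratedDeriv_one,
      zero_add, deriv_gr_algebraMap]
    simp

theorem body_evalAt : Gr.body (evalAt F Z) = Gr.body (F (Gr.body Z)) := by
  rw [evalAt, Finset.sum_range_succ', map_add, map_sum]
  simp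

theorem iteratedDeriv_invol {z : ℂ} (hF : AnalyticAt ℂ F z) (j : ℕ) :
    iteratedDeriv j (fun x => Gr.invol (F x)) z = Gr.invol (iteratedDeriv j F z) :=
  iteratedDeriv_gr_map Gr.invol.toLinearMap hF j

theorem invol_evalAt (hZ : Gr.IsEven Z) (hF : AnalyticAt ℂ F (Gr.body Z)) :
    Gr.invol (evalAt F Z) = evalAt (fun x => Gr.invol (F x)) Z := by
  rw [evalAt, evalAt, map_sum]
  refine Finset.sum_congr rfl fun j _ => ?_
  rw [map_smul, map_mul, map_pow, (hZ.sub (Gr.isEven_algebraMap _)), iteratedDeriv_invol hF]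

end EvalAt

/-! ### Rigidity of twisted derivations on germs. -/

section Uniqueness

variable {m n : ℕ}

/-- Taylor's formula with remainder in the ring of germs. -/
theorem AnalyticAt.exists_eq_sum_pow_smul {V : Type*} [NormedAddCommGroup V] [NormedSpace ℂ V]
    [CompleteSpace V] {F : ℂ → V} {z₀ : ℂ} (hF : AnalyticAt ℂ F z₀) :
    ∃ R : ℂ → V, AnalyticAt ℂ R z₀ ∧ ∀ z, F z = F z₀ + (z - z₀) • R z := by
  refine ⟨dslope F z₀, ?_, fun z => ?_⟩
  · obtain ⟨p, hp⟩ := hF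
    exact ⟨_, hp.has_fpower_series_dslope_fslope⟩
  · rw [sub_smul_dslope]
    abel

/-- A map on germs which satisfies a twisted Leibniz rule and annihilates the constants and the
coordinate is zero. -/
theorem eq_zero_of_leibniz {δ ρ σ : (ℂ → Gr m) → Gr n} {z₀ : ℂ}
    (hadd : ∀ F G, AnalyticAt ℂ F z₀ → AnalyticAt ℂ G z₀ → δ (fun z => F z + G z) = δ F + δ G)
    (hmul : ∀ F G, AnalyticAt ℂ F z₀ → AnalyticAt ℂ G z₀ →
      δ (fun z => F z * G z) = δ F * ρ G + σ F * δ G)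
    (hnil : IsNilpotent (σ fun z => algebraMap ℂ _ (z - z₀)))
    (hscal : ∀ r, δ (fun _ => algebraMap ℂ _ r) = 0)
    (hgen : ∀ i, δ (fun _ => Gr.gen i) = 0)
    (hcoord : δ (fun z => algebraMap ℂ _ z) = 0)
    {F : ℂ → Gr m} (hF : AnalyticAt ℂ F z₀) : δ F = 0 := by
  have hconst : ∀ c : Gr m, δ (fun _ => c) = 0 := by
    intro c
    induction c using Gr.induction_gen with
    | algebraMap r => exact hscal r
    | gen i => exact hgen i
    | mul a b ha hb =>
      rw [hmul _ _ analyticAt_const analyticAt_const, ha, hb, zero_mul, mul_zero, add_zero]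
    | add a b ha hb => rw [hadd _ _ analyticAt_const analyticAt_const, ha, hb, add_zero]
  have hlin : δ (fun z => algebraMap ℂ _ (z - z₀)) = 0 := by
    have h : (fun z => algebraMap ℂ (Gr m) (z - z₀)) =
        fun z => algebraMap ℂ (Gr m) z + algebraMap ℂ (Gr m) (-z₀) := by
      funext z
      rw [← map_add, sub_eq_add_neg]
    rw [h, hadd _ _ analyticAt_gr_algebraMap analyticAt_const, hcoord, hscal, add_zero]
  obtain ⟨K, hK⟩ := hnil
  have hz : AnalyticAt ℂ (fun z : ℂ => algebraMap ℂ (Gr m) (z - z₀)) z₀ :=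
    AnalyticAt.gr_map (Algebra.linearMap ℂ (Gr m)) (analyticAt_id.sub analyticAt_const)
  -- Writing `F = F z₀ + (z - z₀) R`, the constant and the factor `z - z₀` are killed by `δ`, which
  -- leaves `δ F = σ(z - z₀) δ R`. Iterating produces arbitrary powers of the nilpotent `σ(z - z₀)`,
  -- so no convergence argument is needed.
  have step : ∀ k (F : ℂ → Gr m), AnalyticAt ℂ F z₀ → ∃ R : ℂ → Gr m, AnalyticAt ℂ R z₀ ∧
      δ F = (σ fun z => algebraMap ℂ _ (z - z₀)) ^ k * δ R := by
    intro k
    induction k with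
    | zero => exact fun F hF => ⟨F, hF, by rw [pow_zero, one_mul]⟩
    | succ k ih =>
      intro F hF
      obtain ⟨R, hR, h⟩ := hF.exists_eq_sum_pow_smul
      obtain ⟨R', hR', h'⟩ := ih R hR
      refine ⟨R', hR', ?_⟩
      have e : F = fun z => (fun _ => F z₀) z + (fun z => algebraMap ℂ (Gr m) (z - z₀) * R z) z :=
        funext fun z => (h z).trans (congrArg _ (Algebra.smul_def _ _))
      rw [e, hadd _ _ analyticAt_const (hz.gr_mul hR), hconst, hmul _ _ hz hR, hlin, zero_mul,
        zero_add, zero_add, h', pow_succ', mul_assoc]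
  obtain ⟨R, -, h⟩ := step K F hF
  rw [h, hK, zero_mul]

end Uniqueness


/-! ### Pull-back of superfunctions and composition. -/

namespace SuperMap

variable {N k l m : ℕ}

/-- Near `z` the coordinate expression is holomorphic and of the right parities. -/
structure IsRegularAt (Φ : SuperMap N k l) (z : ℂ) : Prop where
  even : AnalyticAt ℂ Φ.even z
  odd : ∀ i, AnalyticAt ℂ (Φ.odd i) z
  isEven : ∀ᶠ x in 𝓝 z, Gr.IsEven (Φ.even x)
  isOdd : ∀ i, ∀ᶠ x in 𝓝 z, Gr.IsOdd (Φ.odd i x)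

theorem IsHolomorphicOn.isRegularAt {Φ : SuperMap N k l} {U : Set ℂ} {f₀ : ℂ → ℂ}
    (h : Φ.IsHolomorphicOn U f₀) (hU : IsOpen U) {z : ℂ} (hz : z ∈ U) : Φ.IsRegularAt z where
  even := h.differentiable_even.analyticAt (hU.mem_nhds hz)
  odd i := (h.differentiable_odd i).analyticAt (hU.mem_nhds hz)
  isEven := by filter_upwards [hU.mem_nhds hz] with x hx using h.isEven x hx
  isOdd i := by filter_upwards [hU.mem_nhds hz] with x hx using h.isOdd i x hx

variable {Φ : SuperMap N k l} {z : ℂ} {F G : ℂ → Gr (N + l)}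

theorem IsRegularAt.eventually (h : Φ.IsRegularAt z) : ∀ᶠ x in 𝓝 z, Φ.IsRegularAt x := by
  filter_upwards [h.even.eventually_analyticAt,
    eventually_all.mpr fun i => (h.odd i).eventually_analyticAt,
    eventually_eventually_nhds.mpr h.isEven,
    eventually_all.mpr fun i => eventually_eventually_nhds.mpr (h.isOdd i)] with x h1 h2 h3 h4
  exact ⟨h1, h2, h3, h4⟩

theorem pullback_congr (h : F =ᶠ[𝓝 (Gr.body (Φ.even z))] G) :
    Φ.pullback F z = Φ.pullback G z :=
  evalAt_congr (h.mono fun x hx => by simp only [hx])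

theorem pullback_const (c : Gr (N + l)) :
    Φ.pullback (fun _ => c) z = subst (fun i => Φ.odd i z) c :=
  evalAt_const _ _

theorem pullback_coord : Φ.pullback (fun x => algebraMap ℂ _ x) z = Φ.even z := by
  simp only [pullback, AlgHom.commutes]
  exact evalAt_id _

theorem analyticAt_subst (Θ : Fin l → Gr (N + k)) {w : ℂ} (hF : AnalyticAt ℂ F w) :
    AnalyticAt ℂ (fun x => subst Θ (F x)) w :=
  hF.gr_map (subst Θ).toLinearMap

theorem pullback_add (hF : AnalyticAt ℂ F (Gr.body (Φ.even z)))
    (hG : AnalyticAt ℂ G (Gr.body (Φ.even z))) :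
    Φ.pullback (fun x => F x + G x) z = Φ.pullback F z + Φ.pullback G z := by
  simp only [pullback, map_add]
  exact evalAt_add (analyticAt_subst _ hF) (analyticAt_subst _ hG)

theorem pullback_mul (h : Gr.IsEven (Φ.even z)) (hF : AnalyticAt ℂ F (Gr.body (Φ.even z)))
    (hG : AnalyticAt ℂ G (Gr.body (Φ.even z))) :
    Φ.pullback (fun x => F x * G x) z = Φ.pullback F z * Φ.pullback G z := by
  simp only [pullback, map_mul]
  exact evalAt_mul h (analyticAt_subst _ hF) (analyticAt_subst _ hG)

theorem pullback_const_mul (h : Gr.IsEven (Φ.even z)) (c : Gr (N + l))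
    (hF : AnalyticAt ℂ F (Gr.body (Φ.even z))) :
    Φ.pullback (fun x => c * F x) z = subst (fun i => Φ.odd i z) c * Φ.pullback F z := by
  rw [pullback_mul h analyticAt_const hF, pullback_const]

theorem pullback_const_smul (h : Gr.IsEven (Φ.even z)) (c : ℂ)
    (hF : AnalyticAt ℂ F (Gr.body (Φ.even z))) :
    Φ.pullback (fun x => c • F x) z = c • Φ.pullback F z := by
  simp only [Algebra.smul_def]
  rw [pullback_const_mul h _ hF, AlgHom.commutes]

theorem body_pullback : Gr.body (Φ.pullback F z) = Gr.body (F (Gr.body (Φ.even z))) := by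
  rw [pullback, body_evalAt, body_subst]

theorem invol_pullback (h : Gr.IsEven (Φ.even z)) (hF : AnalyticAt ℂ F (Gr.body (Φ.even z))) :
    Gr.invol (Φ.pullback F z) = Φ.pullback (fun x => Gr.invol (F x)) z := by
  rw [pullback, invol_evalAt h (analyticAt_subst _ hF)]
  simp only [invol_subst]
  rfl

theorem analyticAt_subst_odd (h : Φ.IsRegularAt z) (c : Gr (N + l)) :
    AnalyticAt ℂ (fun x => subst (fun i => Φ.odd i x) c) z := by
  induction c using Gr.induction_theta with
  | algebraMap r => simpa only [AlgHom.commutes] using analyticAt_const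
  | incl_gen a => simpa only [subst_incl] using analyticAt_const
  | theta i =>
    refine (h.odd i).congr ?_
    filter_upwards [h.isOdd i] with x hx
    rw [subst_theta hx]
  | mul a b ha hb => simpa only [map_mul] using ha.gr_mul hb
  | add a b ha hb => simpa only [map_add] using ha.fun_add hb

theorem analyticAt_body (h : Φ.IsRegularAt z) :
    AnalyticAt ℂ (fun x => Gr.body (Φ.even x)) z :=
  AnalyticAt.gr_map (Gr.body (n := N + k)).toLinearMap h.even

/-- Both the substitution and its argument vary with `x`. Expanding the argument in the monomial
basis separates them into scalar analytic coefficients and substitutions into fixed elements. -/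
theorem analyticAt_subst_comp (h : Φ.IsRegularAt z) (hF : AnalyticAt ℂ F (Gr.body (Φ.even z))) :
    AnalyticAt ℂ (fun x => subst (fun i => Φ.odd i x) (F (Gr.body (Φ.even x)))) z := by
  have e : (fun x => subst (fun i => Φ.odd i x) (F (Gr.body (Φ.even x)))) = fun x =>
      ∑ s, Gr.coeffs (N + l) (F (Gr.body (Φ.even x))) s •
        subst (fun i => Φ.odd i x) ((Pi.basisFun ℂ (Fin (N + l))).ExteriorAlgebra s) := by
    funext x
    conv_lhs => rw [← ((Pi.basisFun ℂ (Fin (N + l))).ExteriorAlgebra).sum_equivFun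
      (F (Gr.body (Φ.even x)))]
    rw [map_sum]
    exact Finset.sum_congr rfl fun s _ => map_smul _ _ _
  rw [e]
  refine Finset.analyticAt_fun_sum _ fun s _ => AnalyticAt.fun_smul ?_ (analyticAt_subst_odd h _)
  exact AnalyticAt.comp (f := fun x => Gr.body (Φ.even x))
    (AnalyticAt.gr_map ((LinearMap.proj s).comp (Gr.coeffs (N + l)).toLinearMap) hF)
    (analyticAt_body h)

/-- Inside the Taylor sum at `x` the substitution is frozen at `x`. Being linear it can be taken out
of the iterated derivatives, and what remains is a finite sum of products of analytic functions. -/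
theorem analyticAt_pullback (h : Φ.IsRegularAt z) (hF : AnalyticAt ℂ F (Gr.body (Φ.even z))) :
    AnalyticAt ℂ (Φ.pullback F) z := by
  have e : (fun x => ∑ j ∈ Finset.range (N + k + 1), ((j.factorial : ℂ)⁻¹) •
      (subst (fun i => Φ.odd i x) (iteratedDeriv j F (Gr.body (Φ.even x))) *
        (Φ.even x - algebraMap ℂ _ (Gr.body (Φ.even x))) ^ j)) =ᶠ[𝓝 z] Φ.pullback F := by
    filter_upwards [(analyticAt_body h).continuousAt.eventually hF.eventually_analyticAt] with x hx
    refine Finset.sum_congr rfl fun j _ => ?_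
    have h1 := iteratedDeriv_gr_map (subst fun i => Φ.odd i x).toLinearMap hx j
    exact congrArg (fun y => _ • (y * _)) h1.symm
  refine AnalyticAt.congr (Finset.analyticAt_fun_sum _ fun j _ => ?_) e
  refine AnalyticAt.fun_smul analyticAt_const (AnalyticAt.gr_mul ?_ (AnalyticAt.gr_pow ?_ _))
  · exact analyticAt_subst_comp h (hF.iteratedDeriv_gr j)
  · exact h.even.sub (AnalyticAt.gr_map (Algebra.linearMap ℂ (Gr (N + k))) (analyticAt_body h))

theorem isNilpotent_pullback_coord_sub :
    IsNilpotent (Φ.pullback (fun x => algebraMap ℂ _ (x - Gr.body (Φ.even z))) z) :=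
  ⟨N + k + 1, Gr.pow_eq_zero_of_body_eq_zero (by rw [body_pullback]; simp)⟩

theorem pullback_isOdd (h : Gr.IsEven (Φ.even z)) (hF : AnalyticAt ℂ F (Gr.body (Φ.even z)))
    (ho : ∀ᶠ x in 𝓝 (Gr.body (Φ.even z)), Gr.IsOdd (F x)) : Gr.IsOdd (Φ.pullback F z) := by
  rw [Gr.IsOdd, invol_pullback h hF,
    pullback_congr (G := fun x => (-1 : ℂ) • F x) (by
      filter_upwards [ho] with x hx; rw [hx, neg_one_smul]),
    pullback_const_smul h _ hF, neg_one_smul]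

theorem pullback_isEven (h : Gr.IsEven (Φ.even z)) (hF : AnalyticAt ℂ F (Gr.body (Φ.even z)))
    (ho : ∀ᶠ x in 𝓝 (Gr.body (Φ.even z)), Gr.IsEven (F x)) : Gr.IsEven (Φ.pullback F z) := by
  rw [Gr.IsEven, invol_pullback h hF, pullback_congr (G := F) (by
    filter_upwards [ho] with x hx; exact hx)]

theorem IsRegularAt.comp {Ψ : SuperMap N l m} (hΨ : Ψ.IsRegularAt (Gr.body (Φ.even z)))
    (h : Φ.IsRegularAt z) : (Ψ.comp Φ).IsRegularAt z where
  even := analyticAt_pullback h hΨ.even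
  odd i := analyticAt_pullback h (hΨ.odd i)
  isEven := by
    filter_upwards [h.isEven, (analyticAt_body h).continuousAt.eventually hΨ.eventually]
      with x h1 h2 using pullback_isEven h1 h2.even h2.isEven
  isOdd i := by
    filter_upwards [h.isEven, (analyticAt_body h).continuousAt.eventually hΨ.eventually]
      with x h1 h2 using pullback_isOdd h1 (h2.odd i) (h2.isOdd i)

/-- Functoriality on constant superfunctions: both sides respect sums and products in `c`, and on an
odd coordinate they agree by the definition of composition. -/
theorem pullback_subst_odd {Ψ : SuperMap N l m} (hΨ : Ψ.IsRegularAt (Gr.body (Φ.even z)))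
    (h : Φ.IsRegularAt z) (c : Gr (N + m)) :
    Φ.pullback (fun x => subst (fun i => Ψ.odd i x) c) z =
      subst (fun i => (Ψ.comp Φ).odd i z) c := by
  induction c using Gr.induction_theta with
  | algebraMap r => simp only [AlgHom.commutes, pullback_const]
  | incl_gen a => simp only [subst_incl, pullback_const]
  | theta i =>
    rw [subst_theta ((hΨ.comp h).isOdd i).self_of_nhds]
    refine pullback_congr ?_
    filter_upwards [hΨ.isOdd i] with x hx
    rw [subst_theta hx]
  | mul a b ha hb =>
    simp only [map_mul]
    rw [pullback_mul h.isEven.self_of_nhds (analyticAt_subst_odd hΨ a) (analyticAt_subst_odd hΨ b),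
      ha, hb]
  | add a b ha hb =>
    simp only [map_add]
    rw [pullback_add (analyticAt_subst_odd hΨ a) (analyticAt_subst_odd hΨ b), ha, hb]

/-- Functoriality of the pull-back. -/
theorem pullback_pullback {Ψ : SuperMap N l m} (hΨ : Ψ.IsRegularAt (Gr.body (Φ.even z)))
    (h : Φ.IsRegularAt z) {F : ℂ → Gr (N + m)}
    (hF : AnalyticAt ℂ F (Gr.body ((Ψ.comp Φ).even z))) :
    Φ.pullback (Ψ.pullback F) z = (Ψ.comp Φ).pullback F z := by
  have hb : Gr.body (Ψ.even (Gr.body (Φ.even z))) = Gr.body ((Ψ.comp Φ).even z) :=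
    body_pullback.symm
  have hΦe := h.isEven.self_of_nhds
  have hce := (hΨ.comp h).isEven.self_of_nhds
  have an : ∀ {F : ℂ → Gr (N + m)}, AnalyticAt ℂ F (Gr.body ((Ψ.comp Φ).even z)) →
      AnalyticAt ℂ (Ψ.pullback F) (Gr.body (Φ.even z)) := fun hF =>
    analyticAt_pullback hΨ (by rwa [hb])
  have hev : ∀ {F : ℂ → Gr (N + m)}, AnalyticAt ℂ F (Gr.body ((Ψ.comp Φ).even z)) →
      ∀ᶠ x in 𝓝 (Gr.body (Φ.even z)), AnalyticAt ℂ F (Gr.body (Ψ.even x)) := fun hF =>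
    (analyticAt_body hΨ).continuousAt.eventually (by
      have := hF.eventually_analyticAt
      rwa [← hb] at this)
  rw [← sub_eq_zero]
  -- The difference of two multiplicative maps satisfies `δ (F G) = δ F · ρ G + σ F · δ G` with `ρ`,
  -- `σ` the two maps themselves.
  refine eq_zero_of_leibniz (z₀ := Gr.body ((Ψ.comp Φ).even z))
    (δ := fun F => Φ.pullback (Ψ.pullback F) z - (Ψ.comp Φ).pullback F z)
    (ρ := fun F => Φ.pullback (Ψ.pullback F) z) (σ := fun F => (Ψ.comp Φ).pullback F z)
    ?_ ?_ ?_ ?_ ?_ ?_ hF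
  · intro F G hF hG
    have e : Ψ.pullback (fun x => F x + G x) =ᶠ[𝓝 (Gr.body (Φ.even z))]
        fun x => Ψ.pullback F x + Ψ.pullback G x := by
      filter_upwards [hev hF, hev hG] with x h1 h2 using pullback_add h1 h2
    rw [pullback_congr e, pullback_add (an hF) (an hG), pullback_add hF hG]
    abel
  · intro F G hF hG
    have e : Ψ.pullback (fun x => F x * G x) =ᶠ[𝓝 (Gr.body (Φ.even z))]
        fun x => Ψ.pullback F x * Ψ.pullback G x := by
      filter_upwards [hev hF, hev hG, hΨ.isEven] with x h1 h2 h3 using pullback_mul h3 h1 h2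
    rw [pullback_congr e, pullback_mul hΦe (an hF) (an hG), pullback_mul hce hF hG]
    noncomm_ring
  · exact isNilpotent_pullback_coord_sub
  · intro r
    have e : Ψ.pullback (fun _ => algebraMap ℂ _ r) = fun _ => algebraMap ℂ _ r := by
      funext x
      rw [pullback_const, AlgHom.commutes]
    simp only [e, pullback_const, AlgHom.commutes, sub_self]
  · intro i
    have e : Ψ.pullback (fun _ => Gr.gen i) = fun x => subst (fun i => Ψ.odd i x) (Gr.gen i) :=
      funext fun x => pullback_const _
    simp only [e]
    rw [pullback_subst_odd hΨ h, pullback_const, sub_self]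
  · have e : Ψ.pullback (fun x => algebraMap ℂ _ x) = Ψ.even := funext fun x => pullback_coord
    simp only [e, pullback_coord]
    exact sub_self _

end SuperMap


/-! ### The odd vector fields and their chain rule. -/

section SuperD

variable {N k : ℕ} {i j : Fin k} {F G : ℂ → Gr (N + k)} {z : ℂ}

/-- The odd vector field `∂_{θ_i} + ½ θ_j ∂_z`. -/
def superD (i j : Fin k) (F : ℂ → Gr (N + k)) (z : ℂ) : Gr (N + k) :=
  dTheta N i (F z) + (1 / 2 : ℂ) • (theta N j * deriv F z)

theorem superD_congr (h : F =ᶠ[𝓝 z] G) : superD i j F z = superD i j G z := by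
  rw [superD, superD, h.deriv_eq, h.self_of_nhds]

theorem superD_add (hF : DifferentiableAt ℂ F z) (hG : DifferentiableAt ℂ G z) :
    superD i j (fun x => F x + G x) z = superD i j F z + superD i j G z := by
  rw [superD, superD, superD, deriv_fun_add hF hG, map_add, mul_add, smul_add]
  abel

theorem superD_const_smul (c : ℂ) (hF : DifferentiableAt ℂ F z) :
    superD i j (fun x => c • F x) z = c • superD i j F z := by
  rw [superD, superD, deriv_fun_const_smul c hF, map_smul, mul_smul_comm, smul_add, smul_comm]

/-- Both summands of the vector field are odd: moving `∂_{θ_i}` or `θ_j` past `F z` produces the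
same involution. -/
theorem superD_mul (hF : DifferentiableAt ℂ F z) (hG : DifferentiableAt ℂ G z) :
    superD i j (fun x => F x * G x) z =
      superD i j F z * G z + Gr.invol (F z) * superD i j G z := by
  rw [superD, superD, superD, deriv_gr_mul hF hG, dTheta_mul, mul_add, ← mul_assoc, ← mul_assoc,
    (isOdd_theta j).mul_eq (F z), add_mul, mul_add, smul_add, smul_mul_assoc, mul_smul_comm,
    mul_assoc (Gr.invol (F z))]
  abel

theorem superD_const (c : Gr (N + k)) : superD i j (fun _ => c) z = dTheta N i c := by
  simp [superD]

theorem superD_coord :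
    superD i j (fun x => algebraMap ℂ _ x) z = (1 / 2 : ℂ) • theta N j := by
  rw [superD, dTheta_algebraMap, deriv_gr_algebraMap, mul_one, zero_add]

theorem AnalyticAt.superD (hF : AnalyticAt ℂ F z) : AnalyticAt ℂ (superD i j F) z :=
  (hF.gr_map (dTheta N i)).add
    (analyticAt_const.fun_smul (analyticAt_const.gr_mul hF.deriv))

theorem invol_superD (hF : AnalyticAt ℂ F z) :
    Gr.invol (superD i j F z) = -superD i j (fun x => Gr.invol (F x)) z := by
  have h : deriv (fun x => Gr.invol (F x)) z = Gr.invol (deriv F z) :=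
    deriv_gr_map Gr.invol.toLinearMap hF.differentiableAt
  rw [superD, superD, map_add, invol_dTheta, map_smul, map_mul, isOdd_theta, h, neg_mul, smul_neg,
    neg_add]

/-- Makes the factor `D_i θ'_i` of the chain rule central. -/
theorem isEven_superD (hF : AnalyticAt ℂ F z) (ho : ∀ᶠ x in 𝓝 z, Gr.IsOdd (F x)) :
    Gr.IsEven (superD i j F z) := by
  rw [Gr.IsEven, invol_superD hF, superD_congr (G := fun x => (-1 : ℂ) • F x) (by
    filter_upwards [ho] with x hx; rw [hx, neg_one_smul]),
    superD_const_smul _ hF.differentiableAt, neg_one_smul, neg_neg]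

end SuperD

namespace SuperMap

variable {N k : ℕ} {i j : Fin 2} {Φ : SuperMap N k 2} {z : ℂ}

/-- At `z` the map takes the line spanned by `D_i = ∂_{θ_i} + ½ θ_j ∂_z` to the line spanned by
`D'_i`. -/
structure PreservesAt (i j : Fin 2) (Φ : SuperMap N 2 2) (z : ℂ) : Prop where
  unit : IsUnit (superD i j (Φ.odd i) z)
  odd : superD i j (Φ.odd j) z = 0
  even : superD i j Φ.even z = superD i j (Φ.odd i) z * ((1 / 2 : ℂ) • Φ.odd j z)

theorem _root_.IsSuperconformalOn.plus {Φ : SuperMap N 2 2} {U : Set ℂ}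
    (h : IsSuperconformalOn Φ U) (hz : z ∈ U) : PreservesAt 0 1 Φ z :=
  ⟨h.unit_plus z hz, h.plus_odd z hz, h.plus_even z hz⟩

/-- `D_i = (D_i θ'_i) D'_i`. -/
theorem superD_pullback {Φ : SuperMap N 2 2} (hij : j ≠ i) (hΦ : Φ.IsRegularAt z)
    (h : PreservesAt i j Φ z) {F : ℂ → Gr (N + 2)} (hF : AnalyticAt ℂ F (Gr.body (Φ.even z))) :
    superD i j (Φ.pullback F) z = superD i j (Φ.odd i) z * Φ.pullback (superD i j F) z := by
  have hΦe := hΦ.isEven.self_of_nhds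
  have he : Gr.IsEven (superD i j (Φ.odd i) z) := isEven_superD (hΦ.odd i) (hΦ.isOdd i)
  have an : ∀ {F : ℂ → Gr (N + 2)}, AnalyticAt ℂ F (Gr.body (Φ.even z)) →
      DifferentiableAt ℂ (Φ.pullback F) z := fun hF => (analyticAt_pullback hΦ hF).differentiableAt
  have hev : ∀ {F : ℂ → Gr (N + 2)}, AnalyticAt ℂ F (Gr.body (Φ.even z)) →
      ∀ᶠ x in 𝓝 z, AnalyticAt ℂ F (Gr.body (Φ.even x)) := fun hF =>
    (analyticAt_body hΦ).continuousAt.eventually hF.eventually_analyticAt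
  have hinv : ∀ {F : ℂ → Gr (N + 2)}, AnalyticAt ℂ F (Gr.body (Φ.even z)) →
      AnalyticAt ℂ (fun x => Gr.invol (F x)) (Gr.body (Φ.even z)) := fun hF =>
    AnalyticAt.gr_map Gr.invol.toLinearMap hF
  rw [← sub_eq_zero]
  -- The defect of the chain rule is a derivation along the pull-back, twisted by the involution in
  -- `σ` because the vector fields are odd. Its vanishing on `θ_j` and on the even coordinate is
  -- what `PreservesAt` records; on `θ_i` it is automatic.
  refine eq_zero_of_leibniz (z₀ := Gr.body (Φ.even z))
    (δ := fun F => superD i j (Φ.pullback F) z -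
      superD i j (Φ.odd i) z * Φ.pullback (superD i j F) z)
    (ρ := fun F => Φ.pullback F z) (σ := fun F => Φ.pullback (fun x => Gr.invol (F x)) z)
    ?_ ?_ ?_ ?_ ?_ ?_ hF
  · intro F G hF hG
    have e : Φ.pullback (fun x => F x + G x) =ᶠ[𝓝 z] fun x => Φ.pullback F x + Φ.pullback G x := by
      filter_upwards [hev hF, hev hG] with x h1 h2 using pullback_add h1 h2
    have e' : superD i j (fun x => F x + G x) =ᶠ[𝓝 (Gr.body (Φ.even z))]
        fun x => superD i j F x + superD i j G x := by
      filter_upwards [hF.eventually_analyticAt, hG.eventually_analyticAt] with x h1 h2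
        using superD_add h1.differentiableAt h2.differentiableAt
    rw [superD_congr e, superD_add (an hF) (an hG), pullback_congr e',
      pullback_add hF.superD hG.superD]
    noncomm_ring
  · intro F G hF hG
    have e : Φ.pullback (fun x => F x * G x) =ᶠ[𝓝 z] fun x => Φ.pullback F x * Φ.pullback G x := by
      filter_upwards [hev hF, hev hG, hΦ.isEven] with x h1 h2 h3 using pullback_mul h3 h1 h2
    have e' : superD i j (fun x => F x * G x) =ᶠ[𝓝 (Gr.body (Φ.even z))]
        fun x => superD i j F x * G x + Gr.invol (F x) * superD i j G x := by
      filter_upwards [hF.eventually_analyticAt, hG.eventually_analyticAt] with x h1 h2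
        using superD_mul h1.differentiableAt h2.differentiableAt
    rw [superD_congr e, superD_mul (an hF) (an hG), pullback_congr e',
      pullback_add (hF.superD.gr_mul hG) ((hinv hF).gr_mul hG.superD),
      pullback_mul hΦe hF.superD hG, pullback_mul hΦe (hinv hF) hG.superD,
      invol_pullback hΦe hF, mul_add, ← mul_assoc, ← mul_assoc, he.comm (Φ.pullback (fun x => Gr.invol (F x)) z)]
    noncomm_ring
  · simp only [AlgHom.commutes]
    exact isNilpotent_pullback_coord_sub
  · intro r
    have e : Φ.pullback (fun _ => algebraMap ℂ _ r) = fun _ => algebraMap ℂ _ r := by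
      funext x
      rw [pullback_const, AlgHom.commutes]
    have e' : superD i j (fun _ => algebraMap ℂ (Gr (N + 2)) r) = fun _ => 0 := by
      funext x
      rw [superD_const, dTheta_algebraMap]
    rw [e, e', pullback_const, map_zero, mul_zero, sub_zero]
  · intro a
    have e : ∀ c, Φ.pullback (fun _ => c) = fun x => subst (fun i => Φ.odd i x) c :=
      fun c => funext fun x => pullback_const _
    have e' : ∀ c, superD i j (fun _ => c) = fun _ => dTheta N i c :=
      fun c => funext fun x => superD_const _
    rw [e, e', pullback_const]
    induction a using Fin.addCases with
    | left a =>
      rw [← incl_gen]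
      simp only [subst_incl]
      rw [superD_const, dTheta_incl, map_zero, mul_zero, sub_zero]
    | right a =>
      change superD i j (fun x => subst (fun i => Φ.odd i x) (theta N a)) z -
        superD i j (Φ.odd i) z * subst _ (dTheta N i (theta N a)) = 0
      rw [superD_congr (G := Φ.odd a) (by
        filter_upwards [hΦ.isOdd a] with x hx; rw [subst_theta hx]), dTheta_theta]
      by_cases hai : a = i
      · rw [if_pos hai, map_one, mul_one, hai, sub_self]
      · have haj : a = j := by omega
        rw [if_neg hai, map_zero, mul_zero, haj, h.odd, sub_zero]
  · have e : Φ.pullback (fun x => algebraMap ℂ _ x) = Φ.even := funext fun x => pullback_coord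
    have e' : superD i j (fun x => algebraMap ℂ (Gr (N + 2)) x) =
        fun _ => (1 / 2 : ℂ) • theta N j := funext fun x => superD_coord
    rw [e, e', pullback_const, map_smul, subst_theta (hΦ.isOdd j).self_of_nhds, h.even, sub_self]

/-- By the chain rule, the factor of the composition is that of `Φ` times the pull-back of that of
`Ψ`; the two remaining identities are pulled back from those of `Ψ`. -/
theorem PreservesAt.comp {Φ Ψ : SuperMap N 2 2} (hij : j ≠ i)
    (hΨ : Ψ.IsRegularAt (Gr.body (Φ.even z))) (hΦ : Φ.IsRegularAt z)
    (h' : ∀ᶠ x in 𝓝 (Gr.body (Φ.even z)), PreservesAt i j Ψ x)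
    (h : PreservesAt i j Φ z) : PreservesAt i j (Ψ.comp Φ) z where
  unit := by
    refine (superD_pullback hij hΦ h (hΨ.odd i)).symm ▸ h.unit.mul ?_
    -- Invertibility depends only on the body, and the body of a pull-back is the body of the
    -- original function at the underlying image point.
    rw [Gr.isUnit_iff, body_pullback, ← Gr.isUnit_iff]
    exact h'.self_of_nhds.unit
  odd := by
    refine (superD_pullback hij hΦ h (hΨ.odd j)).trans ?_
    rw [pullback_congr (h'.mono fun x hx => hx.odd), pullback_const, map_zero, mul_zero]
  even := by
    refine (superD_pullback hij hΦ h hΨ.even).trans ?_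
    change _ = superD i j (Φ.pullback (Ψ.odd i)) z * ((1 / 2 : ℂ) • Φ.pullback (Ψ.odd j) z)
    rw [superD_pullback hij hΦ h (hΨ.odd i), pullback_congr (h'.mono fun x hx => hx.even),
      pullback_mul hΦ.isEven.self_of_nhds (hΨ.odd i).superD
        (analyticAt_const.fun_smul (hΨ.odd j)),
      pullback_const_smul hΦ.isEven.self_of_nhds _ (hΨ.odd j), mul_assoc]

/-! ### The chiral quotient determines a superconformal map. -/

theorem isRegularAt_chiral : (chiral N).IsRegularAt z where
  even := analyticAt_gr_algebraMap.add analyticAt_const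
  odd _ := analyticAt_const
  isEven := Eventually.of_forall fun _ =>
    (Gr.isEven_algebraMap _).add (((isOdd_theta _).mul (isOdd_theta _)).smul _)
  isOdd _ := Eventually.of_forall fun _ => isOdd_theta _

theorem body_chiral_even : Gr.body ((chiral N).even z) = z := by
  simp only [chiral, map_add, map_smul]
  rw [Gr.body_algebraMap, map_mul, thetaP, (isOdd_theta _).body_eq, zero_mul, smul_zero, add_zero]

theorem chiral_comp_even (h0 : Gr.IsOdd (Φ.odd 0 z))
    (h1 : Gr.IsOdd (Φ.odd 1 z)) :
    ((chiral N).comp Φ).even z = Φ.even z + (1 / 2 : ℂ) • (Φ.odd 0 z * Φ.odd 1 z) := by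
  refine (pullback_add analyticAt_gr_algebraMap analyticAt_const).trans ?_
  rw [pullback_coord, pullback_const, map_smul, map_mul, thetaP, thetaM, subst_theta h0,
    subst_theta h1]

theorem chiral_comp_odd (h0 : Gr.IsOdd (Φ.odd 0 z)) (i : Fin 1) :
    ((chiral N).comp Φ).odd i z = Φ.odd 0 z := by
  exact (pullback_const _).trans (subst_theta h0)

/-- The superconformal map is recovered from its quotient: `D₊ Z = (D₊ θ'₊) θ'₋`, where
`Z = z' + ½ θ'₊ θ'₋`. -/
theorem superD_chiral_comp {Φ : SuperMap N 2 2} (hΦ : Φ.IsRegularAt z) (h : PreservesAt 0 1 Φ z) :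
    superD 0 1 ((chiral N).comp Φ).even z = superD 0 1 (Φ.odd 0) z * Φ.odd 1 z := by
  rw [superD_congr (G := fun x => Φ.even x + (1 / 2 : ℂ) • (Φ.odd 0 x * Φ.odd 1 x)) (by
    filter_upwards [hΦ.isOdd 0, hΦ.isOdd 1] with x h2 h3
      using chiral_comp_even h2 h3),
    superD_add hΦ.even.differentiableAt
      (analyticAt_const.fun_smul ((hΦ.odd 0).gr_mul (hΦ.odd 1))).differentiableAt,
    superD_const_smul _ ((hΦ.odd 0).gr_mul (hΦ.odd 1)).differentiableAt,
    superD_mul (hΦ.odd 0).differentiableAt (hΦ.odd 1).differentiableAt, h.odd, h.even, mul_zero,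
    add_zero, mul_smul_comm, ← add_smul]
  -- The terms `z'` and `½ θ'₊ θ'₋` contribute equal halves.
  norm_num

/-- The quotient shows `θ'₊` directly; cancelling the unit `D₊ θ'₊` in `D₊ Z = (D₊ θ'₊) θ'₋` gives
`θ'₋`, and then `z'` is what remains of `Z`. Agreement near `z` is assumed because `D₊`
differentiates. -/
theorem eq_of_chiral_comp_eq {Φ Φ' : SuperMap N 2 2} (hΦ : Φ.IsRegularAt z)
    (hΦ' : Φ'.IsRegularAt z) (h : PreservesAt 0 1 Φ z) (h' : PreservesAt 0 1 Φ' z)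
    (heven : ((chiral N).comp Φ).even =ᶠ[𝓝 z] ((chiral N).comp Φ').even)
    (hodd : ((chiral N).comp Φ).odd 0 =ᶠ[𝓝 z] ((chiral N).comp Φ').odd 0) :
    Φ.even z = Φ'.even z ∧ ∀ i, Φ.odd i z = Φ'.odd i z := by
  have e0 : Φ.odd 0 =ᶠ[𝓝 z] Φ'.odd 0 := by
    filter_upwards [hodd, hΦ.isOdd 0, hΦ'.isOdd 0] with x h1 h2 h3
    rwa [chiral_comp_odd h2, chiral_comp_odd h3] at h1
  have e1 : Φ.odd 1 z = Φ'.odd 1 z := by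
    have h1 := superD_chiral_comp hΦ h
    rw [superD_congr heven, superD_chiral_comp hΦ' h', ← superD_congr e0] at h1
    exact (h.unit.mul_left_cancel h1).symm
  refine ⟨?_, fun i => ?_⟩
  · have h1 := heven.self_of_nhds
    rw [chiral_comp_even (hΦ.isOdd 0).self_of_nhds
      (hΦ.isOdd 1).self_of_nhds, chiral_comp_even
      (hΦ'.isOdd 0).self_of_nhds (hΦ'.isOdd 1).self_of_nhds, e0.self_of_nhds, e1] at h1
    exact add_right_cancel h1
  · fin_cases i
    · exact e0.self_of_nhds
    · exact e1

/-- The outer map enters through its Taylor coefficients, hence agreement on an open set; for the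
inner map, agreement at the point suffices, as in `comp_congr_right`. -/
theorem comp_congr_left {l m : ℕ} {Φ : SuperMap N k l} {Ψ Ψ' : SuperMap N l m} {V : Set ℂ}
    (hV : IsOpen V) (h : Ψ.EqOn Ψ' V) (hz : Gr.body (Φ.even z) ∈ V) :
    (Ψ.comp Φ).even z = (Ψ'.comp Φ).even z ∧ ∀ i, (Ψ.comp Φ).odd i z = (Ψ'.comp Φ).odd i z :=
  ⟨pullback_congr (h.1.eventuallyEq_of_mem (hV.mem_nhds hz)),
    fun i => pullback_congr ((h.2 i).eventuallyEq_of_mem (hV.mem_nhds hz))⟩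

theorem comp_congr_right {l m : ℕ} {Φ Φ' : SuperMap N k l} (Ψ : SuperMap N l m)
    (h : Φ.even z = Φ'.even z ∧ ∀ i, Φ.odd i z = Φ'.odd i z) :
    (Ψ.comp Φ).even z = (Ψ.comp Φ').even z ∧ ∀ i, (Ψ.comp Φ).odd i z = (Ψ.comp Φ').odd i z := by
  have h2 : (fun i => Φ.odd i z) = fun i => Φ'.odd i z := funext h.2
  simp only [comp, pullback, h.1, h2, implies_true, and_self]

theorem comp_assoc {l m p : ℕ} {Φ : SuperMap N k l} {Ψ : SuperMap N l m} {Ω : SuperMap N m p}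
    (hΦ : Φ.IsRegularAt z) (hΨ : Ψ.IsRegularAt (Gr.body (Φ.even z)))
    (hΩ : Ω.IsRegularAt (Gr.body (Ψ.even (Gr.body (Φ.even z))))) :
    ((Ω.comp Ψ).comp Φ).even z = (Ω.comp (Ψ.comp Φ)).even z ∧
      ∀ i, ((Ω.comp Ψ).comp Φ).odd i z = (Ω.comp (Ψ.comp Φ)).odd i z := by
  have hb : Gr.body (Ψ.even (Gr.body (Φ.even z))) = Gr.body ((Ψ.comp Φ).even z) :=
    body_pullback.symm
  rw [hb] at hΩ
  exact ⟨pullback_pullback hΨ hΦ hΩ.even, fun i => pullback_pullback hΨ hΦ (hΩ.odd i)⟩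

end SuperMap


/-! ### Derivatives and inverses of the coefficient functions. -/

section Parity

variable {N n : ℕ} {F : ℂ → Gr n} {z : ℂ}

theorem isEven_deriv (hF : AnalyticAt ℂ F z) (h : ∀ᶠ x in 𝓝 z, Gr.IsEven (F x)) :
    Gr.IsEven (deriv F z) := by
  have h1 : deriv (fun x => Gr.invol (F x)) z = Gr.invol (deriv F z) :=
    deriv_gr_map Gr.invol.toLinearMap hF.differentiableAt
  rw [Gr.IsEven, ← h1]
  exact EventuallyEq.deriv_eq h

theorem isOdd_deriv (hF : AnalyticAt ℂ F z) (h : ∀ᶠ x in 𝓝 z, Gr.IsOdd (F x)) :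
    Gr.IsOdd (deriv F z) := by
  have h1 : deriv (fun x => Gr.invol (F x)) z = Gr.invol (deriv F z) :=
    deriv_gr_map Gr.invol.toLinearMap hF.differentiableAt
  rw [Gr.IsOdd, ← h1, ← deriv.fun_neg]
  exact EventuallyEq.deriv_eq h

theorem AnalyticAt.incl {F : ℂ → Gr N} {k : ℕ} (hF : AnalyticAt ℂ F z) :
    AnalyticAt ℂ (fun x => incl N k (F x)) z :=
  hF.gr_map (_root_.incl N k).toLinearMap

theorem deriv_incl {F : ℂ → Gr N} {k : ℕ} (hF : AnalyticAt ℂ F z) :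
    deriv (fun x => incl N k (F x)) z = incl N k (deriv F z) :=
  deriv_gr_map (incl N k).toLinearMap hF.differentiableAt

theorem deriv_const_mul_incl {F : ℂ → Gr N} {k : ℕ} (c : Gr (N + k)) (hF : AnalyticAt ℂ F z) :
    deriv (fun x => c * incl N k (F x)) z = c * incl N k (deriv F z) := by
  rw [deriv_gr_mul (differentiableAt_const c) hF.incl.differentiableAt, deriv_incl hF]
  simp

theorem theta_mul_self {k : ℕ} (i : Fin k) : theta N i * theta N i = 0 := (isOdd_theta i).mul_self

theorem theta_anticomm {k : ℕ} (i j : Fin k) : theta N i * theta N j = -(theta N j * theta N i) :=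
  (isOdd_theta i).anticomm (isOdd_theta j)

end Parity

section Inverse

variable {n : ℕ} {g : ℂ → Gr n} {z : ℂ}

/-- Left multiplication transfers inversion to the complete normed algebra of continuous
endomorphisms, where inversion is known to be analytic at units; the norm of `Gr n` is used only as
a vector space norm. -/
theorem Gr.inverse_eq_inverse_mulL {x : Gr n} (hx : IsUnit x) :
    Ring.inverse x = Ring.inverse (mulL n x) 1 := by
  have h : ∀ a b : Gr n, mulL n a * mulL n b = mulL n (a * b) := fun a b => by
    ext y
    exact (mul_assoc a b y).symm
  have h1 : mulL n 1 = 1 := by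
    ext y
    exact one_mul y
  have e := Ring.inverse_unit (M₀ := Gr n →L[ℂ] Gr n) ⟨mulL n x, mulL n (Ring.inverse x),
    by rw [h, Ring.mul_inverse_cancel _ hx, h1], by rw [h, Ring.inverse_mul_cancel _ hx, h1]⟩
  have e' : Ring.inverse (mulL n x) = mulL n (Ring.inverse x) := e
  rw [e', mulL_apply, mul_one]

theorem AnalyticAt.eventually_isUnit (hg : AnalyticAt ℂ g z) (h : IsUnit (g z)) :
    ∀ᶠ x in 𝓝 z, IsUnit (g x) := by
  rw [Gr.isUnit_iff] at h
  have hb : AnalyticAt ℂ (fun x => Gr.body (g x)) z := AnalyticAt.gr_map Gr.body.toLinearMap hg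
  filter_upwards [hb.continuousAt.eventually_ne h] with x hx using Gr.isUnit_of_body_ne_zero hx

theorem AnalyticAt.gr_inverse (hg : AnalyticAt ℂ g z) (h : IsUnit (g z)) :
    AnalyticAt ℂ (fun x => Ring.inverse (g x)) z := by
  have h1 : IsUnit (Gr.mulL n (g z)) := by
    have := h.map (Algebra.lmul ℂ (Gr n))
    exact this.map (Module.End.toContinuousLinearMap (Gr n) (𝕜 := ℂ)).toRingEquiv.toRingHom
  obtain ⟨u, hu⟩ := h1
  have h2 : AnalyticAt ℂ (fun x => Ring.inverse (Gr.mulL n (g x))) z := by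
    refine AnalyticAt.comp (g := Ring.inverse) (f := fun x => Gr.mulL n (g x)) ?_
      (((Gr.mulL n).analyticAt _).comp hg)
    rw [← hu]
    exact analyticAt_inverse u
  have h3 : AnalyticAt ℂ (fun x => Ring.inverse (Gr.mulL n (g x)) 1) z :=
    ((ContinuousLinearMap.apply ℂ (Gr n) (1 : Gr n)).analyticAt _).comp h2
  refine h3.congr ?_
  filter_upwards [hg.eventually_isUnit h] with x hx using (Gr.inverse_eq_inverse_mulL hx).symm

theorem deriv_gr_inverse (hg : AnalyticAt ℂ g z) (h : IsUnit (g z)) :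
    deriv (fun x => Ring.inverse (g x)) z =
      -(Ring.inverse (g z) * deriv g z * Ring.inverse (g z)) := by
  have h1 := deriv_gr_mul hg.differentiableAt (hg.gr_inverse h).differentiableAt
  have h2 : (fun x => g x * Ring.inverse (g x)) =ᶠ[𝓝 z] fun _ => 1 := by
    filter_upwards [hg.eventually_isUnit h] with x hx using Ring.mul_inverse_cancel _ hx
  rw [h2.deriv_eq, deriv_const] at h1
  calc deriv (fun x => Ring.inverse (g x)) z
      = Ring.inverse (g z) * (g z * deriv (fun x => Ring.inverse (g x)) z) := by
        rw [← mul_assoc, Ring.inverse_mul_cancel _ h, one_mul]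
    _ = _ := by rw [eq_neg_of_add_eq_zero_right h1.symm, mul_neg, mul_assoc]

end Inverse

/-! ### The odd derivatives of the explicit transformation. -/

section SuperconformalFormula

variable {N : ℕ} {i j : Fin 2} {z : ℂ} {F : ℂ → Gr N}

theorem superD_incl (hF : AnalyticAt ℂ F z) :
    superD i j (fun x => incl N 2 (F x)) z = (1 / 2 : ℂ) • (theta N j * incl N 2 (deriv F z)) := by
  rw [superD, dTheta_incl, deriv_incl hF, zero_add]

theorem superD_const_mul_incl (c : Gr (N + 2)) (hF : AnalyticAt ℂ F z) :
    superD i j (fun x => c * incl N 2 (F x)) z = dTheta N i c * incl N 2 (F z) +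
      (1 / 2 : ℂ) • (theta N j * c * incl N 2 (deriv F z)) := by
  rw [superD, dTheta_mul, dTheta_incl, deriv_const_mul_incl c hF, mul_zero, add_zero, mul_assoc]

theorem superD_theta_mul_incl (hF : AnalyticAt ℂ F z) :
    superD i j (fun x => theta N i * incl N 2 (F x)) z = incl N 2 (F z) +
      (1 / 2 : ℂ) • (theta N j * theta N i * incl N 2 (deriv F z)) := by
  rw [superD_const_mul_incl _ hF, dTheta_theta, if_pos rfl, one_mul]

theorem superD_theta_mul_incl' (hij : j ≠ i) (hF : AnalyticAt ℂ F z) :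
    superD i j (fun x => theta N j * incl N 2 (F x)) z = 0 := by
  rw [superD_const_mul_incl _ hF, dTheta_theta, if_neg hij, theta_mul_self, zero_mul, zero_mul,
    smul_zero, add_zero]

theorem superD_theta_mul_theta_mul_incl (hij : j ≠ i) (hF : AnalyticAt ℂ F z) :
    superD i j (fun x => theta N i * theta N j * incl N 2 (F x)) z =
      theta N j * incl N 2 (F z) := by
  rw [superD_const_mul_incl _ hF, dTheta_mul, dTheta_theta, if_pos rfl, dTheta_theta, if_neg hij,
    theta_anticomm i j, mul_neg, ← mul_assoc, theta_mul_self]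
  simp

theorem superD_theta_mul_theta_mul_incl' (hij : j ≠ i) (hF : AnalyticAt ℂ F z) :
    superD i j (fun x => theta N j * theta N i * incl N 2 (F x)) z =
      -(theta N j * incl N 2 (F z)) := by
  rw [superD_const_mul_incl _ hF, dTheta_mul, dTheta_theta, dTheta_theta, if_pos rfl, if_neg hij,
    ← mul_assoc, theta_mul_self, isOdd_theta]
  simp

variable {e q : ℂ → Gr N}

theorem superD_odd_self (hij : j ≠ i) (he : AnalyticAt ℂ e z) (hq : AnalyticAt ℂ q z) :
    superD i j (fun x => incl N 2 (e x) + theta N i * incl N 2 (q x) +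
      (1 / 2 : ℂ) • (theta N i * theta N j * incl N 2 (deriv e x))) z =
      incl N 2 (q z) + theta N j * incl N 2 (deriv e z) +
        (1 / 2 : ℂ) • (theta N j * theta N i * incl N 2 (deriv q z)) := by
  have h1 : AnalyticAt ℂ (fun x => theta N i * incl N 2 (q x)) z := analyticAt_const.gr_mul hq.incl
  have h2 : AnalyticAt ℂ (fun x => theta N i * theta N j * incl N 2 (deriv e x)) z :=
    analyticAt_const.gr_mul he.deriv.incl
  rw [superD_add (he.incl.fun_add h1).differentiableAt (analyticAt_const.fun_smul h2).differentiableAt,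
    superD_add he.incl.differentiableAt h1.differentiableAt,
    superD_const_smul _ h2.differentiableAt, superD_incl he, superD_theta_mul_incl hq,
    superD_theta_mul_theta_mul_incl hij he.deriv]
  module

/-- The quadratic term of the transformation is there for this cancellation: its derivative `-½ θ_j
e'` removes the `½ θ_j e'` coming from `e`. In `superD_odd_self` the two contributions add up
instead. -/
theorem superD_odd_other (hij : j ≠ i) (he : AnalyticAt ℂ e z) (hq : AnalyticAt ℂ q z) :
    superD i j (fun x => incl N 2 (e x) + theta N j * incl N 2 (q x) +
      (1 / 2 : ℂ) • (theta N j * theta N i * incl N 2 (deriv e x))) z = 0 := by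
  have h1 : AnalyticAt ℂ (fun x => theta N j * incl N 2 (q x)) z := analyticAt_const.gr_mul hq.incl
  have h2 : AnalyticAt ℂ (fun x => theta N j * theta N i * incl N 2 (deriv e x)) z :=
    analyticAt_const.gr_mul he.deriv.incl
  rw [superD_add (he.incl.fun_add h1).differentiableAt (analyticAt_const.fun_smul h2).differentiableAt,
    superD_add he.incl.differentiableAt h1.differentiableAt,
    superD_const_smul _ h2.differentiableAt, superD_incl he, superD_theta_mul_incl' hij hq,
    superD_theta_mul_theta_mul_incl' hij he.deriv]
  module

variable {q qi qj ei ej : ℂ → Gr N}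

theorem superD_even (hij : j ≠ i) (hq : AnalyticAt ℂ q z) (hqi : AnalyticAt ℂ qi z)
    (hqj : AnalyticAt ℂ qj z) (hei : AnalyticAt ℂ ei z) (hej : AnalyticAt ℂ ej z) :
    superD i j (fun x => incl N 2 (q x) + (1 / 2 : ℂ) • (theta N j * incl N 2 (ei x * qj x)) +
      (1 / 2 : ℂ) • (theta N i * incl N 2 (ej x * qi x)) +
      (1 / 4 : ℂ) • (theta N i * theta N j * incl N 2 (deriv (fun y => ei y * ej y) x))) z =
      (1 / 2 : ℂ) • (theta N j * incl N 2 (deriv q z)) +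
      (1 / 2 : ℂ) • (incl N 2 (ej z * qi z) + (1 / 2 : ℂ) •
        (theta N j * theta N i * incl N 2 (deriv ej z * qi z + ej z * deriv qi z))) +
      (1 / 4 : ℂ) • (theta N j * incl N 2 (deriv ei z * ej z + ei z * deriv ej z)) := by
  have h0 := hei.gr_mul hqj
  have h1 := hej.gr_mul hqi
  have h2 := (hei.gr_mul hej).deriv
  have h0' := (analyticAt_const (v := theta N j)).gr_mul (h0.incl (k := 2))
  have h1' := (analyticAt_const (v := theta N i)).gr_mul (h1.incl (k := 2))
  have h2' := (analyticAt_const (v := theta N i * theta N j)).gr_mul (h2.incl (k := 2))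
  have s0 := (analyticAt_const (v := (1 / 2 : ℂ))).fun_smul h0'
  have s1 := (analyticAt_const (v := (1 / 2 : ℂ))).fun_smul h1'
  have s2 := (analyticAt_const (v := (1 / 4 : ℂ))).fun_smul h2'
  rw [superD_add ((hq.incl.fun_add s0).fun_add s1).differentiableAt s2.differentiableAt,
    superD_add (hq.incl.fun_add s0).differentiableAt s1.differentiableAt,
    superD_add hq.incl.differentiableAt s0.differentiableAt,
    superD_const_smul _ h0'.differentiableAt, superD_const_smul _ h1'.differentiableAt,
    superD_const_smul _ h2'.differentiableAt, superD_incl hq, superD_theta_mul_incl' hij h0,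
    superD_theta_mul_incl h1, superD_theta_mul_theta_mul_incl hij h2,
    deriv_gr_mul hei.differentiableAt hej.differentiableAt,
    deriv_gr_mul hej.differentiableAt hqi.differentiableAt, smul_zero, add_zero]

/-- The constraint enters in the coefficient of `θ_j`: eliminating `q'` turns `½ q' + ¼ (e_i e_j)'`
into `½ q_i q_j + ½ e_i' e_j`. The other coefficients agree by parity alone. -/
theorem superconformal_product (hqi : Gr.IsEven (qi z)) (hei' : Gr.IsOdd (deriv ei z))
    (hqi' : Gr.IsEven (deriv qi z)) (hej : Gr.IsOdd (ej z))
    (hc : qi z * qj z = deriv q z + (1 / 2 : ℂ) • (ei z * deriv ej z + ej z * deriv ei z)) :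
    (1 / 2 : ℂ) • (theta N j * incl N 2 (deriv q z)) +
      (1 / 2 : ℂ) • (incl N 2 (ej z * qi z) + (1 / 2 : ℂ) •
        (theta N j * theta N i * incl N 2 (deriv ej z * qi z + ej z * deriv qi z))) +
      (1 / 4 : ℂ) • (theta N j * incl N 2 (deriv ei z * ej z + ei z * deriv ej z)) =
    (incl N 2 (qi z) + theta N j * incl N 2 (deriv ei z) +
        (1 / 2 : ℂ) • (theta N j * theta N i * incl N 2 (deriv qi z))) *
      ((1 / 2 : ℂ) • (incl N 2 (ej z) + theta N j * incl N 2 (qj z) +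
        (1 / 2 : ℂ) • (theta N j * theta N i * incl N 2 (deriv ej z)))) := by
  -- Terms with a repeated odd coordinate drop out of the product.
  have k1 : theta N j * incl N 2 (deriv ei z) * theta N j = 0 := by
    rw [(isOdd_theta j).anticomm hei'.incl, neg_mul, mul_assoc, theta_mul_self, mul_zero, neg_zero]
  have k2 : theta N j * theta N i * incl N 2 (deriv qi z) * theta N j = 0 := by
    rw [mul_assoc, hqi'.incl.comm, theta_anticomm j i, neg_mul, ← mul_assoc,
      mul_assoc (theta N i), theta_mul_self, mul_zero, zero_mul, neg_zero]
  have c1 : incl N 2 (qi z) * theta N j = theta N j * incl N 2 (qi z) := hqi.incl.comm _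
  have c2 : incl N 2 (qi z) * theta N i = theta N i * incl N 2 (qi z) := hqi.incl.comm _
  have e1 : ej z * qi z = qi z * ej z := (hqi.comm _).symm
  have e2 : deriv ej z * qi z = qi z * deriv ej z := (hqi.comm _).symm
  have e3 : ej z * deriv qi z = deriv qi z * ej z := (hqi'.comm _).symm
  have e4 : deriv q z = qi z * qj z -
      (1 / 2 : ℂ) • (ei z * deriv ej z + ej z * deriv ei z) := by rw [hc]; abel
  have e5 : ej z * deriv ei z = -(deriv ei z * ej z) := hej.anticomm hei'
  rw [e1, e2, e3, e4, e5]
  simp only [mul_add, add_mul, smul_mul_assoc, mul_smul_comm, ← mul_assoc, k1, k2,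
    smul_zero, add_zero, map_add, map_sub, map_mul, map_smul, map_neg, mul_sub, mul_neg, smul_add,
    smul_sub]
  rw [c1, mul_assoc (theta N j) (incl N 2 (qi z)) (theta N i), c2, ← mul_assoc]
  module

end SuperconformalFormula


/-! ### Restriction and congruence over a set. -/

namespace SuperMap

variable {N k l : ℕ} {Φ Ψ : SuperMap N k l} {U : Set ℂ} {z : ℂ}

theorem EqOn.symm (h : Φ.EqOn Ψ U) : Ψ.EqOn Φ U := ⟨h.1.symm, fun i => (h.2 i).symm⟩

theorem EqOn.mono {V : Set ℂ} (h : Φ.EqOn Ψ U) (hV : V ⊆ U) : Φ.EqOn Ψ V :=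
  ⟨h.1.mono hV, fun i => (h.2 i).mono hV⟩

theorem EqOn.trans {Ω : SuperMap N k l} (h : Φ.EqOn Ψ U) (h' : Ψ.EqOn Ω U) : Φ.EqOn Ω U :=
  ⟨h.1.trans h'.1, fun i => (h.2 i).trans (h'.2 i)⟩

theorem EqOn.apply (h : Φ.EqOn Ψ U) (hz : z ∈ U) :
    Φ.even z = Ψ.even z ∧ ∀ i, Φ.odd i z = Ψ.odd i z := ⟨h.1 hz, fun i => h.2 i hz⟩

theorem eqOn_of_forall (h : ∀ z ∈ U, Φ.even z = Ψ.even z ∧ ∀ i, Φ.odd i z = Ψ.odd i z) :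
    Φ.EqOn Ψ U := ⟨fun z hz => (h z hz).1, fun i z hz => (h z hz).2 i⟩

theorem IsHolomorphicOn.mono {f₀ : ℂ → ℂ} {V : Set ℂ} (h : Φ.IsHolomorphicOn U f₀)
    (hV : V ⊆ U) : Φ.IsHolomorphicOn V f₀ where
  differentiable_even := h.differentiable_even.mono hV
  differentiable_odd i := (h.differentiable_odd i).mono hV
  isEven z hz := h.isEven z (hV hz)
  isOdd i z hz := h.isOdd i z (hV hz)
  body_even z hz := h.body_even z (hV hz)

theorem IsHolomorphicOn.congr {f₀ : ℂ → ℂ} (h : Φ.IsHolomorphicOn U f₀) (h' : Ψ.EqOn Φ U) :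
    Ψ.IsHolomorphicOn U f₀ where
  differentiable_even := h.differentiable_even.congr h'.1
  differentiable_odd i := (h.differentiable_odd i).congr (h'.2 i)
  isEven z hz := by rw [h'.1 hz]; exact h.isEven z hz
  isOdd i z hz := by rw [h'.2 i hz]; exact h.isOdd i z hz
  body_even z hz := by rw [h'.1 hz]; exact h.body_even z hz

end SuperMap

/-! ### Admissible data give holomorphic superconformal maps. -/

namespace N2Functions

variable {N : ℕ} {T T' : N2Functions N} {U : Set ℂ} {z : ℂ}

theorem IsAdmissibleOn.congr (hU : IsOpen U) (hT : T.IsAdmissibleOn U) (h : T'.EqOn T U) :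
    T'.IsAdmissibleOn U := by
  obtain ⟨h1, h2, h3, h4, h5⟩ := h
  refine ⟨hT.1.congr h1, hT.2.congr h2, hT.3.congr h3, hT.4.congr h4, hT.5.congr h5, ?_, ?_, ?_,
    ?_, ?_, ?_, ?_, ?_⟩
  · exact fun z hz => h1 hz ▸ hT.even_q z hz
  · exact fun z hz => h2 hz ▸ hT.even_qP z hz
  · exact fun z hz => h3 hz ▸ hT.even_qM z hz
  · exact fun z hz => h4 hz ▸ hT.odd_epsP z hz
  · exact fun z hz => h5 hz ▸ hT.odd_epsM z hz
  · exact fun z hz => h2 hz ▸ hT.unit_qP z hz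
  · exact fun z hz => h3 hz ▸ hT.unit_qM z hz
  · intro z hz
    rw [h1.deriv hU hz, h4.deriv hU hz, h5.deriv hU hz, h2 hz, h3 hz, h4 hz, h5 hz]
    exact hT.constraint z hz

theorem EqOn.toSuperMap (hU : IsOpen U) (h : T.EqOn T' U) :
    T.toSuperMap.EqOn T'.toSuperMap U := by
  obtain ⟨h1, h2, h3, h4, h5⟩ := h
  have h6 : Set.EqOn (fun x => T.epsP x * T.epsM x) (fun x => T'.epsP x * T'.epsM x) U :=
    fun x hx => by simp only [h4 hx, h5 hx]
  refine ⟨fun z hz => ?_, fun i z hz => ?_⟩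
  · simp only [N2Functions.toSuperMap, h1 hz, h2 hz, h3 hz, h4 hz, h5 hz, h6.deriv hU hz]
  · fin_cases i
    · simp [N2Functions.toSuperMap, h2 hz, h4 hz, h4.deriv hU hz]
    · simp [N2Functions.toSuperMap, h3 hz, h5 hz, h5.deriv hU hz]

theorem isHolomorphicOn_toSuperMap (hU : IsOpen U) (hT : T.IsAdmissibleOn U) {f₀ : ℂ → ℂ}
    (hb : ∀ z ∈ U, Gr.body (T.q z) = f₀ z) : T.toSuperMap.IsHolomorphicOn U f₀ := by
  have aq : ∀ z ∈ U, AnalyticAt ℂ T.q z := fun z hz => hT.1.analyticAt (hU.mem_nhds hz)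
  have aqP : ∀ z ∈ U, AnalyticAt ℂ T.qP z := fun z hz => hT.2.analyticAt (hU.mem_nhds hz)
  have aqM : ∀ z ∈ U, AnalyticAt ℂ T.qM z := fun z hz => hT.3.analyticAt (hU.mem_nhds hz)
  have aeP : ∀ z ∈ U, AnalyticAt ℂ T.epsP z := fun z hz => hT.4.analyticAt (hU.mem_nhds hz)
  have aeM : ∀ z ∈ U, AnalyticAt ℂ T.epsM z := fun z hz => hT.5.analyticAt (hU.mem_nhds hz)
  have ev : ∀ {P : ℂ → Prop}, (∀ x ∈ U, P x) → ∀ z ∈ U, ∀ᶠ x in 𝓝 z, P x := fun h z hz => by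
    filter_upwards [hU.mem_nhds hz] with x hx using h x hx
  have oP : ∀ z ∈ U, Gr.IsOdd (deriv T.epsP z) := fun z hz =>
    isOdd_deriv (aeP z hz) (ev hT.odd_epsP z hz)
  have oM : ∀ z ∈ U, Gr.IsOdd (deriv T.epsM z) := fun z hz =>
    isOdd_deriv (aeM z hz) (ev hT.odd_epsM z hz)
  have oPM : ∀ z ∈ U, Gr.IsEven (deriv (fun x => T.epsP x * T.epsM x) z) := fun z hz =>
    isEven_deriv ((aeP z hz).gr_mul (aeM z hz))
      (ev (fun x hx => (hT.odd_epsP x hx).mul (hT.odd_epsM x hx)) z hz)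
  have tP : Gr.IsOdd (thetaP N) := isOdd_theta _
  have tM : Gr.IsOdd (thetaM N) := isOdd_theta _
  refine ⟨fun z hz => AnalyticAt.differentiableWithinAt ?_, fun i z hz =>
    AnalyticAt.differentiableWithinAt ?_, fun z hz => ?_, fun i z hz => ?_, fun z hz => ?_⟩
  · exact (((aq z hz).incl.fun_add (analyticAt_const.fun_smul (analyticAt_const.gr_mul
      ((aeP z hz).gr_mul (aqM z hz)).incl))).fun_add (analyticAt_const.fun_smul
      (analyticAt_const.gr_mul ((aeM z hz).gr_mul (aqP z hz)).incl))).fun_add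
      (analyticAt_const.fun_smul (analyticAt_const.gr_mul
      ((aeP z hz).gr_mul (aeM z hz)).deriv.incl))
  · fin_cases i
    · exact ((aeP z hz).incl.fun_add (analyticAt_const.gr_mul (aqP z hz).incl)).fun_add
        (analyticAt_const.fun_smul (analyticAt_const.gr_mul (aeP z hz).deriv.incl))
    · exact ((aeM z hz).incl.fun_add (analyticAt_const.gr_mul (aqM z hz).incl)).fun_add
        (analyticAt_const.fun_smul (analyticAt_const.gr_mul (aeM z hz).deriv.incl))
  · exact (((hT.even_q z hz).incl.add
      ((tM.mul ((hT.odd_epsP z hz).mul_even (hT.even_qM z hz)).incl).smul _)).add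
      ((tP.mul ((hT.odd_epsM z hz).mul_even (hT.even_qP z hz)).incl).smul _)).add
      (((tP.mul tM).mul (oPM z hz).incl).smul _)
  · fin_cases i
    · exact ((hT.odd_epsP z hz).incl.add (tP.mul_even (hT.even_qP z hz).incl)).add
        (((tP.mul tM).mul_odd (oP z hz).incl).smul _)
    · exact ((hT.odd_epsM z hz).incl.add (tM.mul_even (hT.even_qM z hz).incl)).add
        (((tM.mul tP).mul_odd (oM z hz).incl).smul _)
  · rw [← hb z hz]
    simp [N2Functions.toSuperMap, body_incl, tP.body_eq, tM.body_eq]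

theorem isSuperconformalOn_toSuperMap (hU : IsOpen U) (hT : T.IsAdmissibleOn U) :
    IsSuperconformalOn T.toSuperMap U := by
  have aq : ∀ z ∈ U, AnalyticAt ℂ T.q z := fun z hz => hT.1.analyticAt (hU.mem_nhds hz)
  have aqP : ∀ z ∈ U, AnalyticAt ℂ T.qP z := fun z hz => hT.2.analyticAt (hU.mem_nhds hz)
  have aqM : ∀ z ∈ U, AnalyticAt ℂ T.qM z := fun z hz => hT.3.analyticAt (hU.mem_nhds hz)
  have aeP : ∀ z ∈ U, AnalyticAt ℂ T.epsP z := fun z hz => hT.4.analyticAt (hU.mem_nhds hz)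
  have aeM : ∀ z ∈ U, AnalyticAt ℂ T.epsM z := fun z hz => hT.5.analyticAt (hU.mem_nhds hz)
  have ev : ∀ {P : ℂ → Prop}, (∀ x ∈ U, P x) → ∀ z ∈ U, ∀ᶠ x in 𝓝 z, P x := fun h z hz => by
    filter_upwards [hU.mem_nhds hz] with x hx using h x hx
  have oP : ∀ z ∈ U, Gr.IsOdd (deriv T.epsP z) := fun z hz =>
    isOdd_deriv (aeP z hz) (ev hT.odd_epsP z hz)
  have oM : ∀ z ∈ U, Gr.IsOdd (deriv T.epsM z) := fun z hz =>
    isOdd_deriv (aeM z hz) (ev hT.odd_epsM z hz)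
  have eP : ∀ z ∈ U, Gr.IsEven (deriv T.qP z) := fun z hz =>
    isEven_deriv (aqP z hz) (ev hT.even_qP z hz)
  have eM : ∀ z ∈ U, Gr.IsEven (deriv T.qM z) := fun z hz =>
    isEven_deriv (aqM z hz) (ev hT.even_qM z hz)
  have h01 : (1 : Fin 2) ≠ 0 := one_ne_zero
  have h10 : (0 : Fin 2) ≠ 1 := zero_ne_one
  have dP : ∀ z ∈ U, DP (T.toSuperMap.odd 0) z = _ := fun z hz =>
    superD_odd_self h01 (aeP z hz) (aqP z hz)
  have dM : ∀ z ∈ U, DM (T.toSuperMap.odd 1) z = _ := fun z hz =>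
    superD_odd_self h10 (aeM z hz) (aqM z hz)
  refine ⟨fun z hz => ?_, fun z hz => ?_, fun z hz => ?_, fun z hz => ?_, fun z hz => ?_,
    fun z hz => ?_⟩
  · rw [dP z hz, Gr.isUnit_iff]
    simpa [body_incl, (isOdd_theta _).body_eq] using Gr.isUnit_iff.mp (hT.unit_qP z hz)
  · rw [dM z hz, Gr.isUnit_iff]
    simpa [body_incl, (isOdd_theta _).body_eq] using Gr.isUnit_iff.mp (hT.unit_qM z hz)
  · exact superD_odd_other h01 (aeM z hz) (aqM z hz)
  · exact superD_odd_other h10 (aeP z hz) (aqP z hz)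
  · rw [dP z hz]
    refine (superD_even h01 (aq z hz) (aqP z hz) (aqM z hz) (aeP z hz) (aeM z hz)).trans ?_
    exact superconformal_product (hT.even_qP z hz) (oP z hz) (eP z hz) (hT.odd_epsM z hz)
      (hT.constraint z hz)
  · rw [dM z hz]
    -- Exchanging `+` and `-` preserves the formula for `z'`: the signs of `(ε₊ ε₋)'` and of `θ₊ θ₋`
    -- both change. The case of `D₋` is therefore that of `D₊` with the roles exchanged.
    refine Eq.trans ?_ ((superD_even h10 (aq z hz) (aqM z hz) (aqP z hz) (aeM z hz)
      (aeP z hz)).trans (superconformal_product (hT.even_qM z hz) (oM z hz) (eM z hz)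
      (hT.odd_epsP z hz) ?_))
    · refine superD_congr ?_
      filter_upwards [hU.mem_nhds hz] with x hx
      have h : deriv (fun y => T.epsM y * T.epsP y) x =
          -deriv (fun y => T.epsP y * T.epsM y) x := by
        rw [← deriv.fun_neg]
        refine EventuallyEq.deriv_eq ?_
        filter_upwards [hU.mem_nhds hx] with y hy using
          (hT.odd_epsM y hy).anticomm (hT.odd_epsP y hy)
      rw [h, theta_anticomm 1 0, map_neg, neg_mul_neg]
      simp only [N2Functions.toSuperMap, thetaP, thetaM]
      abel
    · rw [(hT.even_qM z hz).comm, hT.constraint z hz, add_comm (T.epsP z * _)]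

end N2Functions

/-! ### The Dolgikh–Rosly–Schwarz correspondence. -/

namespace Functions11

variable {N : ℕ} {T T' : Functions11 N} {U : Set ℂ} {z : ℂ}

theorem isHolomorphicOn_toSuperMap (hU : IsOpen U) (hT : T.IsAdmissibleOn U) {f₀ : ℂ → ℂ}
    (hb : ∀ z ∈ U, Gr.body (T.S z) = f₀ z) : T.toSuperMap.IsHolomorphicOn U f₀ := by
  have aS : ∀ z ∈ U, AnalyticAt ℂ T.S z := fun z hz => hT.1.analyticAt (hU.mem_nhds hz)
  have aV : ∀ z ∈ U, AnalyticAt ℂ T.V z := fun z hz => hT.2.analyticAt (hU.mem_nhds hz)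
  have aφ : ∀ z ∈ U, AnalyticAt ℂ T.phi z := fun z hz => hT.3.analyticAt (hU.mem_nhds hz)
  have aψ : ∀ z ∈ U, AnalyticAt ℂ T.psi z := fun z hz => hT.4.analyticAt (hU.mem_nhds hz)
  have t : Gr.IsOdd (theta N (0 : Fin 1)) := isOdd_theta _
  refine ⟨fun z hz => AnalyticAt.differentiableWithinAt ?_, fun i z hz =>
    AnalyticAt.differentiableWithinAt ?_, fun z hz => ?_, fun i z hz => ?_, fun z hz => ?_⟩
  · exact (aS z hz).incl.fun_add (analyticAt_const.gr_mul ((aV z hz).gr_mul (aφ z hz)).incl)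
  · exact (aψ z hz).incl.fun_add (analyticAt_const.gr_mul (aV z hz).incl)
  · exact (hT.even_S z hz).incl.add
      (t.mul ((hT.even_V z hz).mul_odd (hT.odd_phi z hz)).incl)
  · exact (hT.odd_psi z hz).incl.add (t.mul_even (hT.even_V z hz).incl)
  · rw [← hb z hz]
    simp [Functions11.toSuperMap, body_incl, t.body_eq]

/-- `q₋` is defined so that `q₊ q₋ = S' - ψ' φ`; with `q = S + ½ φ ψ` the constraint is then
Leibniz' rule plus anticommutation. The body of `ψ' φ` vanishes, so invertibility of `q₋` is that of
`S'`. -/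
theorem isAdmissibleOn_drs (hU : IsOpen U) (hT : T.IsAdmissibleOn U)
    (hS : ∀ z ∈ U, IsUnit (deriv T.S z)) : T.drs.IsAdmissibleOn U := by
  have aS : ∀ z ∈ U, AnalyticAt ℂ T.S z := fun z hz => hT.1.analyticAt (hU.mem_nhds hz)
  have aV : ∀ z ∈ U, AnalyticAt ℂ T.V z := fun z hz => hT.2.analyticAt (hU.mem_nhds hz)
  have aφ : ∀ z ∈ U, AnalyticAt ℂ T.phi z := fun z hz => hT.3.analyticAt (hU.mem_nhds hz)
  have aψ : ∀ z ∈ U, AnalyticAt ℂ T.psi z := fun z hz => hT.4.analyticAt (hU.mem_nhds hz)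
  have ev : ∀ {P : ℂ → Prop}, (∀ x ∈ U, P x) → ∀ z ∈ U, ∀ᶠ x in 𝓝 z, P x := fun h z hz => by
    filter_upwards [hU.mem_nhds hz] with x hx using h x hx
  have oψ : ∀ z ∈ U, Gr.IsOdd (deriv T.psi z) := fun z hz =>
    isOdd_deriv (aψ z hz) (ev hT.odd_psi z hz)
  have eS : ∀ z ∈ U, Gr.IsEven (deriv T.S z) := fun z hz =>
    isEven_deriv (aS z hz) (ev hT.even_S z hz)
  have eSψ : ∀ z ∈ U, Gr.IsEven (deriv T.S z - deriv T.psi z * T.phi z) := fun z hz =>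
    (eS z hz).sub ((oψ z hz).mul (hT.odd_phi z hz))
  refine ⟨fun z hz => AnalyticAt.differentiableWithinAt ?_, hT.2,
    fun z hz => AnalyticAt.differentiableWithinAt ?_, hT.4, hT.3, fun z hz => ?_, hT.even_V,
    fun z hz => ?_, hT.odd_psi, hT.odd_phi, hT.unit_V, fun z hz => ?_, fun z hz => ?_⟩
  · exact (aS z hz).fun_add (analyticAt_const.fun_smul ((aφ z hz).gr_mul (aψ z hz)))
  · exact ((aS z hz).deriv.fun_sub ((aψ z hz).deriv.gr_mul (aφ z hz))).gr_mul
      ((aV z hz).gr_inverse (hT.unit_V z hz))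
  · exact (hT.even_S z hz).add (((hT.odd_phi z hz).mul (hT.odd_psi z hz)).smul _)
  · exact (eSψ z hz).mul ((hT.even_V z hz).inverse (hT.unit_V z hz))
  · refine IsUnit.mul ?_ (hT.unit_V z hz).ringInverse
    rw [Gr.isUnit_iff, map_sub, map_mul, (oψ z hz).body_eq, zero_mul, sub_zero, ← Gr.isUnit_iff]
    exact hS z hz
  · change T.V z * ((deriv T.S z - deriv T.psi z * T.phi z) * Ring.inverse (T.V z)) =
      deriv (fun z => T.S z + (1 / 2 : ℂ) • (T.phi z * T.psi z)) z +
        (1 / 2 : ℂ) • (T.psi z * deriv T.phi z + T.phi z * deriv T.psi z)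
    rw [(hT.even_V z hz).comm, mul_assoc, Ring.inverse_mul_cancel _ (hT.unit_V z hz), mul_one,
      deriv_fun_add (aS z hz).differentiableAt
        (analyticAt_const.fun_smul ((aφ z hz).gr_mul (aψ z hz))).differentiableAt,
      deriv_fun_const_smul _ ((aφ z hz).gr_mul (aψ z hz)).differentiableAt,
      deriv_gr_mul (aφ z hz).differentiableAt (aψ z hz).differentiableAt,
      (oψ z hz).anticomm (hT.odd_phi z hz),
      (hT.odd_psi z hz).anticomm (isOdd_deriv (aφ z hz) (ev hT.odd_phi z hz))]
    module

/-- The shift `½ θ₊ θ₋` squares to zero, so Taylor's formula stops at first order; the term with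
`b'` dies because `θ₊` occurs twice. -/
theorem pullback_chiral {a b : ℂ → Gr N} (ha : AnalyticAt ℂ a z) (hb : AnalyticAt ℂ b z) :
    (chiral N).pullback (fun x => incl N 1 (a x) + theta N (0 : Fin 1) * incl N 1 (b x)) z =
      incl N 2 (a z) + thetaP N * incl N 2 (b z) +
        (1 / 2 : ℂ) • (thetaP N * thetaM N * incl N 2 (deriv a z)) := by
  have hP : Gr.IsOdd (thetaP N) := isOdd_theta _
  have hM : Gr.IsOdd (thetaM N) := isOdd_theta _
  have hsq : (1 / 2 : ℂ) • (thetaP N * thetaM N) * (1 / 2 : ℂ) • (thetaP N * thetaM N) = 0 := by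
    rw [smul_mul_smul_comm, mul_assoc, ← mul_assoc (thetaM N), hM.anticomm hP, neg_mul,
      mul_assoc (thetaP N), hM.mul_self, mul_zero, neg_zero, mul_zero, smul_zero]
  have hbody : Gr.body ((1 / 2 : ℂ) • (thetaP N * thetaM N)) = 0 := by
    rw [map_smul, map_mul, hP.body_eq, zero_mul, smul_zero]
  have e : (fun x => subst (fun _ : Fin 1 => thetaP N)
      (incl N 1 (a x) + theta N (0 : Fin 1) * incl N 1 (b x))) =
      fun x => incl N 2 (a x) + thetaP N * incl N 2 (b x) := by
    funext x
    rw [map_add, map_mul, subst_incl, subst_incl,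
      subst_theta (Θ := fun _ : Fin 1 => thetaP N) (i := 0) hP]
  have e2 : deriv (fun x => incl N 2 (a x) + thetaP N * incl N 2 (b x)) z =
      incl N 2 (deriv a z) + thetaP N * incl N 2 (deriv b z) := by
    rw [deriv_fun_add ha.incl.differentiableAt (analyticAt_const.gr_mul hb.incl).differentiableAt,
      deriv_incl ha, deriv_const_mul_incl _ hb]
  have e3 : thetaP N * incl N 2 (deriv b z) * (thetaP N * thetaM N) = 0 := by
    rw [← (hP.mul hM).comm, mul_assoc, ← mul_assoc (thetaM N), hM.anticomm hP, neg_mul, mul_neg,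
      ← mul_assoc, ← mul_assoc, hP.mul_self, zero_mul, zero_mul, neg_zero]
  refine (congrArg (fun F => evalAt F _) e).trans ?_
  refine (evalAt_linear_of_sq z hsq hbody (by omega)).trans ?_
  rw [e2, mul_smul_comm, add_mul, e3, add_zero, ← (hP.mul hM).comm]

/-- The superconformal map of the Dolgikh--Rosly--Schwarz functions has the given quotient. -/
theorem chiral_comp_drs (hU : IsOpen U) (hT : T.IsAdmissibleOn U)
    (hS : ∀ z ∈ U, IsUnit (deriv T.S z)) :
    ((chiral N).comp T.drs.toSuperMap).EqOn (T.toSuperMap.comp (chiral N)) U := by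
  have hΦ := N2Functions.isHolomorphicOn_toSuperMap hU (isAdmissibleOn_drs hU hT hS)
    (fun _ _ => rfl)
  refine SuperMap.eqOn_of_forall fun z hz => ?_
  have aS : AnalyticAt ℂ T.S z := hT.1.analyticAt (hU.mem_nhds hz)
  have aV : AnalyticAt ℂ T.V z := hT.2.analyticAt (hU.mem_nhds hz)
  have aφ : AnalyticAt ℂ T.phi z := hT.3.analyticAt (hU.mem_nhds hz)
  have aψ : AnalyticAt ℂ T.psi z := hT.4.analyticAt (hU.mem_nhds hz)
  refine ⟨?_, fun i => ?_⟩
  · refine (SuperMap.chiral_comp_even (hΦ.isOdd 0 z hz) (hΦ.isOdd 1 z hz)).trans ?_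
    refine Eq.trans ?_ (pullback_chiral aS (aV.gr_mul aφ)).symm
    -- The relation defining `q₋`; it matches the coefficient of `θ₊ θ₋`, which is `½ S'` in the
    -- quotient map.
    have hq : deriv T.S z = T.V z * T.drs.qM z + deriv T.psi z * T.phi z := by
      simp only [drs]
      rw [(hT.even_V z hz).comm, mul_assoc, Ring.inverse_mul_cancel _ (hT.unit_V z hz), mul_one,
        sub_add_cancel]
    have hψ' : Gr.IsOdd (deriv T.psi z) := isOdd_deriv aψ (by
      filter_upwards [hU.mem_nhds hz] with x hx using hT.odd_psi x hx)
    have hV : Gr.IsEven (incl N 2 (T.V z)) := (hT.even_V z hz).incl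
    have hψ : Gr.IsOdd (incl N 2 (T.psi z)) := (hT.odd_psi z hz).incl
    have hP : Gr.IsOdd (thetaP N) := isOdd_theta _
    have hM : Gr.IsOdd (thetaM N) := isOdd_theta _
    have hMP : thetaM N * thetaP N = -(thetaP N * thetaM N) := hM.anticomm hP
    -- The following identities bring monomials to the order `θ₊`, `θ₋`, coefficients.
    have c1 : thetaP N * incl N 2 (T.V z) * thetaM N =
        thetaP N * thetaM N * incl N 2 (T.V z) := by rw [mul_assoc, hV.comm, mul_assoc]
    have c2 : thetaP N * thetaM N * incl N 2 (T.V z) * thetaP N = 0 := by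
      rw [mul_assoc, hV.comm, ← mul_assoc, mul_assoc (thetaP N), hMP, mul_neg, ← mul_assoc,
        hP.mul_self, zero_mul, neg_zero, zero_mul]
    have c3 : thetaP N * thetaM N * incl N 2 (deriv T.psi z) * thetaM N = 0 := by
      rw [mul_assoc, hψ'.incl.anticomm hM, mul_neg, ← mul_assoc, mul_assoc (thetaP N),
        hM.mul_self, mul_zero, zero_mul, neg_zero]
    have c4 : incl N 2 (T.psi z) * thetaM N = -(thetaM N * incl N 2 (T.psi z)) := hψ.anticomm hM
    have c5 : thetaM N * incl N 2 (T.psi z) * thetaP N =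
        thetaP N * thetaM N * incl N 2 (T.psi z) := by
      rw [mul_assoc, hψ.anticomm hP, mul_neg, ← mul_assoc, hMP, neg_mul, neg_neg]
    have c6 : T.phi z * T.psi z = -(T.psi z * T.phi z) :=
      (hT.odd_phi z hz).anticomm (hT.odd_psi z hz)
    have c7 : T.phi z * T.V z = T.V z * T.phi z := ((hT.even_V z hz).comm _).symm
    rw [hq]
    -- This is `z' + ½ θ'₊ θ'₋` written out. After expansion the terms in `φ ψ` and those linear in
    -- `θ₋` cancel, leaving `S + θ₊ V φ + ½ θ₊ θ₋ S'`.
    change incl N 2 (T.S z + (1 / 2 : ℂ) • (T.phi z * T.psi z)) +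
      (1 / 2 : ℂ) • (thetaM N * incl N 2 (T.psi z * T.drs.qM z)) +
      (1 / 2 : ℂ) • (thetaP N * incl N 2 (T.phi z * T.V z)) +
      (1 / 4 : ℂ) • (thetaP N * thetaM N * incl N 2 (deriv (fun x => T.psi x * T.phi x) z)) +
      (1 / 2 : ℂ) • ((incl N 2 (T.psi z) + thetaP N * incl N 2 (T.V z)
        + (1 / 2 : ℂ) • (thetaP N * thetaM N * incl N 2 (deriv T.psi z))) *
        (incl N 2 (T.phi z) + thetaM N * incl N 2 (T.drs.qM z)
        + (1 / 2 : ℂ) • (thetaM N * thetaP N * incl N 2 (deriv T.phi z)))) = _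
    rw [deriv_gr_mul aψ.differentiableAt aφ.differentiableAt, c6, c7]
    simp only [mul_add, add_mul, smul_mul_assoc, mul_smul_comm, ← mul_assoc, c1, c2, c3, c4, c5,
      smul_zero, add_zero, map_add, map_mul, map_smul, map_neg, neg_mul, smul_add]
    module
  · refine (SuperMap.chiral_comp_odd (hΦ.isOdd 0 z hz) i).trans ?_
    exact (pullback_chiral aψ aV).symm

end Functions11

/-! ### The gluing functions in normal form. -/

namespace GluingFunctions

variable {N : ℕ} {G : GluingFunctions N} {U : Set ℂ} {f₀ g₀ : ℂ → ℂ}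

/-- The normal form of `w' = f(w + ξ α(w))`, `ξ' = g(w) (ξ + β(w))`. -/
def functions11 (G : GluingFunctions N) : Functions11 N where
  S := G.f
  V := G.g
  phi := fun w => deriv G.f w * G.α w * Ring.inverse (G.g w)
  psi := fun w => G.g w * G.β w

theorem IsAdmissibleOn.isUnit_g (hG : G.IsAdmissibleOn U f₀ g₀) (hg : ∀ z ∈ U, g₀ z ≠ 0) {z : ℂ}
    (hz : z ∈ U) : IsUnit (G.g z) :=
  Gr.isUnit_of_body_ne_zero (by rw [hG.body_g z hz]; exact hg z hz)

/-- Taking bodies is linear and so commutes with differentiation: the body of `f'` is the derivative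
of `f₀`. -/
theorem IsAdmissibleOn.isUnit_deriv_f (hU : IsOpen U) (hG : G.IsAdmissibleOn U f₀ g₀)
    (hf : ∀ z ∈ U, deriv f₀ z ≠ 0) {z : ℂ} (hz : z ∈ U) : IsUnit (deriv G.f z) := by
  refine Gr.isUnit_of_body_ne_zero ?_
  have h := deriv_gr_map (Gr.body (n := N)).toLinearMap
    (hG.differentiable_f.differentiableAt (hU.mem_nhds hz))
  have h2 : Set.EqOn (fun x => Gr.body (G.f x)) f₀ U := hG.body_f
  have h3 := h2.deriv hU hz
  exact fun h4 => hf z hz (h3.symm.trans (h.trans h4))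

theorem IsAdmissibleOn.functions11 (hU : IsOpen U) (hG : G.IsAdmissibleOn U f₀ g₀)
    (hg : ∀ z ∈ U, g₀ z ≠ 0) : G.functions11.IsAdmissibleOn U := by
  have af : ∀ z ∈ U, AnalyticAt ℂ G.f z := fun z hz => hG.1.analyticAt (hU.mem_nhds hz)
  have ag : ∀ z ∈ U, AnalyticAt ℂ G.g z := fun z hz => hG.2.analyticAt (hU.mem_nhds hz)
  have aα : ∀ z ∈ U, AnalyticAt ℂ G.α z := fun z hz => hG.3.analyticAt (hU.mem_nhds hz)
  have aβ : ∀ z ∈ U, AnalyticAt ℂ G.β z := fun z hz => hG.4.analyticAt (hU.mem_nhds hz)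
  have ef : ∀ z ∈ U, Gr.IsEven (deriv G.f z) := fun z hz => isEven_deriv (af z hz) (by
    filter_upwards [hU.mem_nhds hz] with x hx using hG.even_f x hx)
  refine ⟨hG.1, hG.2, fun z hz => AnalyticAt.differentiableWithinAt ?_,
    fun z hz => AnalyticAt.differentiableWithinAt ?_, hG.even_f, hG.even_g, fun z hz => ?_,
    fun z hz => ?_, fun z hz => hG.isUnit_g hg hz⟩
  · exact ((af z hz).deriv.gr_mul (aα z hz)).gr_mul ((ag z hz).gr_inverse (hG.isUnit_g hg hz))
  · exact (ag z hz).gr_mul (aβ z hz)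
  · exact ((ef z hz).mul_odd (hG.odd_α z hz)).mul_even
      ((hG.even_g z hz).inverse (hG.isUnit_g hg hz))
  · exact (hG.even_g z hz).mul_odd (hG.odd_β z hz)

/-- Since `ξ α` squares to zero, `f(w + ξ α) = f + ξ f' α`, and `f' α = V φ` dictates `φ = f' α
g⁻¹`. -/
theorem IsAdmissibleOn.functions11_toSuperMap (hU : IsOpen U) (hG : G.IsAdmissibleOn U f₀ g₀)
    (hg : ∀ z ∈ U, g₀ z ≠ 0) : G.functions11.toSuperMap.EqOn G.toSuperMap U := by
  refine SuperMap.eqOn_of_forall fun z hz => ?_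
  have af : AnalyticAt ℂ G.f z := hG.1.analyticAt (hU.mem_nhds hz)
  have hu := hG.isUnit_g hg hz
  have eg := hG.even_g z hz
  have t : Gr.IsOdd (theta N (0 : Fin 1)) := isOdd_theta _
  have ef : Gr.IsEven (deriv G.f z) := isEven_deriv af (by
    filter_upwards [hU.mem_nhds hz] with x hx using hG.even_f x hx)
  refine ⟨?_, fun _ => ?_⟩
  · have hsq : theta N (0 : Fin 1) * incl N 1 (G.α z) * (theta N 0 * incl N 1 (G.α z)) = 0 := by
      rw [mul_assoc, ← mul_assoc (incl N 1 _), (hG.odd_α z hz).incl.anticomm t, neg_mul, mul_neg,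
        ← mul_assoc, ← mul_assoc, t.mul_self, zero_mul, zero_mul, neg_zero]
    refine Eq.trans ?_ (evalAt_linear_of_sq z hsq
      (by rw [map_mul, t.body_eq, zero_mul]) (by omega)).symm
    rw [deriv_incl af, ef.incl.comm, mul_assoc, ← map_mul, ← ef.comm]
    simp only [Functions11.toSuperMap, GluingFunctions.functions11]
    rw [eg.comm, mul_assoc, Ring.inverse_mul_cancel _ hu, mul_one]
  · simp only [Functions11.toSuperMap, GluingFunctions.toSuperMap, GluingFunctions.functions11]
    rw [mul_add, ← eg.incl.comm, map_mul]
    exact add_comm _ _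

/-- The two correction terms of `q₋` come from the product rule in `ψ' = (g β)'`: `g β'` yields the
term with `α β'`, and `g' β` yields the one with `(g⁻¹)' = -g⁻¹ g' g⁻¹`. -/
theorem IsAdmissibleOn.functions11_drs (hU : IsOpen U) (hG : G.IsAdmissibleOn U f₀ g₀)
    (hg : ∀ z ∈ U, g₀ z ≠ 0) : G.functions11.drs.EqOn G.n2gluing U := by
  refine ⟨fun z hz => ?_, fun _ _ => rfl, fun z hz => ?_, fun _ _ => rfl, fun _ _ => rfl⟩
  · have hu := hG.isUnit_g hg hz
    change G.f z + (1 / 2 : ℂ) • (deriv G.f z * G.α z * Ring.inverse (G.g z) * (G.g z * G.β z)) =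
      G.f z + (1 / 2 : ℂ) • (deriv G.f z * G.α z * G.β z)
    rw [mul_assoc _ (Ring.inverse _), ← mul_assoc (Ring.inverse _), Ring.inverse_mul_cancel _ hu,
      one_mul]
  · have hu := hG.isUnit_g hg hz
    have af : AnalyticAt ℂ G.f z := hG.1.analyticAt (hU.mem_nhds hz)
    have ag : AnalyticAt ℂ G.g z := hG.2.analyticAt (hU.mem_nhds hz)
    have aβ : AnalyticAt ℂ G.β z := hG.4.analyticAt (hU.mem_nhds hz)
    have ef : Gr.IsEven (deriv G.f z) := isEven_deriv af (by
      filter_upwards [hU.mem_nhds hz] with x hx using hG.even_f x hx)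
    have eg : Gr.IsEven (G.g z) := hG.even_g z hz
    have eh : Gr.IsEven (Ring.inverse (G.g z)) := eg.inverse hu
    have oβ' : Gr.IsOdd (deriv G.β z) := isOdd_deriv aβ (by
      filter_upwards [hU.mem_nhds hz] with x hx using hG.odd_β x hx)
    change (deriv G.f z - deriv (fun w => G.g w * G.β w) z *
        (deriv G.f z * G.α z * Ring.inverse (G.g z))) * Ring.inverse (G.g z) =
      deriv G.f z * Ring.inverse (G.g z) * (1 + G.α z * deriv G.β z)
        + deriv (fun x => Ring.inverse (G.g x)) z * deriv G.f z * G.β z * G.α z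
    rw [deriv_gr_mul ag.differentiableAt aβ.differentiableAt, deriv_gr_inverse ag hu]
    have h1 : Ring.inverse (G.g z) * G.g z = 1 := Ring.inverse_mul_cancel _ hu
    generalize Ring.inverse (G.g z) = h at *
    generalize deriv G.f z = F at *
    have r1 : G.g z * deriv G.β z * (F * G.α z * h) * h = -(F * h * (G.α z * deriv G.β z)) := by
      rw [(hG.odd_α z hz).anticomm oβ', mul_neg, neg_neg, mul_assoc, mul_assoc (F * G.α z),
        ← (eh.mul eh).comm, mul_assoc (G.g z), ← mul_assoc (deriv G.β z), ← (eh.mul eh).comm,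
        ← mul_assoc (G.g z), ← mul_assoc (G.g z), ← mul_assoc (G.g z) h h, eg.comm h, h1, one_mul,
        mul_assoc h, ← mul_assoc (deriv G.β z), ← ef.comm, ef.comm h]
      simp only [mul_assoc]
    have r2 : deriv G.g z * G.β z * (F * G.α z * h) * h =
        h * deriv G.g z * h * F * G.β z * G.α z := by
      rw [mul_assoc, mul_assoc (F * G.α z), ← (eh.mul eh).comm, ← mul_assoc _ (h * h),
        ← (eh.mul eh).comm, ← mul_assoc _ F, ← ef.comm, mul_assoc h, mul_assoc h, ← eh.comm,
        ← mul_assoc h h, ← mul_assoc (h * h), ← ef.comm]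
      simp only [mul_assoc]
    simp only [sub_mul, add_mul, r1, r2, mul_add, mul_one, neg_mul]
    abel

end GluingFunctions


/-! ### The lift of a single transition. -/

namespace GluingFunctions

variable {N : ℕ} {G : GluingFunctions N} {U : Set ℂ} {f₀ g₀ : ℂ → ℂ}

theorem IsAdmissibleOn.n2gluing (hU : IsOpen U) (hG : G.IsAdmissibleOn U f₀ g₀)
    (hf : ∀ z ∈ U, deriv f₀ z ≠ 0) (hg : ∀ z ∈ U, g₀ z ≠ 0) : G.n2gluing.IsAdmissibleOn U := by
  have h := hG.functions11_drs hU hg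
  refine N2Functions.IsAdmissibleOn.congr hU (Functions11.isAdmissibleOn_drs hU
    (hG.functions11 hU hg) fun z hz => hG.isUnit_deriv_f hU hf hz) ?_
  exact ⟨h.1.symm, h.2.1.symm, h.2.2.1.symm, h.2.2.2.1.symm, h.2.2.2.2.symm⟩

theorem IsAdmissibleOn.n2gluing_holomorphic (hU : IsOpen U) (hG : G.IsAdmissibleOn U f₀ g₀)
    (hf : ∀ z ∈ U, deriv f₀ z ≠ 0) (hg : ∀ z ∈ U, g₀ z ≠ 0) :
    G.n2gluing.toSuperMap.IsHolomorphicOn U f₀ := by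
  refine N2Functions.isHolomorphicOn_toSuperMap hU (hG.n2gluing hU hf hg) fun z hz => ?_
  simp [GluingFunctions.n2gluing, (hG.odd_α z hz).body_eq, hG.body_f z hz]

theorem IsAdmissibleOn.toSuperMap_holomorphic (hU : IsOpen U) (hG : G.IsAdmissibleOn U f₀ g₀)
    (hg : ∀ z ∈ U, g₀ z ≠ 0) : G.toSuperMap.IsHolomorphicOn U f₀ :=
  (Functions11.isHolomorphicOn_toSuperMap hU (hG.functions11 hU hg) hG.body_f).congr
    (hG.functions11_toSuperMap hU hg).symm

theorem IsAdmissibleOn.chiral_comp_n2gluing (hU : IsOpen U) (hG : G.IsAdmissibleOn U f₀ g₀)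
    (hf : ∀ z ∈ U, deriv f₀ z ≠ 0) (hg : ∀ z ∈ U, g₀ z ≠ 0) :
    ((chiral N).comp G.n2gluing.toSuperMap).EqOn (G.toSuperMap.comp (chiral N)) U := by
  have h1 := Functions11.chiral_comp_drs hU (hG.functions11 hU hg)
    fun z hz => hG.isUnit_deriv_f hU hf hz
  have h2 := N2Functions.EqOn.toSuperMap hU (hG.functions11_drs hU hg)
  have h3 : ((chiral N).comp G.n2gluing.toSuperMap).EqOn
      ((chiral N).comp G.functions11.drs.toSuperMap) U :=
    SuperMap.eqOn_of_forall fun z hz => SuperMap.comp_congr_right _ (h2.symm.apply hz)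
  have h4 : (G.functions11.toSuperMap.comp (chiral N)).EqOn (G.toSuperMap.comp (chiral N)) U :=
    SuperMap.eqOn_of_forall fun z hz => SuperMap.comp_congr_left hU
      (hG.functions11_toSuperMap hU hg) (by rwa [SuperMap.body_chiral_even])
  exact (h3.trans h1).trans h4

end GluingFunctions

/-! ### Lifting identities between compositions. -/

namespace SuperMap

variable {N : ℕ} {U V : Set ℂ} {z : ℂ}

theorem isRegularAt_id {k : ℕ} : (SuperMap.id N k).IsRegularAt z where
  even := analyticAt_gr_algebraMap
  odd _ := analyticAt_const
  isEven := Eventually.of_forall fun _ => Gr.isEven_algebraMap _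
  isOdd _ := Eventually.of_forall fun _ => isOdd_theta _

theorem preservesAt_id : PreservesAt 0 1 (SuperMap.id N 2) z := by
  have h : superD 0 1 ((SuperMap.id N 2).odd 0) z = 1 :=
    (superD_const (theta N 0)).trans (by rw [dTheta_theta, if_pos rfl])
  refine ⟨h ▸ isUnit_one, (superD_const (theta N 1)).trans ?_, superD_coord.trans ?_⟩
  · rw [dTheta_theta, if_neg one_ne_zero]
  · rw [h, one_mul]
    rfl

/-- With `preservesAt_id`, this lets the condition on reversed edges be treated as a cocycle
condition whose third map is the identity. -/
theorem chiral_comp_id : ((chiral N).comp (SuperMap.id N 2)).EqOn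
    ((SuperMap.id N 1).comp (chiral N)) U := by
  refine eqOn_of_forall fun z _ => ⟨?_, fun i => ?_⟩
  · exact (chiral_comp_even (Φ := SuperMap.id N 2) (isOdd_theta _) (isOdd_theta _)).trans
      (pullback_coord (Φ := chiral N)).symm
  · refine (chiral_comp_odd (Φ := SuperMap.id N 2) (isOdd_theta _) i).trans ?_
    refine Eq.trans ?_ (pullback_const (Φ := chiral N) _).symm
    exact (subst_theta (Θ := fun _ : Fin 1 => thetaP N) (isOdd_theta _)).symm

theorem IsHolomorphicOn.isRegularAt_body {k l : ℕ} {Φ : SuperMap N k l} {f : ℂ → ℂ} {p r : ℕ}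
    {Ψ : SuperMap N p r} {g : ℂ → ℂ} (hΨ : Ψ.IsHolomorphicOn V g) (hV : IsOpen V)
    (hΦ : Φ.IsHolomorphicOn U f) (hm : Set.MapsTo f U V) (hz : z ∈ U) :
    Ψ.IsRegularAt (Gr.body (Φ.even z)) := by
  rw [hΦ.body_even z hz]
  exact hΨ.isRegularAt hV (hm hz)

/-- Compositions of superconformal maps are determined by the compositions of their quotients. -/
theorem comp_eqOn_of_chiral {Y₁ Y₂ Y₃ : SuperMap N 2 2} {X₁ X₂ X₃ : SuperMap N 1 1}
    {f₁ f₂ : ℂ → ℂ} (hU : IsOpen U) (hV : IsOpen V) (hm : Set.MapsTo f₁ U V)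
    (hY₁ : Y₁.IsHolomorphicOn U f₁) (hY₂ : Y₂.IsHolomorphicOn V f₂)
    (hY₃ : ∀ z ∈ U, Y₃.IsRegularAt z)
    (hX₁ : X₁.IsHolomorphicOn U f₁) (hX₂ : X₂.IsHolomorphicOn V f₂)
    (s₁ : ∀ z ∈ U, PreservesAt 0 1 Y₁ z) (s₂ : ∀ z ∈ V, PreservesAt 0 1 Y₂ z)
    (s₃ : ∀ z ∈ U, PreservesAt 0 1 Y₃ z)
    (c₁ : ((chiral N).comp Y₁).EqOn (X₁.comp (chiral N)) U)
    (c₂ : ((chiral N).comp Y₂).EqOn (X₂.comp (chiral N)) V)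
    (c₃ : ((chiral N).comp Y₃).EqOn (X₃.comp (chiral N)) U)
    (hX : (X₂.comp X₁).EqOn X₃ U) : (Y₂.comp Y₁).EqOn Y₃ U := by
  have rC : ∀ z, (chiral N).IsRegularAt z := fun z => isRegularAt_chiral
  have rY₂ : ∀ z ∈ U, Y₂.IsRegularAt (Gr.body (Y₁.even z)) := fun z hz =>
    hY₂.isRegularAt_body hV hY₁ hm hz
  have bC : ∀ z ∈ U, Gr.body ((chiral N).even z) ∈ U := fun z hz => by rwa [body_chiral_even]
  -- The quotient map is carried through the composition by associativity, replacing each `Yᵢ` by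
  -- `Xᵢ` as it passes.
  have e₁ : ((chiral N).comp (Y₂.comp Y₁)).EqOn (((chiral N).comp Y₂).comp Y₁) U :=
    EqOn.symm (eqOn_of_forall fun z hz => comp_assoc (hY₁.isRegularAt hU hz) (rY₂ z hz) (rC _))
  have e₂ : (((chiral N).comp Y₂).comp Y₁).EqOn ((X₂.comp (chiral N)).comp Y₁) U :=
    eqOn_of_forall fun z hz => comp_congr_left hV c₂
      (by rw [hY₁.body_even z hz]; exact hm hz)
  have e₃ : ((X₂.comp (chiral N)).comp Y₁).EqOn (X₂.comp ((chiral N).comp Y₁)) U :=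
    eqOn_of_forall fun z hz => comp_assoc (hY₁.isRegularAt hU hz) (rC _) (by
      rw [body_chiral_even]
      exact hX₂.isRegularAt_body hV hY₁ hm hz)
  have e₄ : (X₂.comp ((chiral N).comp Y₁)).EqOn (X₂.comp (X₁.comp (chiral N))) U :=
    eqOn_of_forall fun z hz => comp_congr_right _ (c₁.apply hz)
  have e₅ : (X₂.comp (X₁.comp (chiral N))).EqOn ((X₂.comp X₁).comp (chiral N)) U :=
    EqOn.symm (eqOn_of_forall fun z hz => comp_assoc (rC _)
      (hX₁.isRegularAt hU (bC z hz)) (by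
        rw [body_chiral_even]
        exact hX₂.isRegularAt_body hV hX₁ hm hz))
  have e₆ : ((X₂.comp X₁).comp (chiral N)).EqOn (X₃.comp (chiral N)) U :=
    eqOn_of_forall fun z hz => comp_congr_left hU hX (bC z hz)
  have e := ((((((e₁.trans e₂).trans e₃).trans e₄).trans e₅).trans e₆).trans c₃.symm)
  refine eqOn_of_forall fun z hz => ?_
  -- The two maps have equal quotients and both preserve the line of `D₊`; preservation of the line
  -- of `D₋` plays no role.
  refine eq_of_chiral_comp_eq ((rY₂ z hz).comp (hY₁.isRegularAt hU hz)) (hY₃ z hz) ?_ (s₃ z hz)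
    (e.1.eventuallyEq_of_mem (hU.mem_nhds hz)) ((e.2 0).eventuallyEq_of_mem (hU.mem_nhds hz))
  refine PreservesAt.comp one_ne_zero (rY₂ z hz) (hY₁.isRegularAt hU hz) ?_ (s₁ z hz)
  rw [hY₁.body_even z hz]
  filter_upwards [hV.mem_nhds (hm hz)] with x hx using s₂ x hx

end SuperMap

/-! ### Coordinates and overlaps of the fatgraph surface. -/

namespace MetricFatgraph

variable {D : Type} [Fintype D] (Γ : MetricFatgraph D)

theorem root_ne_zero (d : D) : Γ.root d ≠ 0 := by
  intro h
  have h1 := Γ.root_pow d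
  rw [h, zero_pow (by have := Γ.three_le d; omega)] at h1
  exact zero_ne_one h1

theorem val_ne_zero (d : D) : (Γ.val d : ℂ) ≠ 0 :=
  Nat.cast_ne_zero.mpr (by have := Γ.three_le d; simp only [val]; omega)

theorem val_next (d : D) : Γ.val (Γ.next d) = Γ.val d :=
  Function.minimalPeriod_apply (Function.minimalPeriod_pos_iff_mem_periodicPts.mp
    (by have := Γ.three_le d; omega))

theorem next_face (d : D) : Γ.next (Γ.face d) = Γ.rev d := by
  simp [face]

theorem val_face (d : D) : Γ.val (Γ.face d) = Γ.val (Γ.rev d) := by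
  rw [← next_face, val_next]

theorem perimeter_pos (d : D) : 0 < Γ.perimeter d := by
  refine Finset.sum_pos (fun i _ => Γ.len_pos _) ?_
  rw [Finset.nonempty_range_iff]
  have h : d ∈ Function.periodicPts Γ.face :=
    Γ.face.injective.mem_periodicPts d
  exact (Function.minimalPeriod_pos_of_mem_periodicPts h).ne'

theorem hasStrictDerivAt_coord (d : D) {z : ℂ} (hz : z ∈ Complex.slitPlane) :
    ∃ c ≠ 0, HasStrictDerivAt (Γ.coord d) c z := by
  have hz0 := Complex.slitPlane_ne_zero hz
  refine ⟨Γ.root d * (2 / (Γ.val d : ℂ) * z ^ (2 / (Γ.val d : ℂ) - 1)), ?_,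
    (Complex.hasStrictDerivAt_cpow_const hz).const_mul _⟩
  refine mul_ne_zero (Γ.root_ne_zero d) (mul_ne_zero (div_ne_zero two_ne_zero (Γ.val_ne_zero d)) ?_)
  rw [Complex.cpow_def_of_ne_zero hz0]
  exact Complex.exp_ne_zero _

theorem isOpen_coord_image (d : D) {V : Set ℂ} (hV : IsOpen V) (hs : V ⊆ Complex.slitPlane) :
    IsOpen (Γ.coord d '' V) := by
  rw [isOpen_iff_mem_nhds]
  rintro _ ⟨z, hz, rfl⟩
  obtain ⟨c, hc, h⟩ := Γ.hasStrictDerivAt_coord d (hs hz)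
  rw [← h.map_nhds_eq hc]
  exact image_mem_map (hV.mem_nhds hz)

/-- Valence at least three gives `2 / m < 1`, so the argument of `z ^ (2 / m)` stays inside the
principal range and the principal powers are inverse to each other. -/
theorem stripCoord_coord (d : D) {z : ℂ} : Γ.stripCoord d (Γ.coord d z) = z := by
  have hv : (3 : ℝ) ≤ Γ.val d := by exact_mod_cast Γ.three_le d
  have him : (Complex.log z * (2 / (Γ.val d : ℂ))).im = Complex.arg z * (2 / Γ.val d) := by
    have : (2 / (Γ.val d : ℂ)) = ((2 / Γ.val d : ℝ) : ℂ) := by push_cast; rfl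
    rw [this, Complex.im_mul_ofReal, Complex.log_im]
  have h0 : 0 < (2 / Γ.val d : ℝ) := by positivity
  have h1 : (2 / Γ.val d : ℝ) < 1 := by rw [div_lt_one (by positivity)]; linarith
  have hp := Real.pi_pos
  rw [stripCoord, coord, mul_div_cancel_left₀ _ (Γ.root_ne_zero d), ← Complex.cpow_mul,
    div_mul_div_cancel₀ (Γ.val_ne_zero d), div_self two_ne_zero, Complex.cpow_one]
  · rw [him]
    nlinarith [Complex.neg_pi_lt_arg z]
  · rw [him]
    nlinarith [Complex.arg_le_pi z]

theorem edgeMap_coord (d : D) (z : ℂ) :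
    Γ.edgeMap d (Γ.coord d z) = Γ.coord (Γ.rev d) ((Γ.len d : ℂ) - z) := by
  rw [edgeMap, stripCoord_coord]

theorem cornerMap_coord (d : D) (z : ℂ) :
    Γ.cornerMap d (Γ.coord d z) = Complex.exp (2 * Real.pi * Complex.I / (Γ.perimeter d : ℂ) *
      ((Γ.offset d : ℂ) + z)) := by
  rw [cornerMap, stripCoord_coord]

theorem isOpen_edgeOverlap (d : D) : IsOpen (Γ.edgeOverlap d) := by
  refine Γ.isOpen_coord_image d ?_ fun z hz => Or.inl hz.1
  exact (isOpen_lt continuous_const Complex.continuous_re).inter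
    (isOpen_lt Complex.continuous_re continuous_const)

theorem isOpen_cornerOverlap (d : D) : IsOpen (Γ.cornerOverlap d) := by
  refine Γ.isOpen_coord_image d ?_ fun z hz => Or.inr hz.1.ne'
  exact (isOpen_lt continuous_const Complex.continuous_im).inter
    ((isOpen_lt continuous_const Complex.continuous_re).inter
    (isOpen_lt Complex.continuous_re continuous_const))

theorem isOpen_tripleOverlap (d : D) : IsOpen (Γ.tripleOverlap d) := by
  refine Γ.isOpen_coord_image d ?_ fun z hz => Or.inr hz.1.ne'
  exact (isOpen_lt continuous_const Complex.continuous_im).inter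
    ((isOpen_lt continuous_const Complex.continuous_re).inter
    (isOpen_lt Complex.continuous_re continuous_const))

theorem tripleOverlap_subset_edgeOverlap (d : D) : Γ.tripleOverlap d ⊆ Γ.edgeOverlap d :=
  Set.image_mono fun _ hz => hz.2

theorem tripleOverlap_subset_cornerOverlap (d : D) : Γ.tripleOverlap d ⊆ Γ.cornerOverlap d :=
  Set.image_mono fun z hz => ⟨hz.1, by have := Γ.len_pos (Γ.next d); linarith [hz.2.1], hz.2.2⟩

theorem mapsTo_edgeMap (d : D) :
    Set.MapsTo (Γ.edgeMap d) (Γ.edgeOverlap d) (Γ.edgeOverlap (Γ.rev d)) := by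
  rintro _ ⟨z, ⟨h1, h2⟩, rfl⟩
  rw [edgeMap_coord]
  refine ⟨_, ⟨?_, ?_⟩, rfl⟩
  · simpa using h2
  · simpa [Γ.len_rev] using h1

/-- The half-edge `rev d` follows `face d` counterclockwise, so the roots differ by `exp (2πi / m)`.
Below the real axis `log (-u) = log u + πi`, which the exponent `2 / m` turns into the same phase.
-/
theorem coord_rev_eq_coord_face (d : D) {u : ℂ} (hu : u.im < 0) :
    Γ.coord (Γ.rev d) u = Γ.coord (Γ.face d) (-u) := by
  have h0 : u ≠ 0 := fun h => by simp [h] at hu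
  have hlog : Complex.log (-u) = Complex.log u + Real.pi * Complex.I := by
    rw [Complex.log, Complex.log, Complex.arg_neg_eq_arg_add_pi_of_im_neg hu, norm_neg]
    push_cast
    ring
  have hr := Γ.root_next (Γ.face d)
  rw [next_face] at hr
  rw [coord, coord, hr, Complex.cpow_def_of_ne_zero h0,
    Complex.cpow_def_of_ne_zero (neg_ne_zero.mpr h0), hlog, ← val_face, add_mul, Complex.exp_add,
    mul_comm (Complex.exp _) (Γ.root _), mul_assoc, mul_comm (Complex.exp _) (Complex.exp _)]
  congr 3
  simp only [val]
  ring

/-- In the stripe of `rev d` the point is `L - z`, in the lower half plane; in the corner chart of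
`face d` it becomes `z - L`, in the upper half plane. -/
theorem mapsTo_edgeMap_tripleOverlap (d : D) :
    Set.MapsTo (Γ.edgeMap d) (Γ.tripleOverlap d) (Γ.cornerOverlap (Γ.face d)) := by
  rintro _ ⟨z, ⟨h1, h2, h3⟩, rfl⟩
  rw [edgeMap_coord, coord_rev_eq_coord_face _ _ (by simpa using h1)]
  refine ⟨_, ⟨by simpa using h1, ?_, ?_⟩, rfl⟩
  · rw [next_face, Γ.len_rev]
    simpa using h2
  · have := Γ.len_pos (Γ.face d)
    simp
    linarith

/-- Chain rule in the stripe coordinate: a zero of `f'` would force `g' = 0`. -/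
theorem deriv_ne_zero_of_comp_coord (d : D) {f g : ℂ → ℂ} {z g' : ℂ} (hz : z ∈ Complex.slitPlane)
    (hf : DifferentiableAt ℂ f (Γ.coord d z)) (h : ∀ x, f (Γ.coord d x) = g x)
    (hg : HasDerivAt g g' z) (hg' : g' ≠ 0) : deriv f (Γ.coord d z) ≠ 0 := by
  obtain ⟨c, -, hc⟩ := Γ.hasStrictDerivAt_coord d hz
  have h1 := hf.hasDerivAt.comp z hc.hasDerivAt
  have h2 : f ∘ Γ.coord d = g := funext h
  rw [h2] at h1
  intro h3
  rw [h3, zero_mul] at h1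
  exact hg' (hg.unique h1)

theorem deriv_edgeMap_ne_zero (d : D) (hf : DifferentiableOn ℂ (Γ.edgeMap d) (Γ.edgeOverlap d)) :
    ∀ w ∈ Γ.edgeOverlap d, deriv (Γ.edgeMap d) w ≠ 0 := by
  rintro _ ⟨z, hz, rfl⟩
  have hs : (Γ.len d : ℂ) - z ∈ Complex.slitPlane := Or.inl (by simpa using hz.2)
  obtain ⟨c, hc, h⟩ := Γ.hasStrictDerivAt_coord (Γ.rev d) hs
  refine Γ.deriv_ne_zero_of_comp_coord d (Or.inl hz.1) (hf.differentiableAt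
    ((Γ.isOpen_edgeOverlap d).mem_nhds ⟨z, hz, rfl⟩)) (Γ.edgeMap_coord d)
    (h.hasDerivAt.comp z ((hasDerivAt_id z).const_sub _)) ?_
  simpa using hc

theorem deriv_cornerMap_ne_zero (d : D)
    (hf : DifferentiableOn ℂ (Γ.cornerMap d) (Γ.cornerOverlap d)) :
    ∀ w ∈ Γ.cornerOverlap d, deriv (Γ.cornerMap d) w ≠ 0 := by
  rintro _ ⟨z, hz, rfl⟩
  refine Γ.deriv_ne_zero_of_comp_coord d (Or.inr hz.1.ne') (hf.differentiableAt
    ((Γ.isOpen_cornerOverlap d).mem_nhds ⟨z, hz, rfl⟩)) (Γ.cornerMap_coord d)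
    ((((hasDerivAt_id z).const_add _).const_mul _).cexp) ?_
  have h1 : (Γ.perimeter d : ℂ) ≠ 0 := Complex.ofReal_ne_zero.mpr (Γ.perimeter_pos d).ne'
  have h2 : (Real.pi : ℂ) ≠ 0 := Complex.ofReal_ne_zero.mpr Real.pi_ne_zero
  refine mul_ne_zero (Complex.exp_ne_zero _) ?_
  rw [mul_one]
  exact div_ne_zero (mul_ne_zero (mul_ne_zero two_ne_zero h2) Complex.I_ne_zero) h1

end MetricFatgraph

/-- Holomorphy of the underlying transition is inherited from `f`, whose body it is, so it need not
be derived from the explicit powers. -/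
theorem GluingFunctions.IsAdmissibleOn.differentiableOn_body {N : ℕ} {G : GluingFunctions N}
    {U : Set ℂ} {f₀ g₀ : ℂ → ℂ} (hU : IsOpen U) (hG : G.IsAdmissibleOn U f₀ g₀) :
    DifferentiableOn ℂ f₀ U := by
  have h : DifferentiableOn ℂ (fun x => Gr.body (G.f x)) U := fun z hz =>
    (AnalyticAt.gr_map (Gr.body (n := N)).toLinearMap
      (hG.differentiable_f.analyticAt (hU.mem_nhds hz))).differentiableWithinAt
  exact h.congr fun z hz => (hG.body_f z hz).symm

/-! ### The corresponding surface and its uniqueness. -/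

namespace FatgraphSupermanifold

variable {D : Type} [Fintype D] {Γ : MetricFatgraph D} {A : FlatConnection Γ} {M : D → ℤ} {N : ℕ}

theorem deriv_edgeMap_ne_zero (X : FatgraphSupermanifold Γ A M N) (d : D) :
    ∀ w ∈ Γ.edgeOverlap d, deriv (Γ.edgeMap d) w ≠ 0 :=
  Γ.deriv_edgeMap_ne_zero d
    ((X.edge_admissible d).differentiableOn_body (Γ.isOpen_edgeOverlap d))

theorem deriv_cornerMap_ne_zero (X : FatgraphSupermanifold Γ A M N) (d : D) :
    ∀ w ∈ Γ.cornerOverlap d, deriv (Γ.cornerMap d) w ≠ 0 :=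
  Γ.deriv_cornerMap_ne_zero d
    ((X.corner_admissible d).differentiableOn_body (Γ.isOpen_cornerOverlap d))

theorem edge_body_ne_zero (d : D) : ∀ w ∈ Γ.edgeOverlap d, (fun _ : ℂ => (A.u d : ℂ)) w ≠ 0 :=
  fun _ _ => Circle.coe_ne_zero _

variable (X : FatgraphSupermanifold Γ A M N) (d : D)

theorem corner_body_ne_zero : ∀ w ∈ Γ.cornerOverlap d,
    (fun w => (X.frame d : ℂ) * Γ.cornerMap d w ^ M d) w ≠ 0 :=
  fun _ _ => mul_ne_zero (Circle.coe_ne_zero _) (zpow_ne_zero _ (Complex.exp_ne_zero _))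

theorem edge_n2gluing : (X.edge d).n2gluing.IsAdmissibleOn (Γ.edgeOverlap d) :=
  (X.edge_admissible d).n2gluing (Γ.isOpen_edgeOverlap d) (X.deriv_edgeMap_ne_zero d)
    (edge_body_ne_zero d)

theorem corner_n2gluing : (X.corner d).n2gluing.IsAdmissibleOn (Γ.cornerOverlap d) :=
  (X.corner_admissible d).n2gluing (Γ.isOpen_cornerOverlap d) (X.deriv_cornerMap_ne_zero d)
    (X.corner_body_ne_zero d)

theorem edge_n2_holomorphic :
    (X.edge d).n2gluing.toSuperMap.IsHolomorphicOn (Γ.edgeOverlap d) (Γ.edgeMap d) :=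
  (X.edge_admissible d).n2gluing_holomorphic (Γ.isOpen_edgeOverlap d) (X.deriv_edgeMap_ne_zero d)
    (edge_body_ne_zero d)

theorem corner_n2_holomorphic :
    (X.corner d).n2gluing.toSuperMap.IsHolomorphicOn (Γ.cornerOverlap d) (Γ.cornerMap d) :=
  (X.corner_admissible d).n2gluing_holomorphic (Γ.isOpen_cornerOverlap d)
    (X.deriv_cornerMap_ne_zero d) (X.corner_body_ne_zero d)

theorem edge_n2_superconformal :
    IsSuperconformalOn (X.edge d).n2gluing.toSuperMap (Γ.edgeOverlap d) :=
  N2Functions.isSuperconformalOn_toSuperMap (Γ.isOpen_edgeOverlap d) (X.edge_n2gluing d)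

theorem corner_n2_superconformal :
    IsSuperconformalOn (X.corner d).n2gluing.toSuperMap (Γ.cornerOverlap d) :=
  N2Functions.isSuperconformalOn_toSuperMap (Γ.isOpen_cornerOverlap d) (X.corner_n2gluing d)

theorem chiral_comp_edge :
    ((chiral N).comp (X.edge d).n2gluing.toSuperMap).EqOn
      ((X.edge d).toSuperMap.comp (chiral N)) (Γ.edgeOverlap d) :=
  (X.edge_admissible d).chiral_comp_n2gluing (Γ.isOpen_edgeOverlap d) (X.deriv_edgeMap_ne_zero d)
    (edge_body_ne_zero d)

theorem chiral_comp_corner :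
    ((chiral N).comp (X.corner d).n2gluing.toSuperMap).EqOn
      ((X.corner d).toSuperMap.comp (chiral N)) (Γ.cornerOverlap d) :=
  (X.corner_admissible d).chiral_comp_n2gluing (Γ.isOpen_cornerOverlap d)
    (X.deriv_cornerMap_ne_zero d) (X.corner_body_ne_zero d)

theorem edge_holomorphic :
    (X.edge d).toSuperMap.IsHolomorphicOn (Γ.edgeOverlap d) (Γ.edgeMap d) :=
  (X.edge_admissible d).toSuperMap_holomorphic (Γ.isOpen_edgeOverlap d) (edge_body_ne_zero d)

theorem corner_holomorphic :
    (X.corner d).toSuperMap.IsHolomorphicOn (Γ.cornerOverlap d) (Γ.cornerMap d) :=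
  (X.corner_admissible d).toSuperMap_holomorphic (Γ.isOpen_cornerOverlap d)
    (X.corner_body_ne_zero d)

/-- The `N = 2` super Riemann surface which corresponds to `X`. -/
def n2Surface : N2SuperRiemannSurface Γ N where
  edge d := (X.edge d).n2gluing.toSuperMap
  corner d := (X.corner d).n2gluing.toSuperMap
  edge_holomorphic := X.edge_n2_holomorphic
  corner_holomorphic := X.corner_n2_holomorphic
  edge_superconformal := X.edge_n2_superconformal
  corner_superconformal := X.corner_n2_superconformal
  -- The inverse condition is lifted with the identity as third map.
  edge_rev d := SuperMap.comp_eqOn_of_chiral (Γ.isOpen_edgeOverlap d)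
    (Γ.isOpen_edgeOverlap (Γ.rev d)) (Γ.mapsTo_edgeMap d) (X.edge_n2_holomorphic d)
    (X.edge_n2_holomorphic (Γ.rev d)) (fun _ _ => SuperMap.isRegularAt_id) (X.edge_holomorphic d)
    (X.edge_holomorphic (Γ.rev d)) (fun _ hz => (X.edge_n2_superconformal d).plus hz)
    (fun _ hz => (X.edge_n2_superconformal (Γ.rev d)).plus hz)
    (fun _ _ => SuperMap.preservesAt_id) (X.chiral_comp_edge d) (X.chiral_comp_edge (Γ.rev d))
    SuperMap.chiral_comp_id (X.edge_rev d)
  cocycle d :=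
    have h₁ := Γ.tripleOverlap_subset_edgeOverlap d
    have h₂ := Γ.tripleOverlap_subset_cornerOverlap d
    -- On the triple overlap the edge and corner data are restricted from larger sets, while the
    -- second factor lives on the whole corner of `face d`.
    SuperMap.comp_eqOn_of_chiral (Γ.isOpen_tripleOverlap d)
      (Γ.isOpen_cornerOverlap (Γ.face d)) (Γ.mapsTo_edgeMap_tripleOverlap d)
      ((X.edge_n2_holomorphic d).mono h₁) (X.corner_n2_holomorphic (Γ.face d))
      (fun _ hz => (X.corner_n2_holomorphic d).isRegularAt (Γ.isOpen_cornerOverlap d) (h₂ hz))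
      ((X.edge_holomorphic d).mono h₁) (X.corner_holomorphic (Γ.face d))
      (fun _ hz => (X.edge_n2_superconformal d).plus (h₁ hz))
      (fun _ hz => (X.corner_n2_superconformal (Γ.face d)).plus hz)
      (fun _ hz => (X.corner_n2_superconformal d).plus (h₂ hz))
      ((X.chiral_comp_edge d).mono h₁) (X.chiral_comp_corner (Γ.face d))
      ((X.chiral_comp_corner d).mono h₂) (X.cocycle d)

end FatgraphSupermanifold

theorem SuperMap.eqOn_of_chiral {N : ℕ} {Φ Φ' : SuperMap N 2 2} {U : Set ℂ} {f₀ : ℂ → ℂ}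
    (hU : IsOpen U) (hΦ : Φ.IsHolomorphicOn U f₀) (hΦ' : Φ'.IsHolomorphicOn U f₀)
    (s : IsSuperconformalOn Φ U) (s' : IsSuperconformalOn Φ' U)
    (h : ((chiral N).comp Φ).EqOn ((chiral N).comp Φ') U) : Φ.EqOn Φ' U :=
  eqOn_of_forall fun _ hz => eq_of_chiral_comp_eq (hΦ.isRegularAt hU hz) (hΦ'.isRegularAt hU hz)
    (s.plus hz) (s'.plus hz) (h.1.eventuallyEq_of_mem (hU.mem_nhds hz))
    ((h.2 0).eventuallyEq_of_mem (hU.mem_nhds hz))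

end

theorem mainTheorem8 {D : Type} [Fintype D] (Γ : MetricFatgraph D) (A : FlatConnection Γ)
    (M : D → ℤ) (hM : ∀ d, M (Γ.face d) = M d) (N : ℕ) (X : FatgraphSupermanifold Γ A M N) :
    (∀ d, (X.edge d).n2gluing.IsAdmissibleOn (Γ.edgeOverlap d)) ∧
    (∀ d, ∃ T : Functions11 N, T.IsAdmissibleOn (Γ.edgeOverlap d) ∧
      T.toSuperMap.EqOn (X.edge d).toSuperMap (Γ.edgeOverlap d) ∧
      T.drs.EqOn (X.edge d).n2gluing (Γ.edgeOverlap d)) ∧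
    ∃ Y : N2SuperRiemannSurface Γ N,
      (∀ d, (Y.edge d).EqOn (X.edge d).n2gluing.toSuperMap (Γ.edgeOverlap d)) ∧
      Corresponds Y X ∧
      ∀ Y' : N2SuperRiemannSurface Γ N, Corresponds Y' X →
        (∀ d, (Y'.edge d).EqOn (Y.edge d) (Γ.edgeOverlap d)) ∧
        (∀ d, (Y'.corner d).EqOn (Y.corner d) (Γ.cornerOverlap d)) := by
  refine ⟨X.edge_n2gluing, fun d => ⟨(X.edge d).functions11, ?_, ?_, ?_⟩, X.n2Surface,
    fun d => ⟨fun _ _ => rfl, fun _ _ _ => rfl⟩, ⟨X.chiral_comp_edge, X.chiral_comp_corner⟩,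
    fun Y' hY' => ⟨fun d => ?_, fun d => ?_⟩⟩
  · exact (X.edge_admissible d).functions11 (Γ.isOpen_edgeOverlap d)
      (FatgraphSupermanifold.edge_body_ne_zero d)
  · exact (X.edge_admissible d).functions11_toSuperMap (Γ.isOpen_edgeOverlap d)
      (FatgraphSupermanifold.edge_body_ne_zero d)
  · exact (X.edge_admissible d).functions11_drs (Γ.isOpen_edgeOverlap d)
      (FatgraphSupermanifold.edge_body_ne_zero d)
  -- Both surfaces have the quotient `X`, and a superconformal transition is determined by its
  -- quotient.
  · exact SuperMap.eqOn_of_chiral (Γ.isOpen_edgeOverlap d) (Y'.edge_holomorphic d)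
      (X.edge_n2_holomorphic d) (Y'.edge_superconformal d) (X.edge_n2_superconformal d)
      ((hY'.1 d).trans (X.chiral_comp_edge d).symm)
  · exact SuperMap.eqOn_of_chiral (Γ.isOpen_cornerOverlap d) (Y'.corner_holomorphic d)
      (X.corner_n2_holomorphic d) (Y'.corner_superconformal d) (X.corner_n2_superconformal d)
      ((hY'.2 d).trans (X.chiral_comp_corner d).symm)
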